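/- Let $X$ be a compact connected Riemann surface of genus $g\ge 2$, let $\mathcal K$ be its canonical bundle, let $\mathcal K^{1/2}$ be a holomorphic line bundle with a fixed isomorphism $\mathcal K^{1/2}\otimes\mathcal K^{1/2}\simeq\mathcal K$, and let $t$ be any holomorphic section of $\mathcal K^{3/2}=\mathcal K^{1/2}\otimes\mathcal K$. Consider the Higgs bundle $$\mathcal E=\mathcal K^{1/2}\oplus\mathcal O\oplus\mathcal K^{-1/2},\qquad \Phi=\begin{pmatrix}0&t&0\\0&0&t\\ \tau&0&0\end{pmatrix},$$ where $\tau$ is the tautological section of $\mathrm{Hom}(\mathcal K^{1/2},\mathcal K^{-1/2})\otimes\mathcal K\simeq\mathcal O$ (the section $1$). Let $H$ be a harmonic metric, that is, a smooth Hermitian metric on $\mathcal E$ whose Chern connection $\nabla$ satisfies Hitchin's equation $F_\nabla+[\Phi,\Phi^{*H}]=0$, and let a Hermitian metric on $X$ (that is, on its holomorphic tangent bundle) be given. Let $\|\tau\|$ be the norm of $\tau$ as a section of $\mathrm{Hom}(\mathcal K^{1/2},\mathcal K^{-1/2})\otimes\mathcal K$, and let $\|t\|$ be the norm of $t$, either as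 a section of $\mathrm{Hom}(\mathcal O,\mathcal K^{1/2})\otimes\mathcal K$ or as a section of $\mathrm{Hom}(\mathcal K^{-1/2},\mathcal O)\otimes\mathcal K$; these norms are induced by the restrictions of $H$ to the three summands of $\mathcal E$ and by the metric on $X$. Then, with either meaning of $\|t\|$, $$\|t\|<\|\tau\|\quad\text{at every point of } X.$$ -/

import Mathlib

open scoped Manifold ContDiff Bundle Matrix

noncomputable section

/-- The Wirtinger derivative `∂f/∂z = (∂f/∂x - i ∂f/∂y) / 2`. -/
def wirtingerZ (f : ℂ → ℂ) (z : ℂ) : ℂ :=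
  (fderiv ℝ f z 1 - Complex.I * fderiv ℝ f z Complex.I) / 2

/-- The Wirtinger derivative `∂f/∂z̄ = (∂f/∂x + i ∂f/∂y) / 2`. -/
def wirtingerZBar (f : ℂ → ℂ) (z : ℂ) : ℂ :=
  (fderiv ℝ f z 1 + Complex.I * fderiv ℝ f z Complex.I) / 2

/-- Entrywise `∂/∂z` of a matrix of functions. -/
def matrixDZ {n : ℕ} (M : ℂ → Matrix (Fin n) (Fin n) ℂ) (z : ℂ) : Matrix (Fin n) (Fin n) ℂ :=
  Matrix.of fun i j => wirtingerZ (fun w => M w i j) z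

/-- Entrywise `∂/∂z̄` of a matrix of functions. -/
def matrixDZBar {n : ℕ} (M : ℂ → Matrix (Fin n) (Fin n) ℂ) (z : ℂ) : Matrix (Fin n) (Fin n) ℂ :=
  Matrix.of fun i j => wirtingerZBar (fun w => M w i j) z

/-- The curvature of the Chern connection of a Hermitian metric whose Gram matrix in a holomorphic
frame is `G`, with `G i j = ⟨e i, e j⟩` conjugate-linear in `e i`: the connection form is
`G⁻¹ ∂G`, its curvature is `∂̄(G⁻¹ ∂G)`, and this is the coefficient of `dz ∧ dz̄` in it. -/
def chernCurvatureMatrix {n : ℕ} (G : ℂ → Matrix (Fin n) (Fin n) ℂ) (z : ℂ) :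
    Matrix (Fin n) (Fin n) ℂ :=
  -matrixDZBar (fun w => (G w)⁻¹ * matrixDZ G w) z

section Bundles

variable {X : Type*} [TopologicalSpace X] [ChartedSpace ℂ X]

/-- A smooth Hermitian metric on a holomorphic vector bundle `E` over a Riemann surface `X`
(conjugate-linear in the first variable). Smoothness means that the pairing of any two local
holomorphic sections is a `C^∞` function in the real sense. -/
structure HermitianMetric (F : Type*) [NormedAddCommGroup F] [NormedSpace ℂ F]
    (E : X → Type*) [TopologicalSpace (Bundle.TotalSpace F E)] [∀ x, AddCommGroup (E x)]
    [∀ x, Module ℂ (E x)] [∀ x, TopologicalSpace (E x)] [FiberBundle F E] where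
  /-- the scalar product on the fiber over `x` -/
  form : ∀ x, E x →ₗ⋆[ℂ] E x →ₗ[ℂ] ℂ
  conj_symm : ∀ x u v, starRingEnd ℂ (form x u v) = form x v u
  pos : ∀ x v, v ≠ 0 → 0 < (form x v v).re
  smooth : ∀ U : Set X, IsOpen U → ∀ s s' : (x : X) → E x,
    ContMDiffOn 𝓘(ℂ) (𝓘(ℂ).prod 𝓘(ℂ, F)) ω (fun x => Bundle.TotalSpace.mk' F x (s x)) U →
    ContMDiffOn 𝓘(ℂ) (𝓘(ℂ).prod 𝓘(ℂ, F)) ω (fun x => Bundle.TotalSpace.mk' F x (s' x)) U →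
    ContMDiffOn 𝓘(ℝ, ℂ) 𝓘(ℝ, ℂ) ∞ (fun x => form x (s x) (s' x)) U

section General

variable {F : Type*} [NormedAddCommGroup F] [NormedSpace ℂ F]
  {E : X → Type*} [TopologicalSpace (Bundle.TotalSpace F E)] [∀ x, AddCommGroup (E x)]
  [∀ x, Module ℂ (E x)] [∀ x, TopologicalSpace (E x)] [FiberBundle F E]

/-- The norm on the fiber over `x` of a Hermitian metric. -/
def HermitianMetric.fiberNorm (h : HermitianMetric F E) (x : X) (v : E x) : ℝ :=
  Real.sqrt (h.form x v v).re

/-- The Gram matrix of the sections `e`, read in the chart `φ`. -/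
def HermitianMetric.gram (h : HermitianMetric F E) (φ : OpenPartialHomeomorph X ℂ) {n : ℕ}
    (e : Fin n → (x : X) → E x) (z : ℂ) : Matrix (Fin n) (Fin n) ℂ :=
  Matrix.of fun i j => h.form (φ.symm z) (e i (φ.symm z)) (e j (φ.symm z))

/-- The coordinate vector `∂/∂z` of the chart `φ` at the point of coordinate `z`. -/
def coordVector (φ : OpenPartialHomeomorph X ℂ) (z : ℂ) : TangentSpace 𝓘(ℂ) (φ.symm z) :=
  mfderiv 𝓘(ℂ) 𝓘(ℂ) φ.symm z (1 : ℂ)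

/-- The matrix `A` of the coefficient of `dz` of an `End E`-valued `(1,0)`-form `Φ = A dz`, in the
chart `φ` and the local frame `e`. -/
def higgsMatrix (Φ : ∀ x, TangentSpace 𝓘(ℂ) x →ₗ[ℂ] Module.End ℂ (E x))
    (φ : OpenPartialHomeomorph X ℂ) {n : ℕ} {e : Fin n → (x : X) → E x} {U : Set X}
    (he : IsLocalFrameOn 𝓘(ℂ) F ω e U) (z : ℂ) : Matrix (Fin n) (Fin n) ℂ :=
  Matrix.of fun i j =>
    he.coeff i (φ.symm z) (Φ (φ.symm z) (coordVector φ z) (e j (φ.symm z)))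

/-- Hitchin's equation `F_h + [Φ, Φ^{*h}] = 0` for the Chern connection of the Hermitian metric `h`
and the Higgs field `Φ`. In a holomorphic chart and a local holomorphic frame with Gram matrix `G`,
if `Φ = A dz` then `Φ^{*h} = A* dz̄`, where `A* = G⁻¹ Aᴴ G` is the `h`-adjoint of `A`, and
`[Φ, Φ^{*h}] = Φ ∧ Φ^{*h} + Φ^{*h} ∧ Φ = (A A* - A* A) dz ∧ dz̄`. -/
def SolvesHitchin (h : HermitianMetric F E)
    (Φ : ∀ x, TangentSpace 𝓘(ℂ) x →ₗ[ℂ] Module.End ℂ (E x)) : Prop :=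
  ∀ φ ∈ IsManifold.maximalAtlas 𝓘(ℂ) ω X, ∀ U : Set X, IsOpen U → U ⊆ φ.source →
    ∀ (n : ℕ) (e : Fin n → (x : X) → E x) (he : IsLocalFrameOn 𝓘(ℂ) F ω e U),
    ∀ z ∈ φ.target, φ.symm z ∈ U →
      chernCurvatureMatrix (h.gram φ e) z +
        (higgsMatrix Φ φ he z * ((h.gram φ e z)⁻¹ * (higgsMatrix Φ φ he z)ᴴ * h.gram φ e z) -
          ((h.gram φ e z)⁻¹ * (higgsMatrix Φ φ he z)ᴴ * h.gram φ e z) * higgsMatrix Φ φ he z) = 0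

end General

/-- The norm of an element `A` of `Hom(V, W) ⊗ T^*`, seen as a bilinear map `T × V → W`, induced by
norms `nT`, `nV`, `nW` on complex lines `T`, `V`, `W`: the smallest `C ≥ 0` with
`|A v u| ≤ C |v| |u|` for all `v`, `u`. -/
def twistedHomNorm {T V W : Type*} (nT : T → ℝ) (nV : V → ℝ) (nW : W → ℝ) (A : T → V → W) : ℝ :=
  sInf {C : ℝ | 0 ≤ C ∧ ∀ v u, nW (A v u) ≤ C * nT v * nV u}

/-- The canonical bundle `K = Hom(TX, ℂ)`. -/
abbrev CanonicalBundle (X : Type*) [TopologicalSpace X] [ChartedSpace ℂ X] : X → Type _ :=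
  fun x => TangentSpace 𝓘(ℂ) x →L[ℂ] Bundle.Trivial X ℂ x

variable [IsManifold 𝓘(ℂ) ω X]

variable (X) in
/-- The genus of a compact Riemann surface: the dimension of its space of holomorphic one-forms,
that is of holomorphic sections of the canonical bundle `K = Hom(TX, ℂ)`. -/
def riemannSurfaceGenus : ℕ :=
  Module.finrank ℂ Cₛ^ω⟮𝓘(ℂ); ℂ →L[ℂ] ℂ, CanonicalBundle X⟯

variable (L : X → Type*) [TopologicalSpace (Bundle.TotalSpace ℂ L)] [∀ x, AddCommGroup (L x)]
  [∀ x, Module ℂ (L x)] [∀ x, TopologicalSpace (L x)] [∀ x, IsTopologicalAddGroup (L x)]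
  [∀ x, ContinuousSMul ℂ (L x)] [FiberBundle ℂ L] [VectorBundle ℂ ℂ L]

/-- An isomorphism `L ⊗ L ≅ K` of holomorphic line bundles, which makes `L` a square root of the
canonical bundle `K`: bilinear maps `L x × L x → K x` that induce an isomorphism
`L x ⊗ L x ≅ K x` for every `x`, and that send local holomorphic sections of `L` to
local holomorphic sections of `K`. -/
structure CanonicalSquareRoot where
  /-- the multiplication `L x × L x → K x` -/
  mul : ∀ x, L x →ₗ[ℂ] L x →L[ℂ] CanonicalBundle X x
  bijective : ∀ x, Function.Bijective
    (TensorProduct.lift (ContinuousLinearMap.coeLM ℂ ∘ₗ mul x))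
  holomorphic : ∀ U : Set X, IsOpen U → ∀ a b : (x : X) → L x,
    ContMDiffOn 𝓘(ℂ) (𝓘(ℂ).prod 𝓘(ℂ, ℂ)) ω (fun x => Bundle.TotalSpace.mk' ℂ x (a x)) U →
    ContMDiffOn 𝓘(ℂ) (𝓘(ℂ).prod 𝓘(ℂ, ℂ)) ω (fun x => Bundle.TotalSpace.mk' ℂ x (b x)) U →
    ContMDiffOn 𝓘(ℂ) (𝓘(ℂ).prod 𝓘(ℂ, ℂ →L[ℂ] ℂ)) ω
      (fun x => Bundle.TotalSpace.mk' (ℂ →L[ℂ] ℂ) x (mul x (a x) (b x))) U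

/-- The dual line bundle `L⁻¹`. -/
abbrev DualLine : X → Type _ := fun x => L x →L[ℂ] Bundle.Trivial X ℂ x

/-- The holomorphic vector bundle `L ⊕ 𝒪 ⊕ L⁻¹`. -/
abbrev RankThreeBundle : X → Type _ := L ×ᵇ (Bundle.Trivial X ℂ ×ᵇ DualLine L)

/-- The model fiber of `L ⊕ 𝒪 ⊕ L⁻¹`. -/
abbrev RankThreeFiber : Type := ℂ × (ℂ × (ℂ →L[ℂ] ℂ))

variable {L}

/-- The tautological section `τ` of `Hom(L, L⁻¹) ⊗ K`: the image `τ(v) a` of `a` is the functional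
`b ↦ (a b)(v)`, where `a b` is the product in `K`. -/
def CanonicalSquareRoot.tau (S : CanonicalSquareRoot L) (x : X) :
    TangentSpace 𝓘(ℂ) x →ₗ[ℂ] L x →ₗ[ℂ] DualLine L x :=
  LinearMap.mk₂ ℂ
    (fun v a => (⟨⟨⟨fun b => S.mul x a b v, by intros; simp⟩, by intros; simp⟩, by
      exact (continuous_eval_const v).comp (S.mul x a).continuous⟩ : DualLine L x))
    (by intros; ext; simp) (by intros; ext; simp) (by intros; ext; simp) (by intros; ext; simp)

/-- The section `t` of `L ⊗ K = Hom(TX, L)` as a section of `Hom(𝒪, L) ⊗ K`. -/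
def tUpper (t : Cₛ^ω⟮𝓘(ℂ); ℂ →L[ℂ] ℂ, fun x : X => TangentSpace 𝓘(ℂ) x →L[ℂ] L x⟯) (x : X) :
    TangentSpace 𝓘(ℂ) x →ₗ[ℂ] Bundle.Trivial X ℂ x →ₗ[ℂ] L x :=
  LinearMap.mk₂ ℂ (fun v (b : ℂ) => b • t x v)
    (by intros; simp) (by intros; rw [map_smul, smul_comm]) (by intros; simp [add_smul])
    (by intros; simp [mul_smul])

/-- The section `t` of `L ⊗ K = Hom(TX, L)` as a section of `Hom(L⁻¹, 𝒪) ⊗ K`. -/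
def tLower (t : Cₛ^ω⟮𝓘(ℂ); ℂ →L[ℂ] ℂ, fun x : X => TangentSpace 𝓘(ℂ) x →L[ℂ] L x⟯) (x : X) :
    TangentSpace 𝓘(ℂ) x →ₗ[ℂ] DualLine L x →ₗ[ℂ] Bundle.Trivial X ℂ x :=
  LinearMap.mk₂ ℂ (fun v c => c (t x v))
    (by intros; simp) (by intros; simp) (by intros; simp) (by intros; simp)

/-- The Higgs field on `L ⊕ 𝒪 ⊕ L⁻¹` with matrix `((0, t, 0), (0, 0, t), (τ, 0, 0))`. -/
def cyclicHiggsField (S : CanonicalSquareRoot L)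
    (t : Cₛ^ω⟮𝓘(ℂ); ℂ →L[ℂ] ℂ, fun x : X => TangentSpace 𝓘(ℂ) x →L[ℂ] L x⟯) (x : X) :
    TangentSpace 𝓘(ℂ) x →ₗ[ℂ] Module.End ℂ (RankThreeBundle L x) :=
  LinearMap.mk₂ ℂ (fun v p => (tUpper t x v p.2.1, tLower t x v p.2.2, S.tau x v p.1))
    (by intros; simp) (by intros; simp) (by intros; simp)
    (fun c v p => Prod.ext (map_smul (tUpper t x v) c p.2.1)
      (Prod.ext (map_smul (tLower t x v) c p.2.2) (map_smul (S.tau x v) c p.1)))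

/-- The norm of `τ` in `Hom(L, L⁻¹) ⊗ K` for the metric `H` on `L ⊕ 𝒪 ⊕ L⁻¹`, restricted to the
summands, and the metric `g` on `X`. -/
def normTau (H : HermitianMetric RankThreeFiber (RankThreeBundle L))
    (g : HermitianMetric ℂ (TangentSpace 𝓘(ℂ) : X → Type)) (S : CanonicalSquareRoot L) (x : X) : ℝ :=
  twistedHomNorm (g.fiberNorm x) (fun a : L x => H.fiberNorm x (a, 0, 0))
    (fun c : DualLine L x => H.fiberNorm x (0, 0, c)) (fun v a => S.tau x v a)

/-- The norm of `t` as a section of `Hom(𝒪, L) ⊗ K`, for the same metrics. -/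
def normTUpper (H : HermitianMetric RankThreeFiber (RankThreeBundle L))
    (g : HermitianMetric ℂ (TangentSpace 𝓘(ℂ) : X → Type))
    (t : Cₛ^ω⟮𝓘(ℂ); ℂ →L[ℂ] ℂ, fun x : X => TangentSpace 𝓘(ℂ) x →L[ℂ] L x⟯) (x : X) : ℝ :=
  twistedHomNorm (g.fiberNorm x) (fun b : Bundle.Trivial X ℂ x => H.fiberNorm x (0, b, 0))
    (fun a : L x => H.fiberNorm x (a, 0, 0)) (fun v b => tUpper t x v b)

/-- The norm of `t` as a section of `Hom(L⁻¹, 𝒪) ⊗ K`, for the same metrics. -/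
def normTLower (H : HermitianMetric RankThreeFiber (RankThreeBundle L))
    (g : HermitianMetric ℂ (TangentSpace 𝓘(ℂ) : X → Type))
    (t : Cₛ^ω⟮𝓘(ℂ); ℂ →L[ℂ] ℂ, fun x : X => TangentSpace 𝓘(ℂ) x →L[ℂ] L x⟯) (x : X) : ℝ :=
  twistedHomNorm (g.fiberNorm x) (fun c : DualLine L x => H.fiberNorm x (0, 0, c))
    (fun b : Bundle.Trivial X ℂ x => H.fiberNorm x (0, b, 0)) (fun v c => tLower t x v c)

end Bundles

end

/-! In a local frame adapted to the three summands, let h₀, h₁, h₂ be the squared lengths of the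
frame vectors and p, q the coefficients of t and τ.

Suppose first that H is diagonal. Put a = |p|² h₀/h₁, b = |p|² h₁/h₂, c = |q|² h₂/h₀. Hitchin's
equation becomes the Toda system Δ log hᵢ = 4 (a - c, b - a, c - b)ᵢ. The two possible squares of
‖t‖/‖τ‖ are ρ = a/c and ρ = b/c; since log |p|² and log |q|² are harmonic, both satisfy Δ log ρ = 12
c (ρ - 1) away from the zeros of t. If the maximum of ρ were at least 1, the strong maximum
principle (`eventually_eq_zero_of_planeLaplacian_ge`, used in `eventually_eq_of_planeLaplacian_log`)
would make ρ constant on X. Then t would have no zero, and t²τ would be a nowhere vanishing section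
of K³. As the genus is at least 2, some nonzero one-form w vanishes at a point; w³/(t²τ) would be a
holomorphic function on the compact X, hence constant, hence zero, a contradiction
(`HasCyclicReadings.ratio_lt_one`).

It remains to see that H is diagonal (`HasCyclicReadings.offDiag_eq_zero`). This is proved by a
Bochner argument rather than by uniqueness of the harmonic metric. For a primitive cube root of
unity ζ, the gauge transformation γ = diag(1, ζ, ζ²) satisfies Φγ = ζγΦ. By
`wirtingerZBar_wirtingerZ_gramNormSq`, |γ|² is subharmonic, hence constant, so both squares in the
Bochner formula vanish: the adjoint W of γ is holomorphic and WΦ = ζΦW. The entry of W from L to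
L⁻¹, and the squares of its entries from L to 𝒪 and from 𝒪 to L⁻¹, are sections of K⁻¹;
multiplication by one-forms with a zero shows that they vanish. The relation with Φ then kills the
upper entries, and a diagonal adjoint of γ, whose eigenvalues are distinct, means that the summands
are orthogonal. -/

noncomputable section

open Filter Topology Metric

set_option linter.unusedSectionVars false

/-! ### The strong maximum principle in the plane, by a Hopf barrier. -/

section StrongMaximumPrinciple

/-- The second derivative of `f` at `z` in the direction `v`. -/
def secondDeriv (f : ℂ → ℝ) (v z : ℂ) : ℝ := fderiv ℝ (fun w => fderiv ℝ f w v) z v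

/-- A positive second derivative would make the point a local minimum too; the function would be
locally constant and its second derivative zero. -/
lemma deriv_deriv_nonpos_of_isLocalMax {g : ℝ → ℝ} {a : ℝ} (hg : ContinuousAt g a)
    (h : IsLocalMax g a) : deriv (deriv g) a ≤ 0 := by
  by_contra! hpos
  have h1 : IsLocalMin g a := isLocalMin_of_deriv_deriv_pos hpos h.deriv_eq_zero hg
  have h2 : g =ᶠ[𝓝 a] fun _ => g a := by
    filter_upwards [h, h1] with x hx hx'
    exact le_antisymm hx hx'
  have h3 : deriv (deriv g) a = 0 := by
    rw [h2.deriv.deriv_eq]; simp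
  exact hpos.ne' h3

lemma secondDeriv_eq_deriv {f : ℂ → ℝ} {z : ℂ} (hf : ContDiffAt ℝ 2 f z) (v : ℂ) :
    deriv (deriv fun t : ℝ => f (z + t * v)) 0 = secondDeriv f v z := by
  have hline : ∀ t : ℝ, HasDerivAt (fun t : ℝ => z + t * v) v t := fun t => by
    simpa using ((Complex.ofRealCLM.hasDerivAt (x := t)).mul_const v).const_add z
  have hcont : ContinuousAt (fun t : ℝ => z + t * v) 0 := (hline 0).continuousAt
  have h1 : ∀ᶠ w in 𝓝 z, DifferentiableAt ℝ f w := by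
    filter_upwards [hf.eventually (by simp)] with w hw
    exact hw.differentiableAt (by simp)
  have h2 : (deriv fun t : ℝ => f (z + t * v)) =ᶠ[𝓝 0] fun t : ℝ => fderiv ℝ f (z + t * v) v := by
    have : Tendsto (fun t : ℝ => z + t * v) (𝓝 0) (𝓝 z) := by simpa [ContinuousAt] using hcont
    filter_upwards [this.eventually h1] with t ht
    exact (ht.hasFDerivAt.comp_hasDerivAt t (hline t)).deriv
  rw [h2.deriv_eq]
  have h3 : DifferentiableAt ℝ (fun w => fderiv ℝ f w v) z :=
    ((hf.fderiv_right (m := 1) (by norm_num)).differentiableAt (by simp)).clm_apply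
      (differentiableAt_const v)
  have h4 : HasFDerivAt (fun w => fderiv ℝ f w v) (fderiv ℝ (fun w => fderiv ℝ f w v) z)
      (z + (0 : ℝ) * v) := by simpa using h3.hasFDerivAt
  exact (h4.comp_hasDerivAt (0 : ℝ) (hline 0)).deriv

lemma secondDeriv_nonpos_of_isLocalMax {f : ℂ → ℝ} {z : ℂ} (hf : ContDiffAt ℝ 2 f z)
    (h : IsLocalMax f z) (v : ℂ) : secondDeriv f v z ≤ 0 := by
  rw [← secondDeriv_eq_deriv hf]
  have hcont : ContinuousAt (fun t : ℝ => z + t * v) 0 := by fun_prop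
  have ht : Tendsto (fun t : ℝ => z + t * v) (𝓝 0) (𝓝 z) := by simpa [ContinuousAt] using hcont
  apply deriv_deriv_nonpos_of_isLocalMax
  · exact ContinuousAt.comp (by simpa using hf.continuousAt) hcont
  · have := ht.eventually h
    simpa [IsLocalMax, IsMaxFilter] using this

lemma secondDeriv_add {f g : ℂ → ℝ} {z : ℂ} (hf : ContDiffAt ℝ 2 f z) (hg : ContDiffAt ℝ 2 g z)
    (v : ℂ) : secondDeriv (fun w => f w + g w) v z = secondDeriv f v z + secondDeriv g v z := by
  have key : ∀ {f : ℂ → ℝ}, ContDiffAt ℝ 2 f z →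
      DifferentiableAt ℝ (fun w => fderiv ℝ f w v) z := fun hf =>
    ((hf.fderiv_right (m := 1) (by norm_num)).differentiableAt (by simp)).clm_apply
      (differentiableAt_const v)
  have h1 : (fun w => fderiv ℝ (fun w => f w + g w) w v) =ᶠ[𝓝 z]
      fun w => fderiv ℝ f w v + fderiv ℝ g w v := by
    filter_upwards [hf.eventually (by simp), hg.eventually (by simp)] with w hw hw'
    rw [fderiv_fun_add (hw.differentiableAt (by simp)) (hw'.differentiableAt (by simp))]; rfl
  simp only [secondDeriv]
  rw [h1.fderiv_eq, fderiv_fun_add (key hf) (key hg)]; rfl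

/-- The Laplacian of a function on the plane. -/
def planeLaplacian (f : ℂ → ℝ) (z : ℂ) : ℝ := secondDeriv f 1 z + secondDeriv f Complex.I z

lemma planeLaplacian_nonpos_of_isLocalMax {f : ℂ → ℝ} {z : ℂ} (hf : ContDiffAt ℝ 2 f z)
    (h : IsLocalMax f z) : planeLaplacian f z ≤ 0 :=
  add_nonpos (secondDeriv_nonpos_of_isLocalMax hf h 1) (secondDeriv_nonpos_of_isLocalMax hf h _)

lemma planeLaplacian_add {f g : ℂ → ℝ} {z : ℂ} (hf : ContDiffAt ℝ 2 f z)
    (hg : ContDiffAt ℝ 2 g z) :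
    planeLaplacian (fun w => f w + g w) z = planeLaplacian f z + planeLaplacian g z := by
  simp only [planeLaplacian, secondDeriv_add hf hg]; ring

/-- The barrier function of the strong maximum principle. -/
def gaussianBarrier (ε k c : ℝ) (y z : ℂ) : ℝ :=
  ε * (Real.exp (-k * ((z.re - y.re) ^ 2 + (z.im - y.im) ^ 2)) - c)

lemma contDiff_gaussianBarrier (ε k c : ℝ) (y : ℂ) : ContDiff ℝ 2 (gaussianBarrier ε k c y) := by
  have h1 : ContDiff ℝ 2 (fun z : ℂ => z.re) := Complex.reCLM.contDiff
  have h2 : ContDiff ℝ 2 (fun z : ℂ => z.im) := Complex.imCLM.contDiff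
  unfold gaussianBarrier
  fun_prop

lemma deriv_deriv_exp_quadratic (ε k c a b s : ℝ) :
    deriv (deriv fun t : ℝ => ε * (Real.exp (-k * ((a + t) ^ 2 + b)) - c)) s =
      ε * ((4 * k ^ 2 * (a + s) ^ 2 - 2 * k) * Real.exp (-k * ((a + s) ^ 2 + b))) := by
  have h0 : ∀ t : ℝ, HasDerivAt (fun t : ℝ => -k * ((a + t) ^ 2 + b)) (-k * (2 * (a + t))) t := by
    intro t
    have := ((((hasDerivAt_id t).const_add a).pow 2).add_const b).const_mul (-k)
    exact this.congr_deriv (by simp)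
  have h1 : (deriv fun t : ℝ => ε * (Real.exp (-k * ((a + t) ^ 2 + b)) - c)) =
      fun t => ε * (Real.exp (-k * ((a + t) ^ 2 + b)) * (-k * (2 * (a + t)))) := by
    funext t
    exact (((h0 t).exp.sub_const c).const_mul ε).deriv
  rw [h1]
  have h2 : HasDerivAt (fun t : ℝ => -k * (2 * (a + t))) (-k * 2) s := by
    have := (((hasDerivAt_id s).const_add a).const_mul 2).const_mul (-k)
    simpa using this
  refine (((h0 s).exp.mul h2).const_mul ε).deriv.trans ?_
  ring

lemma planeLaplacian_gaussianBarrier (ε k c : ℝ) (y z : ℂ) :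
    planeLaplacian (gaussianBarrier ε k c y) z =
      ε * ((4 * k ^ 2 * ((z.re - y.re) ^ 2 + (z.im - y.im) ^ 2) - 4 * k) *
        Real.exp (-k * ((z.re - y.re) ^ 2 + (z.im - y.im) ^ 2))) := by
  have hc := (contDiff_gaussianBarrier ε k c y).contDiffAt (x := z)
  rw [planeLaplacian, ← secondDeriv_eq_deriv hc, ← secondDeriv_eq_deriv hc]
  have e1 : (fun t : ℝ => gaussianBarrier ε k c y (z + t * 1)) =
      fun t : ℝ => ε * (Real.exp (-k * (((z.re - y.re) + t) ^ 2 + (z.im - y.im) ^ 2)) - c) := by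
    funext t; simp only [gaussianBarrier, Complex.add_re, Complex.add_im, Complex.mul_re, Complex.mul_im,
      Complex.ofReal_re, Complex.ofReal_im, Complex.one_re, Complex.one_im]; ring_nf
  have e2 : (fun t : ℝ => gaussianBarrier ε k c y (z + t * Complex.I)) =
      fun t : ℝ => ε * (Real.exp (-k * (((z.im - y.im) + t) ^ 2 + (z.re - y.re) ^ 2)) - c) := by
    funext t; simp only [gaussianBarrier, Complex.add_re, Complex.add_im, Complex.mul_re, Complex.mul_im,
      Complex.ofReal_re, Complex.ofReal_im, Complex.I_re, Complex.I_im]; ring_nf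
  rw [e1, e2, deriv_deriv_exp_quadratic, deriv_deriv_exp_quadratic]
  rw [add_comm ((z.im - y.im + 0) ^ 2)]
  simp only [add_zero]
  ring

lemma dist_sq_eq_re_im (y z : ℂ) : (z.re - y.re) ^ 2 + (z.im - y.im) ^ 2 = dist z y ^ 2 := by
  rw [Complex.dist_eq_re_im, Real.sq_sqrt (by positivity)]

/-- The strong maximum principle: a nonpositive `C²` function with `Δ f ≥ C f` that vanishes at a
point vanishes near it. -/
theorem eventually_eq_zero_of_planeLaplacian_ge {f : ℂ → ℝ} {z₀ : ℂ} {C : ℝ} (hC : 0 ≤ C)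
    (hf : ∀ᶠ z in 𝓝 z₀, ContDiffAt ℝ 2 f z) (hle : ∀ᶠ z in 𝓝 z₀, f z ≤ 0) (h0 : f z₀ = 0)
    (hL : ∀ᶠ z in 𝓝 z₀, C * f z ≤ planeLaplacian f z) : ∀ᶠ z in 𝓝 z₀, f z = 0 := by
  obtain ⟨r, hr, hball⟩ := Metric.eventually_nhds_iff_ball.1 (hf.and (hle.and hL))
  -- With |y - z₀| < r/3, the disc of radius r/2 about y still lies in the ball of radius r about
  -- z₀, and z₀ is interior to it.
  refine Metric.eventually_nhds_iff_ball.2 ⟨r / 3, by positivity, fun y hy => ?_⟩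
  have hyr : dist y z₀ < r / 3 := hy
  have hin : ∀ z, dist z y ≤ r / 2 → z ∈ ball z₀ r := fun z hz => by
    have := dist_triangle z y z₀
    rw [mem_ball]; linarith
  by_contra hne
  have hyb : y ∈ ball z₀ r := hin y (by simp; positivity)
  have hneg : f y < 0 := lt_of_le_of_ne (hball y hyb).2.1 hne
  have hcont : ∀ z ∈ ball z₀ r, ContinuousAt f z := fun z hz => (hball z hz).1.continuousAt
  obtain ⟨ρ, hρ, hρneg⟩ := Metric.eventually_nhds_iff_ball.1
    ((hcont y hyb).eventually (gt_mem_nhds hneg))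
  set R := dist z₀ y with hR
  have hRpos : 0 < R := dist_pos.2 (fun h => hne (by rw [← h]; exact h0))
  -- Inner radius of the annulus: f is negative on the circle of radius s about y, and z₀ lies
  -- outside it.
  obtain ⟨s, hs0, hsρ, hsR⟩ : ∃ s, 0 < s ∧ s < ρ ∧ s < R :=
    ⟨min ρ R / 2, by positivity, by have := min_le_left ρ R; linarith,
      by have := min_le_right ρ R; linarith⟩
  have hRr : R < r / 2 := by rw [hR, dist_comm]; linarith
  -- This size of k makes the Gaussian satisfy Δe > C e at distance at least s from y.
  obtain ⟨k, hk0, hk⟩ : ∃ k : ℝ, 0 < k ∧ 0 < 4 * k ^ 2 * s ^ 2 - 4 * k - C := by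
    refine ⟨(2 + C) / s ^ 2 + 1, by positivity, ?_⟩
    have hs2 : 0 < s ^ 2 := by positivity
    have e : ((2 + C) / s ^ 2 + 1) * s ^ 2 = 2 + C + s ^ 2 := by field_simp
    set k := (2 + C) / s ^ 2 + 1 with hkdef
    have hk1 : 1 ≤ k := by rw [hkdef]; have : 0 ≤ (2 + C) / s ^ 2 := by positivity
                           linarith
    have : 4 * k ^ 2 * s ^ 2 - 4 * k - C = 4 * k * (2 + C + s ^ 2) - 4 * k - C := by rw [← e]; ring
    rw [this]; nlinarith
  -- Subtracting this value makes the barrier vanish at z₀ and be negative farther from y than z₀.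
  set c := Real.exp (-k * R ^ 2) with hc
  have hinner : ∃ δ : ℝ, 0 < δ ∧ ∀ z, dist z y = s → f z ≤ -δ := by
    have hcomp : IsCompact (sphere y s) := isCompact_sphere y s
    have hco : ContinuousOn f (sphere y s) := fun z hz =>
      (hcont z (hin z (by rw [mem_sphere.1 hz]; linarith))).continuousWithinAt
    have hnes : (sphere y s).Nonempty := NormedSpace.sphere_nonempty.2 hs0.le
    obtain ⟨m, hm, hmax⟩ := hcomp.exists_isMaxOn hnes hco
    refine ⟨-f m, ?_, fun z hz => by simpa using hmax (show z ∈ sphere y s from hz)⟩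
    have := hρneg m (by rw [mem_ball, mem_sphere.1 hm]; exact hsρ)
    linarith
  obtain ⟨δ, hδ, hδs⟩ := hinner
  -- The barrier is at most ε, so f plus the barrier stays negative on the inner circle, where f ≤
  -- -δ.
  set ε := δ / 2 with hε
  have hεpos : 0 < ε := by positivity
  set w := gaussianBarrier ε k c y with hw
  have hwval : ∀ z, w z = ε * (Real.exp (-k * dist z y ^ 2) - c) := fun z => by
    rw [hw, gaussianBarrier, dist_sq_eq_re_im]
  set F := fun z => f z + w z with hF
  -- On this closed annulus F vanishes at the interior point z₀ and is negative on both boundary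
  -- circles, so its maximum is interior.
  set N := {z : ℂ | s ≤ dist z y ∧ dist z y ≤ r / 2} with hN
  have hNc : IsCompact N := by
    have : N = closedBall y (r / 2) ∩ {z | s ≤ dist z y} := by
      ext z; simp [hN, and_comm]
    rw [this]
    exact (isCompact_closedBall y (r / 2)).inter_right
      (isClosed_le continuous_const (continuous_id.dist continuous_const))
  have hFN : ContinuousOn F N := fun z hz =>
    ((hcont z (hin z hz.2)).add
      (contDiff_gaussianBarrier ε k c y).continuous.continuousAt).continuousWithinAt
  have hz0N : z₀ ∈ N := ⟨hsR.le, hRr.le⟩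
  obtain ⟨m, hmN, hmax⟩ := hNc.exists_isMaxOn ⟨z₀, hz0N⟩ hFN
  have hFz0 : F z₀ = 0 := by
    simp only [hF, hwval, h0, ← hR, hc]; ring
  have hFm : 0 ≤ F m := by rw [← hFz0]; exact hmax hz0N
  have hmb := hin m hmN.2
  have hcpos : 0 < c := Real.exp_pos _
  have hm1 : s < dist m y := by
    refine lt_of_le_of_ne hmN.1 fun h => ?_
    have h1 := hδs m h.symm
    have h2 : w m ≤ ε := by
      rw [hwval]
      have : Real.exp (-k * dist m y ^ 2) ≤ 1 := Real.exp_le_one_iff.2 (by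
        have : 0 ≤ k * dist m y ^ 2 := by positivity
        linarith)
      nlinarith
    have : F m = f m + w m := rfl
    linarith
  have hm2 : dist m y < r / 2 := by
    refine lt_of_le_of_ne hmN.2 fun h => ?_
    have h1 := (hball m hmb).2.1
    have h2 : w m < 0 := by
      rw [hwval]
      apply mul_neg_of_pos_of_neg hεpos
      rw [sub_neg, hc]
      apply Real.exp_lt_exp.2
      rw [h]
      have : R ^ 2 < (r / 2) ^ 2 := by gcongr
      nlinarith
    have : F m = f m + w m := rfl
    linarith
  have hloc : IsLocalMax F m := by
    apply hmax.isLocalMax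
    have h1 : ∀ᶠ z in 𝓝 m, s < dist z y :=
      (continuous_id.dist continuous_const).continuousAt.eventually (lt_mem_nhds hm1)
    have h2 : ∀ᶠ z in 𝓝 m, dist z y < r / 2 :=
      (continuous_id.dist continuous_const).continuousAt.eventually (gt_mem_nhds hm2)
    filter_upwards [h1, h2] with z hz hz'
    exact ⟨hz.le, hz'.le⟩
  have hfm := (hball m hmb).1
  have hwm := (contDiff_gaussianBarrier ε k c y).contDiffAt (x := m)
  have h1 := planeLaplacian_nonpos_of_isLocalMax (hfm.add hwm) hloc
  rw [planeLaplacian_add hfm hwm,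
    planeLaplacian_gaussianBarrier, dist_sq_eq_re_im] at h1
  have h2 := (hball m hmb).2.2
  set E := Real.exp (-k * dist m y ^ 2) with hE
  have hEpos : 0 < E := Real.exp_pos _
  have h3 : w m ≤ ε * E := by rw [hwval]; nlinarith
  have h4 : f m + w m = F m := rfl
  have h5 : 4 * k ^ 2 * s ^ 2 - 4 * k ≤ 4 * k ^ 2 * dist m y ^ 2 - 4 * k := by
    have : s ^ 2 ≤ dist m y ^ 2 := by gcongr
    nlinarith [sq_nonneg k]
  -- Since F m ≥ 0, f m ≥ -w m ≥ -εE. Hence ΔF ≥ εE (4k²s² - 4k - C) > 0 at m, against maximality.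
  have h6 : C * (-(ε * E)) ≤ C * f m := by
    apply mul_le_mul_of_nonneg_left _ hC; linarith
  have hεE : 0 < ε * E := by positivity
  nlinarith

end StrongMaximumPrinciple

/-! ### Calculus of the Wirtinger derivatives. -/

section Wirtinger

variable {f g : ℂ → ℂ} {z : ℂ}

lemma wirtingerZ_congr (h : f =ᶠ[𝓝 z] g) : wirtingerZ f z = wirtingerZ g z := by
  simp only [wirtingerZ, h.fderiv_eq]

lemma wirtingerZBar_congr (h : f =ᶠ[𝓝 z] g) : wirtingerZBar f z = wirtingerZBar g z := by
  simp only [wirtingerZBar, h.fderiv_eq]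

@[simp] lemma wirtingerZ_const (c : ℂ) : wirtingerZ (fun _ => c) z = 0 := by simp [wirtingerZ]

@[simp] lemma wirtingerZBar_const (c : ℂ) : wirtingerZBar (fun _ => c) z = 0 := by
  simp [wirtingerZBar]

lemma wirtingerZBar_add (hf : DifferentiableAt ℝ f z) (hg : DifferentiableAt ℝ g z) :
    wirtingerZBar (fun w => f w + g w) z = wirtingerZBar f z + wirtingerZBar g z := by
  simp only [wirtingerZBar, fderiv_fun_add hf hg, add_apply]; ring

lemma wirtingerZ_mul (hf : DifferentiableAt ℝ f z) (hg : DifferentiableAt ℝ g z) :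
    wirtingerZ (fun w => f w * g w) z = wirtingerZ f z * g z + f z * wirtingerZ g z := by
  simp only [wirtingerZ, fderiv_fun_mul hf hg, add_apply,
    smul_apply, smul_eq_mul]; ring

lemma wirtingerZBar_mul (hf : DifferentiableAt ℝ f z) (hg : DifferentiableAt ℝ g z) :
    wirtingerZBar (fun w => f w * g w) z = wirtingerZBar f z * g z + f z * wirtingerZBar g z := by
  simp only [wirtingerZBar, fderiv_fun_mul hf hg, add_apply,
    smul_apply, smul_eq_mul]; ring

lemma wirtingerZ_sum {ι : Type*} (s : Finset ι) {f : ι → ℂ → ℂ}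
    (hf : ∀ i ∈ s, DifferentiableAt ℝ (f i) z) :
    wirtingerZ (fun w => ∑ i ∈ s, f i w) z = ∑ i ∈ s, wirtingerZ (f i) z := by
  simp only [wirtingerZ, fderiv_fun_sum hf, sum_apply, Finset.mul_sum,
    ← Finset.sum_sub_distrib, Finset.sum_div]

lemma wirtingerZBar_sum {ι : Type*} (s : Finset ι) {f : ι → ℂ → ℂ}
    (hf : ∀ i ∈ s, DifferentiableAt ℝ (f i) z) :
    wirtingerZBar (fun w => ∑ i ∈ s, f i w) z = ∑ i ∈ s, wirtingerZBar (f i) z := by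
  simp only [wirtingerZBar, fderiv_fun_sum hf, sum_apply, Finset.mul_sum,
    ← Finset.sum_add_distrib, Finset.sum_div]

lemma fderiv_star_apply (hf : DifferentiableAt ℝ f z) (v : ℂ) :
    fderiv ℝ (fun w => star (f w)) z v = star (fderiv ℝ f z v) := by
  have := (Complex.conjCLE.toContinuousLinearMap.hasFDerivAt.comp z hf.hasFDerivAt).fderiv
  exact congrArg (fun L => L v) this

lemma wirtingerZBar_star (hf : DifferentiableAt ℝ f z) :
    wirtingerZBar (fun w => star (f w)) z = star (wirtingerZ f z) := by
  simp only [wirtingerZBar, wirtingerZ, fderiv_star_apply hf]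
  simp [sub_eq_add_neg]

lemma wirtingerZ_star (hf : DifferentiableAt ℝ f z) :
    wirtingerZ (fun w => star (f w)) z = star (wirtingerZBar f z) := by
  simp only [wirtingerZBar, wirtingerZ, fderiv_star_apply hf]
  simp [sub_eq_add_neg]

lemma wirtingerZBar_eq_zero (hf : DifferentiableAt ℂ f z) : wirtingerZBar f z = 0 := by
  have h := (hf.hasFDerivAt.restrictScalars ℝ).fderiv
  simp only [wirtingerZBar, h, ContinuousLinearMap.coe_restrictScalars']
  have : (fderiv ℂ f z) Complex.I = Complex.I * fderiv ℂ f z 1 := by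
    rw [← smul_eq_mul, ← map_smul]; simp
  rw [this, ← mul_assoc, Complex.I_mul_I]; ring

lemma differentiableAt_of_wirtingerZBar_eq_zero (hf : DifferentiableAt ℝ f z)
    (h : wirtingerZBar f z = 0) : DifferentiableAt ℂ f z := by
  rw [differentiableAt_complex_iff_differentiableAt_real]
  refine ⟨hf, ?_⟩
  have h1 : fderiv ℝ f z 1 + Complex.I * fderiv ℝ f z Complex.I = 0 := by
    simpa [wirtingerZBar] using h
  have h2 : fderiv ℝ f z 1 = -(Complex.I * fderiv ℝ f z Complex.I) := eq_neg_of_add_eq_zero_left h1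
  rw [h2, smul_eq_mul, mul_neg, ← mul_assoc, Complex.I_mul_I]; ring

lemma contDiffAt_wirtingerZ (hf : ContDiffAt ℝ ∞ f z) : ContDiffAt ℝ ∞ (wirtingerZ f) z := by
  have h : ContDiffAt ℝ ∞ (fderiv ℝ f) z := hf.fderiv_right (by norm_num)
  unfold wirtingerZ
  simp only [div_eq_mul_inv]
  exact ((h.clm_apply contDiffAt_const).sub
    (contDiffAt_const.mul (h.clm_apply contDiffAt_const))).mul contDiffAt_const

/-- The real part is enough later, and it avoids the symmetry of the mixed second derivatives, which
would only serve to cancel the imaginary part. -/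
lemma re_wirtingerZBar_wirtingerZ_ofReal {u : ℂ → ℝ} (hu : ContDiffAt ℝ 2 u z) :
    (wirtingerZBar (wirtingerZ fun w => (u w : ℂ)) z).re = planeLaplacian u z / 4 := by
  have key : ∀ {f : ℂ → ℝ} {z v : ℂ}, DifferentiableAt ℝ f z →
      fderiv ℝ (fun w => (f w : ℂ)) z v = (fderiv ℝ f z v : ℂ) := fun {f z v} hf => by
    have := (Complex.ofRealCLM.hasFDerivAt.comp z hf.hasFDerivAt).fderiv
    exact congrArg (fun L => L v) this
  have h1 : (wirtingerZ fun w => (u w : ℂ)) =ᶠ[𝓝 z]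
      fun w => ((fderiv ℝ u w 1 : ℝ) - Complex.I * (fderiv ℝ u w Complex.I : ℝ)) * (1 / 2 : ℂ) := by
    filter_upwards [hu.eventually (by simp)] with w hw
    simp only [wirtingerZ, key (hw.differentiableAt (by simp))]; ring
  have hd : ∀ v, DifferentiableAt ℝ (fun w => fderiv ℝ u w v) z := fun v =>
    ((hu.fderiv_right (m := 1) (by norm_num)).differentiableAt (by simp)).clm_apply
      (differentiableAt_const v)
  have hdc : ∀ v, DifferentiableAt ℝ (fun w => ((fderiv ℝ u w v : ℝ) : ℂ)) z := fun v =>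
    Complex.ofRealCLM.differentiableAt.comp z (hd v)
  rw [wirtingerZBar_congr h1, wirtingerZBar, fderiv_mul_const ((hdc 1).fun_sub ((hdc _).const_mul _)),
    fderiv_fun_sub (hdc 1) ((hdc _).const_mul _), fderiv_const_mul (hdc _)]
  simp only [smul_apply, sub_apply, key (hd _), smul_eq_mul,
    planeLaplacian, secondDeriv]
  simp
  ring

end Wirtinger

/-! ### Entrywise Wirtinger calculus for matrix-valued functions. -/

section MatrixCalculus

variable {n : ℕ} {M N : ℂ → Matrix (Fin n) (Fin n) ℂ} {z : ℂ}

/-- Entrywise real smoothness of a matrix of functions. -/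
def SmoothEntries (M : ℂ → Matrix (Fin n) (Fin n) ℂ) (z : ℂ) : Prop :=
  ∀ i j, ContDiffAt ℝ ∞ (fun w => M w i j) z

lemma SmoothEntries.diff (h : SmoothEntries M z) (i j : Fin n) :
    DifferentiableAt ℝ (fun w => M w i j) z := (h i j).differentiableAt (by simp)

lemma SmoothEntries.mul (hM : SmoothEntries M z) (hN : SmoothEntries N z) :
    SmoothEntries (fun w => M w * N w) z := fun i j => by
  simp only [Matrix.mul_apply]
  exact ContDiffAt.sum fun k _ => (hM i k).mul (hN k j)

lemma SmoothEntries.const (A : Matrix (Fin n) (Fin n) ℂ) : SmoothEntries (fun _ => A) z :=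
  fun _ _ => contDiffAt_const

lemma SmoothEntries.dz (hM : SmoothEntries M z) : SmoothEntries (matrixDZ M) z :=
  fun i j => contDiffAt_wirtingerZ (hM i j)

lemma SmoothEntries.trace (hM : SmoothEntries M z) :
    ContDiffAt ℝ ∞ (fun w => (M w).trace) z := by
  simp only [Matrix.trace, Matrix.diag_apply]
  exact ContDiffAt.sum fun k _ => hM k k

lemma SmoothEntries.det (hM : SmoothEntries M z) : ContDiffAt ℝ ∞ (fun w => (M w).det) z := by
  simp only [Matrix.det_apply, Units.smul_def, zsmul_eq_mul]
  exact ContDiffAt.sum fun σ _ => contDiffAt_const.mul (contDiffAt_prod fun i _ => hM _ _)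

lemma SmoothEntries.inv (hM : SmoothEntries M z) (hdet : (M z).det ≠ 0) :
    SmoothEntries (fun w => (M w)⁻¹) z := fun i j => by
  simp only [Matrix.inv_def, Matrix.smul_apply, Ring.inverse_eq_inv', smul_eq_mul]
  refine (hM.det.inv hdet).mul ?_
  simp only [Matrix.adjugate_apply]
  refine SmoothEntries.det (M := fun w => (M w).updateRow j (Pi.single i 1)) fun k l => ?_
  by_cases h : k = j
  · subst h; simpa using contDiffAt_const
  · simpa [Matrix.updateRow_ne h] using hM k l

lemma matrixDZ_congr (h : M =ᶠ[𝓝 z] N) : matrixDZ M z = matrixDZ N z := by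
  ext i j
  exact wirtingerZ_congr (h.mono fun w hw => by simp [hw])

lemma matrixDZBar_congr (h : M =ᶠ[𝓝 z] N) : matrixDZBar M z = matrixDZBar N z := by
  ext i j
  exact wirtingerZBar_congr (h.mono fun w hw => by simp [hw])

lemma matrixDZ_mul (hM : SmoothEntries M z) (hN : SmoothEntries N z) :
    matrixDZ (fun w => M w * N w) z = matrixDZ M z * N z + M z * matrixDZ N z := by
  ext i j
  simp only [matrixDZ, Matrix.of_apply, Matrix.mul_apply, Matrix.add_apply]
  rw [wirtingerZ_sum _ fun k _ => (hM.diff i k).fun_mul (hN.diff k j), ← Finset.sum_add_distrib]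
  exact Finset.sum_congr rfl fun k _ => wirtingerZ_mul (hM.diff i k) (hN.diff k j)

lemma matrixDZBar_mul (hM : SmoothEntries M z) (hN : SmoothEntries N z) :
    matrixDZBar (fun w => M w * N w) z = matrixDZBar M z * N z + M z * matrixDZBar N z := by
  ext i j
  simp only [matrixDZBar, Matrix.of_apply, Matrix.mul_apply, Matrix.add_apply]
  rw [wirtingerZBar_sum _ fun k _ => (hM.diff i k).fun_mul (hN.diff k j), ← Finset.sum_add_distrib]
  exact Finset.sum_congr rfl fun k _ => wirtingerZBar_mul (hM.diff i k) (hN.diff k j)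

@[simp] lemma matrixDZ_const (A : Matrix (Fin n) (Fin n) ℂ) : matrixDZ (fun _ => A) z = 0 := by
  ext; simp [matrixDZ]

@[simp] lemma matrixDZBar_const (A : Matrix (Fin n) (Fin n) ℂ) :
    matrixDZBar (fun _ => A) z = 0 := by
  ext; simp [matrixDZBar]

lemma wirtingerZ_trace (hM : SmoothEntries M z) :
    wirtingerZ (fun w => (M w).trace) z = (matrixDZ M z).trace := by
  simp only [Matrix.trace, Matrix.diag_apply, matrixDZ, Matrix.of_apply]
  exact wirtingerZ_sum _ fun k _ => hM.diff k k

lemma wirtingerZBar_trace (hM : SmoothEntries M z) :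
    wirtingerZBar (fun w => (M w).trace) z = (matrixDZBar M z).trace := by
  simp only [Matrix.trace, Matrix.diag_apply, matrixDZBar, Matrix.of_apply]
  exact wirtingerZBar_sum _ fun k _ => hM.diff k k

lemma matrixDZBar_of_isHermitian (hM : SmoothEntries M z)
    (h : ∀ᶠ w in 𝓝 z, (M w).IsHermitian) : matrixDZBar M z = (matrixDZ M z)ᴴ := by
  ext i j
  have h1 : (fun w => M w i j) =ᶠ[𝓝 z] fun w => star (M w j i) :=
    h.mono fun w hw => (hw.apply i j).symm
  simp only [matrixDZBar, matrixDZ, Matrix.of_apply, Matrix.conjTranspose_apply]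
  rw [wirtingerZBar_congr h1, wirtingerZBar_star (hM.diff j i)]

lemma matrixDZ_inv (hM : SmoothEntries M z) (hdet : (M z).det ≠ 0) :
    matrixDZ (fun w => (M w)⁻¹) z = -((M z)⁻¹ * matrixDZ M z * (M z)⁻¹) := by
  have hev : ∀ᶠ w in 𝓝 z, (M w).det ≠ 0 := hM.det.continuousAt.eventually_ne hdet
  have h1 : (fun w => (M w)⁻¹ * M w) =ᶠ[𝓝 z] fun _ => 1 :=
    hev.mono fun w hw => Matrix.nonsing_inv_mul _ (isUnit_iff_ne_zero.2 hw)
  have h2 := matrixDZ_congr h1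
  rw [matrixDZ_mul (hM.inv hdet) hM, matrixDZ_const] at h2
  have h3 : M z * (M z)⁻¹ = 1 := Matrix.mul_nonsing_inv _ (isUnit_iff_ne_zero.2 hdet)
  calc matrixDZ (fun w => (M w)⁻¹) z
      = matrixDZ (fun w => (M w)⁻¹) z * M z * (M z)⁻¹ := by rw [mul_assoc, h3, mul_one]
    _ = _ := by rw [eq_neg_of_add_eq_zero_left h2, neg_mul]

lemma matrixDZBar_inv (hM : SmoothEntries M z) (hdet : (M z).det ≠ 0) :
    matrixDZBar (fun w => (M w)⁻¹) z = -((M z)⁻¹ * matrixDZBar M z * (M z)⁻¹) := by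
  have hev : ∀ᶠ w in 𝓝 z, (M w).det ≠ 0 := hM.det.continuousAt.eventually_ne hdet
  have h1 : (fun w => (M w)⁻¹ * M w) =ᶠ[𝓝 z] fun _ => 1 :=
    hev.mono fun w hw => Matrix.nonsing_inv_mul _ (isUnit_iff_ne_zero.2 hw)
  have h2 := matrixDZBar_congr h1
  rw [matrixDZBar_mul (hM.inv hdet) hM, matrixDZBar_const] at h2
  have h3 : M z * (M z)⁻¹ = 1 := Matrix.mul_nonsing_inv _ (isUnit_iff_ne_zero.2 hdet)
  calc matrixDZBar (fun w => (M w)⁻¹) z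
      = matrixDZBar (fun w => (M w)⁻¹) z * M z * (M z)⁻¹ := by rw [mul_assoc, h3, mul_one]
    _ = _ := by rw [eq_neg_of_add_eq_zero_left h2, neg_mul]

end MatrixCalculus

/-! ### Adjoints and norms of endomorphisms for a Gram matrix. -/

section Bochner

variable {n : ℕ}

/-- The adjoint of the matrix `A` for the Hermitian form with Gram matrix `G`. -/
def gramAdjoint (G A : Matrix (Fin n) (Fin n) ℂ) : Matrix (Fin n) (Fin n) ℂ := G⁻¹ * Aᴴ * G

/-- The squared norm of a matrix for the Hermitian form with Gram matrix `G`, as a complex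
number. -/
def gramNormSq (G A : Matrix (Fin n) (Fin n) ℂ) : ℂ := (gramAdjoint G A * A).trace

-- Writing G = BᴴB passes to an orthonormal frame: the quantity is the squared Frobenius norm of B A
-- B⁻¹.
open scoped ComplexOrder MatrixOrder in
lemma gramNormSq_nonneg_and_eq_zero_complex {G : Matrix (Fin n) (Fin n) ℂ} (hG : G.PosDef)
    (A : Matrix (Fin n) (Fin n) ℂ) :
    0 ≤ gramNormSq G A ∧ (gramNormSq G A = 0 → A = 0) := by
  obtain ⟨B, rfl⟩ := CStarAlgebra.nonneg_iff_eq_star_mul_self.mp hG.posSemidef.nonneg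
  rw [Matrix.star_eq_conjTranspose] at hG ⊢
  have hBu : IsUnit B.det := by
    have h := (Matrix.isUnit_iff_isUnit_det _).1 hG.isUnit
    rw [Matrix.det_mul] at h
    exact isUnit_of_mul_isUnit_right h
  have hBB : B⁻¹ * B = 1 := Matrix.nonsing_inv_mul _ hBu
  have hBB' : B * B⁻¹ = 1 := Matrix.mul_nonsing_inv _ hBu
  have h1 : gramNormSq (Bᴴ * B) A = ((B * A * B⁻¹)ᴴ * (B * A * B⁻¹)).trace := by
    simp only [gramNormSq, gramAdjoint, Matrix.mul_inv_rev, Matrix.conjTranspose_mul,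
      Matrix.conjTranspose_nonsing_inv]
    rw [show B⁻¹ * Bᴴ⁻¹ * Aᴴ * (Bᴴ * B) * A = B⁻¹ * (Bᴴ⁻¹ * Aᴴ * Bᴴ * B * A) by
      simp only [mul_assoc], Matrix.trace_mul_comm]
    simp only [mul_assoc]
  have h2 : (0 : ℂ) ≤ ((B * A * B⁻¹)ᴴ * (B * A * B⁻¹)).trace :=
    (Matrix.posSemidef_conjTranspose_mul_self _).trace_nonneg
  rw [h1]
  refine ⟨h2, fun h4 => ?_⟩
  have h5 := Matrix.trace_conjTranspose_mul_self_eq_zero_iff.1 h4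
  calc A = B⁻¹ * (B * A * B⁻¹) * B := by
        simp only [mul_assoc, hBB, mul_one]; rw [← mul_assoc, hBB, one_mul]
    _ = 0 := by rw [h5]; simp

open scoped ComplexOrder in
lemma gramNormSq_im {G : Matrix (Fin n) (Fin n) ℂ} (hG : G.PosDef)
    (A : Matrix (Fin n) (Fin n) ℂ) : (gramNormSq G A).im = 0 :=
  (Complex.nonneg_iff.1 (gramNormSq_nonneg_and_eq_zero_complex hG A).1).2.symm

open scoped ComplexOrder in
lemma gramNormSq_nonneg_and_eq_zero {G : Matrix (Fin n) (Fin n) ℂ} (hG : G.PosDef)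
    (A : Matrix (Fin n) (Fin n) ℂ) :
    0 ≤ (gramNormSq G A).re ∧ ((gramNormSq G A).re = 0 → A = 0) :=
  ⟨(Complex.nonneg_iff.1 (gramNormSq_nonneg_and_eq_zero_complex hG A).1).1, fun h =>
    (gramNormSq_nonneg_and_eq_zero_complex hG A).2 (Complex.ext h (gramNormSq_im hG A))⟩

lemma gramAdjoint_sub (G A B : Matrix (Fin n) (Fin n) ℂ) :
    gramAdjoint G (A - B) = gramAdjoint G A - gramAdjoint G B := by
  simp [gramAdjoint, Matrix.conjTranspose_sub, mul_sub, sub_mul]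

lemma gramAdjoint_smul (G A : Matrix (Fin n) (Fin n) ℂ) (c : ℂ) :
    gramAdjoint G (c • A) = star c • gramAdjoint G A := by
  simp [gramAdjoint]

lemma gramAdjoint_mul {G : Matrix (Fin n) (Fin n) ℂ} (hG : IsUnit G.det)
    (A B : Matrix (Fin n) (Fin n) ℂ) :
    gramAdjoint G (A * B) = gramAdjoint G B * gramAdjoint G A := by
  have h : G * G⁻¹ = 1 := Matrix.mul_nonsing_inv _ hG
  simp only [gramAdjoint, Matrix.conjTranspose_mul]
  rw [show G⁻¹ * Bᴴ * G * (G⁻¹ * Aᴴ * G) = G⁻¹ * Bᴴ * (G * G⁻¹) * Aᴴ * G by simp only [mul_assoc],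
    h]
  simp only [mul_assoc, one_mul]

lemma gramAdjoint_gramAdjoint {G : Matrix (Fin n) (Fin n) ℂ} (hG : IsUnit G.det)
    (hH : G.IsHermitian) (A : Matrix (Fin n) (Fin n) ℂ) : gramAdjoint G (gramAdjoint G A) = A := by
  have h : G⁻¹ * G = 1 := Matrix.nonsing_inv_mul _ hG
  simp only [gramAdjoint, Matrix.conjTranspose_mul, Matrix.conjTranspose_conjTranspose,
    Matrix.conjTranspose_nonsing_inv, hH.eq]
  rw [show G⁻¹ * (G * (A * G⁻¹)) * G = (G⁻¹ * G) * A * (G⁻¹ * G) by simp only [mul_assoc], h]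
  simp

/-- If `γ` intertwines `A` and `c A` with `|c| = 1`, then `⟨[[A, A*], γ], γ⟩ = |A* γ - c̄ γ A*|²`. -/
lemma trace_commutator_eq_gramNormSq {G A γ : Matrix (Fin n) (Fin n) ℂ} {c : ℂ}
    (hG : IsUnit G.det) (hH : G.IsHermitian) (hc : c * star c = 1) (hA : A * γ = c • (γ * A)) :
    (gramAdjoint G γ * ((A * gramAdjoint G A - gramAdjoint G A * A) * γ -
      γ * (A * gramAdjoint G A - gramAdjoint G A * A))).trace =
      gramNormSq G (gramAdjoint G A * γ - star c • (γ * gramAdjoint G A)) := by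
  rw [gramNormSq, gramAdjoint_sub, gramAdjoint_smul, gramAdjoint_mul hG, gramAdjoint_mul hG,
    gramAdjoint_gramAdjoint hG hH, star_star]
  set W := gramAdjoint G γ
  set B := gramAdjoint G A
  -- The square expands into four traces. One already occurs in the commutator; the other three are
  -- matched to it by Aγ = cγA, |c| = 1 and cyclicity of the trace.
  have e1 : (W * A * (star c • (γ * B))).trace = (W * γ * A * B).trace := by
    rw [show W * A * (star c • (γ * B)) = star c • (W * (A * γ) * B) by
      simp only [Matrix.mul_smul, mul_assoc], hA]
    simp only [Matrix.mul_smul, Matrix.smul_mul, smul_smul, mul_comm (star c) c, hc, one_smul,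
      mul_assoc]
  have e2 : ((c • (A * W)) * (B * γ)).trace = (W * B * A * γ).trace := by
    rw [show (c • (A * W)) * (B * γ) = A * (c • (W * B * γ)) by
      simp only [Matrix.mul_smul, Matrix.smul_mul, mul_assoc], Matrix.trace_mul_comm,
      Matrix.smul_mul, mul_assoc, ← Matrix.mul_smul, ← hA]
    simp only [mul_assoc]
  have e3 : ((c • (A * W)) * (star c • (γ * B))).trace = (W * γ * B * A).trace := by
    rw [Matrix.smul_mul, Matrix.mul_smul, smul_smul, hc, one_smul, mul_assoc,
      Matrix.trace_mul_comm]
    simp only [mul_assoc]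
  simp only [sub_mul, mul_sub, Matrix.trace_sub, e1, e2, e3]
  simp only [mul_assoc]

end Bochner

/-! ### The Bochner formula for an endomorphism that twists the Higgs field. -/

section BochnerFormula

variable {n : ℕ} {G : ℂ → Matrix (Fin n) (Fin n) ℂ} {γ A : Matrix (Fin n) (Fin n) ℂ} {c z : ℂ}

open scoped ComplexOrder

/-- The connection form of the Chern connection in a holomorphic frame. -/
def chernForm (G : ℂ → Matrix (Fin n) (Fin n) ℂ) (z : ℂ) : Matrix (Fin n) (Fin n) ℂ :=
  (G z)⁻¹ * matrixDZ G z

lemma Matrix.PosDef.isUnit_det {G : Matrix (Fin n) (Fin n) ℂ} (hG : G.PosDef) : IsUnit G.det :=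
  (Matrix.isUnit_iff_isUnit_det _).1 hG.isUnit

lemma SmoothEntries.gramAdjoint (hG : SmoothEntries G z) (hp : (G z).PosDef)
    (γ : Matrix (Fin n) (Fin n) ℂ) : SmoothEntries (fun w => gramAdjoint (G w) γ) z :=
  ((hG.inv hp.isUnit_det.ne_zero).mul (.const _)).mul hG

/-- A constant γ is holomorphic, so its adjoint W is killed by the (1,0) part of the Chern
connection: ∂W + [θ, W] = 0, with θ the connection form. -/
lemma matrixDZ_gramAdjoint (hG : SmoothEntries G z) (hp : (G z).PosDef)
    (γ : Matrix (Fin n) (Fin n) ℂ) :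
    matrixDZ (fun w => gramAdjoint (G w) γ) z =
      gramAdjoint (G z) γ * chernForm G z - chernForm G z * gramAdjoint (G z) γ := by
  have hd := hp.isUnit_det
  have h : G z * (G z)⁻¹ = 1 := Matrix.mul_nonsing_inv _ hd
  have hi := hG.inv hd.ne_zero
  simp only [gramAdjoint]
  rw [matrixDZ_mul (hi.mul (.const _)) hG, matrixDZ_mul hi (.const _), matrixDZ_inv hG hd.ne_zero,
    matrixDZ_const, chernForm]
  rw [show (G z)⁻¹ * γᴴ * G z * ((G z)⁻¹ * matrixDZ G z) =
    (G z)⁻¹ * γᴴ * (G z * (G z)⁻¹) * matrixDZ G z by simp only [mul_assoc], h]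
  simp only [mul_zero, add_zero, neg_mul, mul_one, mul_assoc]
  abel

/-- The connection is compatible with the metric, so ∂̄ of the adjoint is the adjoint of the (1,0)
covariant derivative, which for constant γ is [θ, γ]. -/
lemma matrixDZBar_gramAdjoint (hG : SmoothEntries G z) (hp : ∀ᶠ w in 𝓝 z, (G w).PosDef)
    (γ : Matrix (Fin n) (Fin n) ℂ) :
    matrixDZBar (fun w => gramAdjoint (G w) γ) z =
      gramAdjoint (G z) (chernForm G z * γ - γ * chernForm G z) := by
  have hd := hp.self_of_nhds.isUnit_det
  have h : (G z)⁻¹ * G z = 1 := Matrix.nonsing_inv_mul _ hd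
  have hi := hG.inv hd.ne_zero
  simp only [gramAdjoint]
  rw [matrixDZBar_mul (hi.mul (.const _)) hG, matrixDZBar_mul hi (.const _),
    matrixDZBar_inv hG hd.ne_zero, matrixDZBar_const,
    matrixDZBar_of_isHermitian hG (hp.mono fun w hw => hw.isHermitian), chernForm]
  simp only [Matrix.conjTranspose_sub, Matrix.conjTranspose_mul, Matrix.conjTranspose_nonsing_inv,
    hp.self_of_nhds.isHermitian.eq, mul_sub, sub_mul, mul_assoc, h, mul_zero, add_zero, neg_mul,
    mul_one]
  abel

/-- The Bochner formula for an endomorphism that intertwines the Higgs field of a solution of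
Hitchin's equation with a multiple of it. -/
theorem wirtingerZBar_wirtingerZ_gramNormSq (hG : ∀ᶠ w in 𝓝 z, SmoothEntries G w)
    (hp : ∀ᶠ w in 𝓝 z, (G w).PosDef)
    (hH : chernCurvatureMatrix G z +
      (A * gramAdjoint (G z) A - gramAdjoint (G z) A * A) = 0)
    (hc : c * star c = 1) (hA : A * γ = c • (γ * A)) :
    wirtingerZBar (wirtingerZ fun w => gramNormSq (G w) γ) z =
      gramNormSq (G z) (chernForm G z * γ - γ * chernForm G z) +
        gramNormSq (G z) (gramAdjoint (G z) A * γ - star c • (γ * gramAdjoint (G z) A)) := by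
  have hGz := hG.self_of_nhds
  have hpz := hp.self_of_nhds
  have hch : SmoothEntries (chernForm G) z := (hGz.inv hpz.isUnit_det.ne_zero).mul hGz.dz
  have hY : SmoothEntries (fun w => chernForm G w * γ - γ * chernForm G w) z := fun i j => by
    simpa only [Matrix.sub_apply] using
      ((hch.mul (.const γ)) i j).sub (((SmoothEntries.const γ).mul hch) i j)
  have h1 : (wirtingerZ fun w => gramNormSq (G w) γ) =ᶠ[𝓝 z]
      fun w => (gramAdjoint (G w) γ * (chernForm G w * γ - γ * chernForm G w)).trace := by
    filter_upwards [hG, hp] with w hw hpw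
    simp only [gramNormSq]
    rw [wirtingerZ_trace ((hw.gramAdjoint hpw γ).mul (.const γ)),
      matrixDZ_mul (hw.gramAdjoint hpw γ) (.const γ), matrixDZ_gramAdjoint hw hpw, matrixDZ_const]
    have e : (chernForm G w * gramAdjoint (G w) γ * γ).trace =
        (gramAdjoint (G w) γ * (γ * chernForm G w)).trace := by
      rw [mul_assoc, Matrix.trace_mul_comm, mul_assoc]
    rw [mul_zero, add_zero, sub_mul, mul_sub, Matrix.trace_sub, Matrix.trace_sub, e, mul_assoc]
  have hdY : matrixDZBar (fun w => chernForm G w * γ - γ * chernForm G w) z =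
      matrixDZBar (chernForm G) z * γ - γ * matrixDZBar (chernForm G) z := by
    have e1 := matrixDZBar_mul hch (.const γ)
    have e2 := matrixDZBar_mul (.const (-γ)) hch
    rw [matrixDZBar_const] at e1 e2
    have e3 : matrixDZBar (fun w => chernForm G w * γ + -γ * chernForm G w) z =
        matrixDZBar (fun w => chernForm G w * γ) z + matrixDZBar (fun w => -γ * chernForm G w) z := by
      ext i j
      exact wirtingerZBar_add ((hch.mul (.const γ)).diff i j)
        (((SmoothEntries.const (-γ)).mul hch).diff i j)
    rw [e1, e2] at e3
    simpa [sub_eq_add_neg] using e3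
  have hR : matrixDZBar (chernForm G) z = A * gramAdjoint (G z) A - gramAdjoint (G z) A * A := by
    have : -matrixDZBar (chernForm G) z + (A * gramAdjoint (G z) A - gramAdjoint (G z) A * A) = 0 :=
      hH
    exact (neg_add_eq_zero.1 this)
  rw [wirtingerZBar_congr h1, wirtingerZBar_trace ((hGz.gramAdjoint hpz γ).mul hY),
    matrixDZBar_mul (hGz.gramAdjoint hpz γ) hY, matrixDZBar_gramAdjoint hGz hp, Matrix.trace_add,
    hdY, hR, trace_commutator_eq_gramNormSq hpz.isUnit_det hpz.isHermitian hc hA]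
  rfl

end BochnerFormula

/-! ### Linear algebra of the cyclic Higgs field and its order-three symmetry. -/

section CyclicAlgebra

open scoped ComplexOrder

/-- The matrix of the cyclic Higgs field. -/
def cyclicMatrix (p q : ℂ) : Matrix (Fin 3) (Fin 3) ℂ := !![0, p, 0; 0, 0, p; q, 0, 0]

/-- The diagonal gauge transformation that multiplies the cyclic Higgs field by `ζ`. -/
def cyclicGauge (ζ : ℂ) : Matrix (Fin 3) (Fin 3) ℂ := Matrix.diagonal ![1, ζ, ζ ^ 2]

variable {ζ p q : ℂ}

lemma exists_cube_root : ∃ ζ : ℂ, ζ ^ 2 + ζ + 1 = 0 := by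
  have h := (Complex.isPrimitiveRoot_exp 3 (by norm_num)).geom_sum_eq_zero (by norm_num)
  refine ⟨Complex.exp (2 * Real.pi * Complex.I / (3 : ℕ)), ?_⟩
  simp only [Finset.sum_range_succ, Finset.sum_range_zero] at h
  linear_combination h

lemma cube_eq_one (hζ : ζ ^ 2 + ζ + 1 = 0) : ζ ^ 3 = 1 := by linear_combination (ζ - 1) * hζ

lemma mul_star_eq_one (hζ : ζ ^ 2 + ζ + 1 = 0) : ζ * star ζ = 1 := by
  have h : ‖ζ‖ = 1 := by
    have h1 : ‖ζ‖ ^ 3 = 1 := by rw [← norm_pow, cube_eq_one hζ, norm_one]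
    exact (pow_eq_one_iff_of_nonneg (norm_nonneg _) (by norm_num)).1 h1
  have := Complex.mul_conj ζ
  rw [Complex.normSq_eq_norm_sq, h] at this
  simpa using this

/-- Each nonzero entry sits at (i, j) with j = i + 1 modulo 3, so acting on columns rather than rows
gains one factor ζ; the corner entry q uses ζ³ = 1. -/
lemma cyclicMatrix_mul_cyclicGauge (hζ : ζ ^ 2 + ζ + 1 = 0) (p q : ℂ) :
    cyclicMatrix p q * cyclicGauge ζ = ζ • (cyclicGauge ζ * cyclicMatrix p q) := by
  have h3 := cube_eq_one hζ
  rw [cyclicMatrix, cyclicGauge]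
  ext i j
  fin_cases i <;> fin_cases j <;> simp [Matrix.mul_diagonal, Matrix.diagonal_mul]
  · ring
  · ring
  · linear_combination -q * h3

/-- A matrix with `W A = ζ A W` for the cyclic matrix `A` is diagonal as soon as its strictly lower
triangular entries vanish. -/
lemma offDiag_eq_zero_of_commute {W : Matrix (Fin 3) (Fin 3) ℂ} (hq : q ≠ 0) (hζ : ζ ≠ 0)
    (h : W * cyclicMatrix p q = ζ • (cyclicMatrix p q * W)) (h10 : W 1 0 = 0) (h20 : W 2 0 = 0)
    (h21 : W 2 1 = 0) : ∀ i j, i ≠ j → W i j = 0 := by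
  -- With the lower entries zero, these three equations read q W₀₂ = 0, q W₁₂ = 0 and ζ q W₀₁ = 0.
  have e00 := congrFun (congrFun h 0) 0
  have e10 := congrFun (congrFun h 1) 0
  have e21 := congrFun (congrFun h 2) 1
  simp only [Matrix.mul_apply, Matrix.smul_apply, Fin.sum_univ_three, h10, h20, h21] at e00 e10 e21
  simp [cyclicMatrix, hq, hζ] at e00 e10 e21
  intro i j hij
  fin_cases i <;> fin_cases j <;> simp_all

/-- For the diagonal adjoint W, the identity γᴴG = GW says that conj(γᵢ) Gᵢⱼ = Gᵢⱼ Wⱼⱼ. The case i =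
j gives Wⱼⱼ = conj(γⱼ), and the three γᵢ are distinct. -/
lemma offDiag_gram_eq_zero {G : Matrix (Fin 3) (Fin 3) ℂ} (hG : G.PosDef)
    (hζ : ζ ^ 2 + ζ + 1 = 0)
    (h : ∀ i j, i ≠ j → gramAdjoint G (cyclicGauge ζ) i j = 0) : ∀ i j, i ≠ j → G i j = 0 := by
  have hGG : G * G⁻¹ = 1 := Matrix.mul_nonsing_inv _ hG.isUnit_det
  have key : (cyclicGauge ζ)ᴴ * G = G * gramAdjoint G (cyclicGauge ζ) := by
    simp only [gramAdjoint, ← mul_assoc, hGG, one_mul]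
  set W := gramAdjoint G (cyclicGauge ζ) with hW
  have hent : ∀ i j, star (![1, ζ, ζ ^ 2] i) * G i j = G i j * W j j := fun i j => by
    have e := congrFun (congrFun key i) j
    rw [cyclicGauge, Matrix.diagonal_conjTranspose, Matrix.diagonal_mul, Matrix.mul_apply,
      Finset.sum_eq_single j (fun k _ hk => by rw [h k j hk, mul_zero]) (by simp)] at e
    exact e
  have hdiag : ∀ j, star (![1, ζ, ζ ^ 2] j) = W j j := fun j => by
    have h0 : G j j ≠ 0 := (hG.diag_pos (i := j)).ne'
    exact mul_left_cancel₀ h0 (by rw [← hent j j, mul_comm])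
  intro i j hij
  have h1 := hent i j
  rw [← hdiag j] at h1
  have h2 : star (![1, ζ, ζ ^ 2] i - ![1, ζ, ζ ^ 2] j) * G i j = 0 := by
    rw [star_sub]; linear_combination h1
  refine (mul_eq_zero.1 h2).resolve_left fun h3 => ?_
  rw [star_eq_zero] at h3
  have hne1 : ζ - 1 ≠ 0 := fun h => by
    have : ζ = 1 := sub_eq_zero.1 h
    rw [this] at hζ; norm_num at hζ
  have hne0 : ζ ≠ 0 := fun h => by rw [h] at hζ; norm_num at hζ
  have hne2 : ζ + 1 ≠ 0 := fun h => by
    have : ζ ^ 2 = 0 := by linear_combination hζ - h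
    exact hne0 (by simpa using this)
  fin_cases i <;> fin_cases j <;> simp at h3 hij
  · exact hne1 (by linear_combination -h3)
  · exact mul_ne_zero hne1 hne2 (by linear_combination -h3)
  · exact hne1 (by linear_combination h3)
  · exact mul_ne_zero hne0 hne1 (by linear_combination -h3)
  · exact mul_ne_zero hne1 hne2 (by linear_combination h3)
  · exact mul_ne_zero hne0 hne1 (by linear_combination h3)

/-- The change of Gram matrix under the change of frame `diag (l, 1, l⁻¹)`. -/
def scaleGram (l : ℂ) (G : Matrix (Fin 3) (Fin 3) ℂ) : Matrix (Fin 3) (Fin 3) ℂ :=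
  (Matrix.diagonal ![l, 1, l⁻¹])ᴴ * G * Matrix.diagonal ![l, 1, l⁻¹]

lemma scaleGram_apply (l : ℂ) (G : Matrix (Fin 3) (Fin 3) ℂ) (i j : Fin 3) :
    scaleGram l G i j = star (![l, 1, l⁻¹] i) * G i j * ![l, 1, l⁻¹] j := by
  simp [scaleGram, Matrix.diagonal_conjTranspose, Matrix.diagonal_mul, Matrix.mul_diagonal]

/-- The change of frame is diagonal and commutes with γ, so γ keeps its matrix and its adjoint is
conjugated. The entries therefore transform as sections of the corresponding Hom bundles. -/
lemma gramAdjoint_scaleGram {l : ℂ} (hl : l ≠ 0) (G : Matrix (Fin 3) (Fin 3) ℂ) :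
    gramAdjoint (scaleGram l G) (cyclicGauge ζ) =
      Matrix.diagonal ![l⁻¹, 1, l] * gramAdjoint G (cyclicGauge ζ) * Matrix.diagonal ![l, 1, l⁻¹] := by
  have h1 : Matrix.diagonal ![l, 1, l⁻¹] * Matrix.diagonal ![l⁻¹, 1, l] = 1 := by
    rw [Matrix.diagonal_mul_diagonal, ← Matrix.diagonal_one]
    congr 1; ext i; fin_cases i <;> simp [hl]
  have h2 : (Matrix.diagonal ![l, 1, l⁻¹])⁻¹ = Matrix.diagonal ![l⁻¹, 1, l] :=
    Matrix.inv_eq_right_inv h1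
  set D := Matrix.diagonal ![l, 1, l⁻¹] with hD
  have hu : IsUnit Dᴴ.det := by
    rw [Matrix.det_conjTranspose]
    exact (IsUnit.of_mul_eq_one _ (by rw [← Matrix.det_mul, h1, Matrix.det_one])).star
  have h3 : (cyclicGauge ζ)ᴴ * Dᴴ = Dᴴ * (cyclicGauge ζ)ᴴ := by
    rw [hD, cyclicGauge, Matrix.diagonal_conjTranspose, Matrix.diagonal_conjTranspose,
      Matrix.diagonal_mul_diagonal, Matrix.diagonal_mul_diagonal]
    congr 1; ext i; exact mul_comm _ _
  have h4 : Dᴴ⁻¹ * Dᴴ = 1 := Matrix.nonsing_inv_mul _ hu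
  simp only [gramAdjoint, scaleGram, Matrix.mul_inv_rev, ← hD, h2]
  rw [show Matrix.diagonal ![l⁻¹, 1, l] * (G⁻¹ * Dᴴ⁻¹) * (cyclicGauge ζ)ᴴ * (Dᴴ * G * D) =
    Matrix.diagonal ![l⁻¹, 1, l] * (G⁻¹ * (Dᴴ⁻¹ * ((cyclicGauge ζ)ᴴ * Dᴴ)) * G) * D by
      simp only [mul_assoc], h3, ← mul_assoc Dᴴ⁻¹, h4, one_mul]

lemma gramAdjoint_scaleGram_apply {l : ℂ} (hl : l ≠ 0) (G : Matrix (Fin 3) (Fin 3) ℂ)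
    (i j : Fin 3) :
    gramAdjoint (scaleGram l G) (cyclicGauge ζ) i j =
      ![l⁻¹, 1, l] i * gramAdjoint G (cyclicGauge ζ) i j * ![l, 1, l⁻¹] j := by
  rw [gramAdjoint_scaleGram hl, Matrix.mul_diagonal, Matrix.diagonal_mul]

/-- Only diagonal entries of the adjoint meet the diagonal γ in the trace, and conjugation by a
diagonal matrix fixes them. Thus |γ|² is a function on the surface. -/
lemma gramNormSq_scaleGram {l : ℂ} (hl : l ≠ 0) (G : Matrix (Fin 3) (Fin 3) ℂ) :
    gramNormSq (scaleGram l G) (cyclicGauge ζ) = gramNormSq G (cyclicGauge ζ) := by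
  have h : ∀ G, gramNormSq G (cyclicGauge ζ) =
      ∑ i, gramAdjoint G (cyclicGauge ζ) i i * ![1, ζ, ζ ^ 2] i := fun G => by
    rw [gramNormSq, Matrix.trace]
    simp only [Matrix.diag_apply]
    conv_lhs => rw [cyclicGauge]
    simp only [Matrix.mul_diagonal]
    rfl
  rw [h, h]
  simp only [gramAdjoint_scaleGram_apply hl, Fin.sum_univ_three]
  simp
  field_simp

end CyclicAlgebra

/-! ### Laplacians of logarithms. -/

section DiagonalGram

open scoped ComplexOrder

lemma planeLaplacian_const_mul {f : ℂ → ℝ} {z : ℂ} (hf : ContDiffAt ℝ 2 f z) (c : ℝ) :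
    planeLaplacian (fun w => c * f w) z = c * planeLaplacian f z := by
  have key : ∀ v, secondDeriv (fun w => c * f w) v z = c * secondDeriv f v z := fun v => by
    have h1 : (fun w => fderiv ℝ (fun w => c * f w) w v) =ᶠ[𝓝 z] fun w => c * fderiv ℝ f w v := by
      filter_upwards [hf.eventually (by simp)] with w hw
      rw [fderiv_const_mul (hw.differentiableAt (by simp))]; rfl
    have hd : DifferentiableAt ℝ (fun w => fderiv ℝ f w v) z :=
      ((hf.fderiv_right (m := 1) (by norm_num)).differentiableAt (by simp)).clm_apply
        (differentiableAt_const v)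
    simp only [secondDeriv]
    rw [h1.fderiv_eq, fderiv_const_mul hd]; rfl
  simp only [planeLaplacian, key]; ring

/-- This is Δ = 4 Re ∂̄∂ together with ∂ log f = f⁻¹ ∂f; the complex copy g allows a diagonal Gram
entry to be inserted directly. -/
lemma planeLaplacian_log {f : ℂ → ℝ} {g : ℂ → ℂ} {z : ℂ}
    (hf : ∀ᶠ w in 𝓝 z, ContDiffAt ℝ ∞ f w) (hpos : 0 < f z) (hg : ∀ᶠ w in 𝓝 z, (f w : ℂ) = g w) :
    planeLaplacian (fun w => Real.log (f w)) z =
      4 * (wirtingerZBar (fun w => (g w)⁻¹ * wirtingerZ g w) z).re := by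
  have hlog : ContDiffAt ℝ 2 (fun w => Real.log (f w)) z :=
    (hf.self_of_nhds.of_le (by norm_cast)).log hpos.ne'
  have h := re_wirtingerZBar_wirtingerZ_ofReal hlog
  have hev : (wirtingerZ fun w => (Real.log (f w) : ℂ)) =ᶠ[𝓝 z]
      fun w => (g w)⁻¹ * wirtingerZ g w := by
    filter_upwards [hf, hg.eventually_nhds,
      hf.self_of_nhds.continuousAt.eventually (lt_mem_nhds hpos)] with w hw hgw hposw
    have hd := hw.differentiableAt (by simp)
    rw [← wirtingerZ_congr hgw, ← hgw.self_of_nhds]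
    have e1 : HasFDerivAt (fun w => (Real.log (f w) : ℂ))
        (Complex.ofRealCLM.comp ((f w)⁻¹ • fderiv ℝ f w)) w :=
      Complex.ofRealCLM.hasFDerivAt.comp w (hd.hasFDerivAt.log hposw.ne')
    have e2 : HasFDerivAt (fun w => (f w : ℂ)) (Complex.ofRealCLM.comp (fderiv ℝ f w)) w :=
      Complex.ofRealCLM.hasFDerivAt.comp w hd.hasFDerivAt
    simp only [wirtingerZ, e1.fderiv, e2.fderiv]
    simp
    ring
  rw [wirtingerZBar_congr hev] at h
  linarith

/-- Since ∂ log(p p̄) = p'/p is holomorphic, ∂̄ kills it. -/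
lemma planeLaplacian_log_normSq {p : ℂ → ℂ} {z : ℂ} (hp : ∀ᶠ w in 𝓝 z, DifferentiableAt ℂ p w)
    (h0 : p z ≠ 0) : planeLaplacian (fun w => Real.log (Complex.normSq (p w))) z = 0 := by
  have hsm : ∀ᶠ w in 𝓝 z, ContDiffAt ℝ ∞ p w := by
    filter_upwards [hp.eventually_nhds] with w hw
    exact (Complex.analyticAt_iff_eventually_differentiableAt.2 hw).contDiffAt.restrict_scalars ℝ
  have hns : ∀ᶠ w in 𝓝 z, ContDiffAt ℝ ∞ (fun w => Complex.normSq (p w)) w := by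
    filter_upwards [hsm] with w hw
    simp only [Complex.normSq_apply]
    have h1 : ContDiffAt ℝ ∞ (fun w => (p w).re) w := Complex.reCLM.contDiff.contDiffAt.comp w hw
    have h2 : ContDiffAt ℝ ∞ (fun w => (p w).im) w := Complex.imCLM.contDiff.contDiffAt.comp w hw
    exact (h1.mul h1).add (h2.mul h2)
  have hg : ∀ᶠ w in 𝓝 z, (Complex.normSq (p w) : ℂ) = p w * star (p w) :=
    .of_forall fun w => (Complex.mul_conj (p w)).symm
  rw [planeLaplacian_log hns (Complex.normSq_pos.2 h0) hg]
  have hev : (fun w => (p w * star (p w))⁻¹ * wirtingerZ (fun w => p w * star (p w)) w) =ᶠ[𝓝 z]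
      fun w => (p w)⁻¹ * wirtingerZ p w := by
    filter_upwards [hp, hp.self_of_nhds.continuousAt.eventually_ne h0] with w hw hw0
    have hr : DifferentiableAt ℝ p w := hw.restrictScalars ℝ
    have hs : DifferentiableAt ℝ (fun w => star (p w)) w :=
      Complex.conjCLE.differentiableAt.comp w hr
    rw [wirtingerZ_mul hr hs, wirtingerZ_star hr, wirtingerZBar_eq_zero hw]
    have : star (p w) ≠ 0 := star_ne_zero.2 hw0
    field_simp
    simp
  have hd : wirtingerZ p =ᶠ[𝓝 z] deriv p := by
    filter_upwards [hp] with w hw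
    have h := (hw.hasFDerivAt.restrictScalars ℝ).fderiv
    have h2 : (fderiv ℂ p w) Complex.I = Complex.I * fderiv ℂ p w 1 := by
      rw [← smul_eq_mul, ← map_smul]; simp
    simp only [wirtingerZ, h, ContinuousLinearMap.coe_restrictScalars', h2, ← mul_assoc,
      Complex.I_mul_I, fderiv_apply_one_eq_deriv]
    ring
  have hhol : DifferentiableAt ℂ (fun w => (p w)⁻¹ * deriv p w) z := by
    have ha := Complex.analyticAt_iff_eventually_differentiableAt.2 hp
    exact (ha.differentiableAt.inv h0).mul ha.deriv.differentiableAt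
  rw [wirtingerZBar_congr (hev.trans (hd.mono fun w hw => congrArg ((p w)⁻¹ * ·) hw)), wirtingerZBar_eq_zero hhol]
  simp

end DiagonalGram

/-! ### The Toda system and the maximum principle for the two ratios. -/

section LocalRatios

open scoped ComplexOrder

/-- The data of a cyclic Higgs bundle with harmonic metric in a holomorphic frame, at the
point `z`: `G` is the Gram matrix, and `p`, `q` are the coefficients of the Higgs field. -/
structure CyclicHitchinAt (G : ℂ → Matrix (Fin 3) (Fin 3) ℂ) (p q : ℂ → ℂ) (z : ℂ) : Prop where
  smooth : SmoothEntries G z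
  posDef : (G z).PosDef
  p_diff : DifferentiableAt ℂ p z
  q_diff : DifferentiableAt ℂ q z
  q_ne : q z ≠ 0
  hitchin : chernCurvatureMatrix G z +
    (cyclicMatrix (p z) (q z) * gramAdjoint (G z) (cyclicMatrix (p z) (q z)) -
      gramAdjoint (G z) (cyclicMatrix (p z) (q z)) * cyclicMatrix (p z) (q z)) = 0

/-- The square of `‖t‖ / ‖τ‖`, for `t` in `Hom(𝒪, L) ⊗ K`, in a frame. -/
def ratioUpper (G : Matrix (Fin 3) (Fin 3) ℂ) (p q : ℂ) : ℝ :=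
  Complex.normSq p * (G 0 0).re ^ 2 / (Complex.normSq q * (G 1 1).re * (G 2 2).re)

/-- The square of `‖t‖ / ‖τ‖`, for `t` in `Hom(L⁻¹, 𝒪) ⊗ K`, in a frame. -/
def ratioLower (G : Matrix (Fin 3) (Fin 3) ℂ) (p q : ℂ) : ℝ :=
  Complex.normSq p * (G 0 0).re * (G 1 1).re / (Complex.normSq q * (G 2 2).re ^ 2)

variable {G : ℂ → Matrix (Fin 3) (Fin 3) ℂ} {p q : ℂ → ℂ} {z : ℂ}

lemma Matrix.PosDef.re_diag_pos {G : Matrix (Fin 3) (Fin 3) ℂ} (hG : G.PosDef) (i : Fin 3) :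
    0 < (G i i).re := (Complex.pos_iff.1 (hG.diag_pos (i := i))).1

lemma Matrix.PosDef.ofReal_re_diag {G : Matrix (Fin 3) (Fin 3) ℂ} (hG : G.PosDef) (i : Fin 3) :
    ((G i i).re : ℂ) = G i i :=
  Complex.ext rfl (Complex.pos_iff.1 (hG.diag_pos (i := i))).2

lemma eq_diagonal_of_offDiag {G : Matrix (Fin 3) (Fin 3) ℂ} (h : ∀ i j, i ≠ j → G i j = 0) :
    G = Matrix.diagonal fun i => G i i := by
  ext i j
  by_cases hij : i = j
  · subst hij; simp
  · rw [h i j hij, Matrix.diagonal_apply_ne _ hij]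

lemma inv_diagonal_of_ne {g : Fin 3 → ℂ} (hg : ∀ i, g i ≠ 0) :
    (Matrix.diagonal g)⁻¹ = Matrix.diagonal fun i => (g i)⁻¹ := by
  apply Matrix.inv_eq_right_inv
  rw [Matrix.diagonal_mul_diagonal, ← Matrix.diagonal_one]
  congr 1; ext i; exact mul_inv_cancel₀ (hg i)

lemma gramAdjoint_apply_of_offDiag {G : Matrix (Fin 3) (Fin 3) ℂ} (hG : G.PosDef)
    (h : ∀ i j, i ≠ j → G i j = 0) (A : Matrix (Fin 3) (Fin 3) ℂ) (i j : Fin 3) :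
    gramAdjoint G A i j = (G i i)⁻¹ * star (A j i) * G j j := by
  have hne : ∀ i, G i i ≠ 0 := fun i => (hG.diag_pos (i := i)).ne'
  conv_lhs => rw [eq_diagonal_of_offDiag h]
  rw [gramAdjoint, inv_diagonal_of_ne hne, Matrix.mul_diagonal, Matrix.diagonal_mul,
    Matrix.conjTranspose_apply]

/-- For a diagonal metric the Chern form is diagonal with entries ∂ log hᵢ, so the diagonal of
Hitchin's equation computes Δ log hᵢ. -/
lemma planeLaplacian_log_diag (h : ∀ᶠ w in 𝓝 z, CyclicHitchinAt G p q w)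
    (hoff : ∀ᶠ w in 𝓝 z, ∀ i j, i ≠ j → G w i j = 0) (i : Fin 3) :
    planeLaplacian (fun w => Real.log (G w i i).re) z =
      4 * ((cyclicMatrix (p z) (q z) * gramAdjoint (G z) (cyclicMatrix (p z) (q z)) -
        gramAdjoint (G z) (cyclicMatrix (p z) (q z)) * cyclicMatrix (p z) (q z)) i i).re := by
  have hz := h.self_of_nhds
  rw [planeLaplacian_log (f := fun w => (G w i i).re) (g := fun w => G w i i) ?_ (hz.posDef.re_diag_pos i)
    (h.mono fun w hw => hw.posDef.ofReal_re_diag i)]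
  · have hev : (fun w => (G w i i)⁻¹ * wirtingerZ (fun w => G w i i) w) =ᶠ[𝓝 z]
        fun w => chernForm G w i i := by
      filter_upwards [h, hoff] with w hw how
      have hne : ∀ i, G w i i ≠ 0 := fun i => (hw.posDef.diag_pos (i := i)).ne'
      rw [chernForm]
      conv_rhs => rw [eq_diagonal_of_offDiag how, inv_diagonal_of_ne hne, Matrix.diagonal_mul]
      rfl
    rw [wirtingerZBar_congr hev]
    have e := congrFun (congrFun (neg_add_eq_zero.1 hz.hitchin) i) i
    rw [← e]; rfl
  · exact h.mono fun w hw => Complex.reCLM.contDiff.contDiffAt.comp w (hw.smooth i i)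

lemma commutator_diag {G : Matrix (Fin 3) (Fin 3) ℂ} (hG : G.PosDef)
    (h : ∀ i j, i ≠ j → G i j = 0) (p q : ℂ) (i : Fin 3) :
    ((cyclicMatrix p q * gramAdjoint G (cyclicMatrix p q) -
      gramAdjoint G (cyclicMatrix p q) * cyclicMatrix p q) i i).re =
    ![Complex.normSq p * (G 0 0).re / (G 1 1).re - Complex.normSq q * (G 2 2).re / (G 0 0).re,
      Complex.normSq p * (G 1 1).re / (G 2 2).re - Complex.normSq p * (G 0 0).re / (G 1 1).re,
      Complex.normSq q * (G 2 2).re / (G 0 0).re - Complex.normSq p * (G 1 1).re / (G 2 2).re] i := by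
  have key : ∀ (p : ℂ) (i j : Fin 3), p * ((G i i)⁻¹ * star p * G j j) =
      ((Complex.normSq p * (G j j).re / (G i i).re : ℝ) : ℂ) := fun p i j => by
    have h1 : p * star p = (Complex.normSq p : ℂ) := Complex.mul_conj p
    push_cast
    rw [hG.ofReal_re_diag, hG.ofReal_re_diag, ← h1]; ring
  have key' : ∀ (p : ℂ) (i j : Fin 3), ((G i i)⁻¹ * star p * G j j) * p =
      ((Complex.normSq p * (G j j).re / (G i i).re : ℝ) : ℂ) := fun p i j => by
    rw [mul_comm, key]
  have c00 : cyclicMatrix p q 0 0 = 0 := rfl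
  have c01 : cyclicMatrix p q 0 1 = p := rfl
  have c02 : cyclicMatrix p q 0 2 = 0 := rfl
  have c10 : cyclicMatrix p q 1 0 = 0 := rfl
  have c11 : cyclicMatrix p q 1 1 = 0 := rfl
  have c12 : cyclicMatrix p q 1 2 = p := rfl
  have c20 : cyclicMatrix p q 2 0 = q := rfl
  have c21 : cyclicMatrix p q 2 1 = 0 := rfl
  have c22 : cyclicMatrix p q 2 2 = 0 := rfl
  have hsub : ∀ a b : ℝ, ((a : ℂ) - (b : ℂ)).re = a - b := fun a b => by simp
  fin_cases i <;>
  simp only [Fin.zero_eta, Fin.mk_one, Fin.reduceFinMk, Matrix.sub_apply, Matrix.mul_apply,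
    Fin.sum_univ_three, gramAdjoint_apply_of_offDiag hG h, c00, c01, c02, c10, c11, c12, c20, c21,
    c22, key, key', Complex.normSq_zero, zero_mul, zero_div, Complex.ofReal_zero, add_zero,
    zero_add, hsub] <;> rfl

lemma planeLaplacian_congr {f g : ℂ → ℝ} (h : f =ᶠ[𝓝 z] g) :
    planeLaplacian f z = planeLaplacian g z := by
  have key : ∀ v, secondDeriv f v z = secondDeriv g v z := fun v => by
    have h1 : (fun w => fderiv ℝ f w v) =ᶠ[𝓝 z] fun w => fderiv ℝ g w v :=
      h.fderiv.mono fun w hw => congrArg (fun L : ℂ →L[ℝ] ℝ => L v) hw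
    simp only [secondDeriv, h1.fderiv_eq]
  simp only [planeLaplacian, key]

/-- The strong maximum principle for the logarithm of a ratio `ρ` that satisfies
`Δ log ρ = 12 c (ρ - 1)`. -/
lemma eventually_eq_of_planeLaplacian_log {ρ c : ℂ → ℝ} (hc : ContinuousAt c z)
    (hc0 : ∀ᶠ w in 𝓝 z, 0 ≤ c w) (hρ : ∀ᶠ w in 𝓝 z, ContDiffAt ℝ 2 (fun w => Real.log (ρ w)) w)
    (hpos : ∀ᶠ w in 𝓝 z, 0 < ρ w) (hL : ∀ᶠ w in 𝓝 z,
      planeLaplacian (fun w => Real.log (ρ w)) w = 12 * c w * (ρ w - 1))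
    (h1 : 1 ≤ ρ z) (hmax : ∀ᶠ w in 𝓝 z, ρ w ≤ ρ z) : ∀ᶠ w in 𝓝 z, ρ w = ρ z := by
  have hz0 : 0 < ρ z := by linarith
  have hconst : ∀ w, ContDiffAt ℝ 2 (fun _ : ℂ => -Real.log (ρ z)) w := fun w => contDiffAt_const
  have hlap0 : ∀ w, planeLaplacian (fun _ : ℂ => -Real.log (ρ z)) w = 0 := fun w => by
    simp [planeLaplacian, secondDeriv]
  have hC : 0 ≤ 12 * (c z + 1) := by linarith [hc0.self_of_nhds]
  have key := eventually_eq_zero_of_planeLaplacian_ge (z₀ := z)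
    (f := fun w => Real.log (ρ w) + -Real.log (ρ z)) (C := 12 * (c z + 1)) hC
    (hρ.mono fun w hw => hw.add (hconst w)) ?_ (by simp) ?_
  · filter_upwards [key, hpos] with w hw hw0
    exact Real.log_injOn_pos hw0 hz0 (by linarith)
  · filter_upwards [hmax, hpos] with w hw hw0
    have := Real.log_le_log hw0 hw
    linarith
  · filter_upwards [hmax, hpos, hρ, hL, hc0, hc.eventually (gt_mem_nhds (lt_add_one (c z)))]
      with w hw hw0 hρw hLw hcw hcw'
    rw [planeLaplacian_add hρw (hconst w), hlap0, add_zero, hLw]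
    -- Here log ρ ≤ ρ - 1, and the hypothesis ρ z ≥ 1 gives log ρ z ≥ 0. As the left side is also
    -- nonpositive, c w may be replaced by the larger constant c z + 1.
    have e1 : Real.log (ρ w) + -Real.log (ρ z) ≤ ρ w - 1 := by
      have := Real.log_le_sub_one_of_pos hw0
      have := Real.log_nonneg h1
      linarith
    have e2 : Real.log (ρ w) + -Real.log (ρ z) ≤ 0 := by
      have := Real.log_le_log hw0 hw
      linarith
    nlinarith

lemma contDiffAt_normSq (hp : ∀ᶠ w in 𝓝 z, DifferentiableAt ℂ p w) :
    ContDiffAt ℝ 2 (fun w => Complex.normSq (p w)) z := by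
  have hw : ContDiffAt ℝ 2 p z :=
    (Complex.analyticAt_iff_eventually_differentiableAt.2 hp).contDiffAt.restrict_scalars ℝ
  simp only [Complex.normSq_apply]
  have h1 : ContDiffAt ℝ 2 (fun w => (p w).re) z := Complex.reCLM.contDiff.contDiffAt.comp z hw
  have h2 : ContDiffAt ℝ 2 (fun w => (p w).im) z := Complex.imCLM.contDiff.contDiffAt.comp z hw
  exact (h1.mul h1).add (h2.mul h2)

lemma CyclicHitchinAt.contDiffAt_re_diag (h : CyclicHitchinAt G p q z) (i : Fin 3) :
    ContDiffAt ℝ 2 (fun w => (G w i i).re) z :=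
  Complex.reCLM.contDiff.contDiffAt.comp z ((h.smooth i i).of_le (by norm_cast))

/-- The Laplacian of `log (|p|² / |q|² h₀ᵃ h₁ᵇ h₂ᶜ)` for the diagonal entries `hᵢ` of `G`. -/
lemma planeLaplacian_log_combination (h : ∀ᶠ w in 𝓝 z, CyclicHitchinAt G p q w)
    (hoff : ∀ᶠ w in 𝓝 z, ∀ i j, i ≠ j → G w i j = 0) (hp : p z ≠ 0) (k : Fin 3 → ℝ) :
    let f := fun w => Real.log (Complex.normSq (p w)) + (-1 * Real.log (Complex.normSq (q w)) +
      (k 0 * Real.log (G w 0 0).re + (k 1 * Real.log (G w 1 1).re + k 2 * Real.log (G w 2 2).re)))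
    ContDiffAt ℝ 2 f z ∧ planeLaplacian f z =
      4 * (k 0 * (Complex.normSq (p z) * (G z 0 0).re / (G z 1 1).re -
        Complex.normSq (q z) * (G z 2 2).re / (G z 0 0).re) +
      k 1 * (Complex.normSq (p z) * (G z 1 1).re / (G z 2 2).re -
        Complex.normSq (p z) * (G z 0 0).re / (G z 1 1).re) +
      k 2 * (Complex.normSq (q z) * (G z 2 2).re / (G z 0 0).re -
        Complex.normSq (p z) * (G z 1 1).re / (G z 2 2).re)) := by
  intro f
  have hz := h.self_of_nhds
  have hpe := h.mono fun w hw => hw.p_diff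
  have hqe := h.mono fun w hw => hw.q_diff
  have s1 : ContDiffAt ℝ 2 (fun w => Real.log (Complex.normSq (p w))) z :=
    (contDiffAt_normSq hpe).log (Complex.normSq_pos.2 hp).ne'
  have s2 : ContDiffAt ℝ 2 (fun w => Real.log (Complex.normSq (q w))) z :=
    (contDiffAt_normSq hqe).log (Complex.normSq_pos.2 hz.q_ne).ne'
  have s3 : ∀ i, ContDiffAt ℝ 2 (fun w => Real.log (G w i i).re) z := fun i =>
    (hz.contDiffAt_re_diag i).log (hz.posDef.re_diag_pos i).ne'
  have s2' : ContDiffAt ℝ 2 (fun w => -1 * Real.log (Complex.normSq (q w))) z :=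
    contDiffAt_const.mul s2
  have s3' : ∀ i, ContDiffAt ℝ 2 (fun w => k i * Real.log (G w i i).re) z := fun i =>
    contDiffAt_const.mul (s3 i)
  have t1 := (s3' 1).add (s3' 2)
  have t2 := (s3' 0).add t1
  have t3 := s2'.add t2
  refine ⟨s1.add t3, ?_⟩
  rw [planeLaplacian_add s1 t3, planeLaplacian_add s2' t2, planeLaplacian_add (s3' 0) t1,
    planeLaplacian_add (s3' 1) (s3' 2), planeLaplacian_const_mul s2,
    planeLaplacian_const_mul (s3 0), planeLaplacian_const_mul (s3 1),
    planeLaplacian_const_mul (s3 2), planeLaplacian_log_normSq hpe hp,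
    planeLaplacian_log_normSq hqe hz.q_ne, planeLaplacian_log_diag h hoff,
    planeLaplacian_log_diag h hoff, planeLaplacian_log_diag h hoff,
    commutator_diag hz.posDef hoff.self_of_nhds, commutator_diag hz.posDef hoff.self_of_nhds,
    commutator_diag hz.posDef hoff.self_of_nhds]
  simp only [Matrix.cons_val]
  ring

/-- The coefficient `|q|² h₂ / h₀` is continuous. -/
lemma CyclicHitchinAt.continuousAt_weight (h : CyclicHitchinAt G p q z) :
    ContinuousAt (fun w => Complex.normSq (q w) * (G w 2 2).re / (G w 0 0).re) z :=
  ((Complex.continuous_normSq.continuousAt.comp h.q_diff.continuousAt).mul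
    (h.contDiffAt_re_diag 2).continuousAt).div (h.contDiffAt_re_diag 0).continuousAt
    (h.posDef.re_diag_pos 0).ne'

/-- With a, b, c as in the Toda system, ρ = a/c, and the weights (2, -1, -1) give 4 (2(a - c) - (b -
a) - (c - b)) = 12 (a - c) = 12 c (ρ - 1). The bound ρ ≥ 1 at the maximum keeps p away from zero
nearby, so the logarithms make sense. -/
theorem eventually_ratioUpper_eq (h : ∀ᶠ w in 𝓝 z, CyclicHitchinAt G p q w)
    (hoff : ∀ᶠ w in 𝓝 z, ∀ i j, i ≠ j → G w i j = 0)
    (h1 : 1 ≤ ratioUpper (G z) (p z) (q z))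
    (hmax : ∀ᶠ w in 𝓝 z, ratioUpper (G w) (p w) (q w) ≤ ratioUpper (G z) (p z) (q z)) :
    ∀ᶠ w in 𝓝 z, ratioUpper (G w) (p w) (q w) = ratioUpper (G z) (p z) (q z) := by
  have hz := h.self_of_nhds
  have hp : p z ≠ 0 := by
    intro h0
    rw [ratioUpper, h0] at h1
    norm_num at h1
  have hpe : ∀ᶠ w in 𝓝 z, p w ≠ 0 := hz.p_diff.continuousAt.eventually_ne hp
  have hlog : ∀ᶠ w in 𝓝 z, Real.log (ratioUpper (G w) (p w) (q w)) =
      Real.log (Complex.normSq (p w)) + (-1 * Real.log (Complex.normSq (q w)) +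
        (2 * Real.log (G w 0 0).re + (-1 * Real.log (G w 1 1).re + -1 * Real.log (G w 2 2).re))) := by
    filter_upwards [h, hpe] with w hw hpw
    have a := (Complex.normSq_pos.2 hpw).ne'
    have b := (Complex.normSq_pos.2 hw.q_ne).ne'
    have c := fun i => (hw.posDef.re_diag_pos i).ne'
    rw [ratioUpper, Real.log_div (mul_ne_zero a (pow_ne_zero _ (c 0)))
      (mul_ne_zero (mul_ne_zero b (c 1)) (c 2)), Real.log_mul a (pow_ne_zero _ (c 0)),
      Real.log_mul (mul_ne_zero b (c 1)) (c 2), Real.log_mul b (c 1), Real.log_pow]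
    push_cast; ring
  refine eventually_eq_of_planeLaplacian_log (ρ := fun w => ratioUpper (G w) (p w) (q w))
    hz.continuousAt_weight ?_ ?_ ?_ ?_ h1 hmax
  · filter_upwards [h] with w hw
    have := hw.posDef.re_diag_pos
    have := Complex.normSq_nonneg (q w)
    exact div_nonneg (mul_nonneg this (hw.posDef.re_diag_pos 2).le) (hw.posDef.re_diag_pos 0).le
  · filter_upwards [h.eventually_nhds, hoff.eventually_nhds, hpe, hlog.eventually_nhds]
      with w hw how hpw hlw
    exact (planeLaplacian_log_combination hw how hpw ![2, -1, -1]).1.congr_of_eventuallyEq hlw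
  · filter_upwards [h, hpe] with w hw hpw
    have a := Complex.normSq_pos.2 hpw
    have b := Complex.normSq_pos.2 hw.q_ne
    have c := hw.posDef.re_diag_pos
    exact div_pos (mul_pos a (pow_pos (c 0) 2)) (mul_pos (mul_pos b (c 1)) (c 2))
  · filter_upwards [h.eventually_nhds, hoff.eventually_nhds, hpe, hlog.eventually_nhds]
      with w hw how hpw hlw
    refine (planeLaplacian_congr hlw).trans
      ((planeLaplacian_log_combination hw how hpw ![2, -1, -1]).2.trans ?_)
    have b := (Complex.normSq_pos.2 hw.self_of_nhds.q_ne).ne'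
    have c := fun i => (hw.self_of_nhds.posDef.re_diag_pos i).ne'
    have c0 := c 0
    have c1 := c 1
    have c2 := c 2
    simp only [Matrix.cons_val, ratioUpper]
    field_simp
    ring

/-- Now ρ = b/c, and the weights (1, 1, -2) give 4 ((a - c) + (b - a) - 2(c - b)) = 12 (b - c) = 12
c (ρ - 1). -/
theorem eventually_ratioLower_eq (h : ∀ᶠ w in 𝓝 z, CyclicHitchinAt G p q w)
    (hoff : ∀ᶠ w in 𝓝 z, ∀ i j, i ≠ j → G w i j = 0)
    (h1 : 1 ≤ ratioLower (G z) (p z) (q z))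
    (hmax : ∀ᶠ w in 𝓝 z, ratioLower (G w) (p w) (q w) ≤ ratioLower (G z) (p z) (q z)) :
    ∀ᶠ w in 𝓝 z, ratioLower (G w) (p w) (q w) = ratioLower (G z) (p z) (q z) := by
  have hz := h.self_of_nhds
  have hp : p z ≠ 0 := by
    intro h0
    rw [ratioLower, h0] at h1
    norm_num at h1
  have hpe : ∀ᶠ w in 𝓝 z, p w ≠ 0 := hz.p_diff.continuousAt.eventually_ne hp
  have hlog : ∀ᶠ w in 𝓝 z, Real.log (ratioLower (G w) (p w) (q w)) =
      Real.log (Complex.normSq (p w)) + (-1 * Real.log (Complex.normSq (q w)) +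
        (1 * Real.log (G w 0 0).re + (1 * Real.log (G w 1 1).re + -2 * Real.log (G w 2 2).re))) := by
    filter_upwards [h, hpe] with w hw hpw
    have a := (Complex.normSq_pos.2 hpw).ne'
    have b := (Complex.normSq_pos.2 hw.q_ne).ne'
    have c := fun i => (hw.posDef.re_diag_pos i).ne'
    rw [ratioLower, Real.log_div (mul_ne_zero (mul_ne_zero a (c 0)) (c 1))
      (mul_ne_zero b (pow_ne_zero _ (c 2))), Real.log_mul b (pow_ne_zero _ (c 2)),
      Real.log_mul (mul_ne_zero a (c 0)) (c 1), Real.log_mul a (c 0), Real.log_pow]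
    push_cast; ring
  refine eventually_eq_of_planeLaplacian_log (ρ := fun w => ratioLower (G w) (p w) (q w))
    hz.continuousAt_weight ?_ ?_ ?_ ?_ h1 hmax
  · filter_upwards [h] with w hw
    have := hw.posDef.re_diag_pos
    have := Complex.normSq_nonneg (q w)
    exact div_nonneg (mul_nonneg this (hw.posDef.re_diag_pos 2).le) (hw.posDef.re_diag_pos 0).le
  · filter_upwards [h.eventually_nhds, hoff.eventually_nhds, hpe, hlog.eventually_nhds]
      with w hw how hpw hlw
    exact (planeLaplacian_log_combination hw how hpw ![1, 1, -2]).1.congr_of_eventuallyEq hlw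
  · filter_upwards [h, hpe] with w hw hpw
    have a := Complex.normSq_pos.2 hpw
    have b := Complex.normSq_pos.2 hw.q_ne
    have c := hw.posDef.re_diag_pos
    exact div_pos (mul_pos (mul_pos a (c 0)) (c 1)) (mul_pos b (pow_pos (c 2) 2))
  · filter_upwards [h.eventually_nhds, hoff.eventually_nhds, hpe, hlog.eventually_nhds]
      with w hw how hpw hlw
    refine (planeLaplacian_congr hlw).trans
      ((planeLaplacian_log_combination hw how hpw ![1, 1, -2]).2.trans ?_)
    have b := (Complex.normSq_pos.2 hw.self_of_nhds.q_ne).ne'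
    have c := fun i => (hw.self_of_nhds.posDef.re_diag_pos i).ne'
    have c0 := c 0
    have c1 := c 1
    have c2 := c 2
    simp only [Matrix.cons_val, ratioLower]
    field_simp
    ring

end LocalRatios

/-! ### Independence of the ratios from the frame and the coordinate. -/

section RatioScaling

lemma scaleGram_diag_re (l : ℂ) (G : Matrix (Fin 3) (Fin 3) ℂ) :
    (scaleGram l G 0 0).re = Complex.normSq l * (G 0 0).re ∧
      (scaleGram l G 1 1).re = (G 1 1).re ∧
      (scaleGram l G 2 2).re = (Complex.normSq l)⁻¹ * (G 2 2).re := by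
  have key : ∀ a b : ℂ, star a * b * a = ((Complex.normSq a : ℝ) : ℂ) * b := fun a b => by
    have h1 : a * star a = (Complex.normSq a : ℂ) := Complex.mul_conj a
    rw [← h1]; ring
  have hl : (![l, 1, l⁻¹] : Fin 3 → ℂ) 0 = l := rfl
  have h1 : (![l, 1, l⁻¹] : Fin 3 → ℂ) 1 = 1 := rfl
  have h2 : (![l, 1, l⁻¹] : Fin 3 → ℂ) 2 = l⁻¹ := rfl
  refine ⟨?_, ?_, ?_⟩ <;> rw [scaleGram_apply, key, Complex.re_ofReal_mul]
  · rw [hl]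
  · rw [h1, Complex.normSq_one, one_mul]
  · rw [h2, Complex.normSq_inv]

/-- The factor l changes the frame of L, and m the tangent vector at which t and τ are evaluated.
Invariance makes the ratio a function on the surface. -/
lemma ratioUpper_scale {l m : ℂ} (hl : l ≠ 0) (hm : m ≠ 0) (G : Matrix (Fin 3) (Fin 3) ℂ)
    (p q : ℂ) :
    ratioUpper (scaleGram l G) (m * l⁻¹ * p) (m * l ^ 2 * q) = ratioUpper G p q := by
  obtain ⟨e0, e1, e2⟩ := scaleGram_diag_re l G
  have hl' := (Complex.normSq_pos.2 hl).ne'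
  have hm' := (Complex.normSq_pos.2 hm).ne'
  simp only [ratioUpper, e0, e1, e2, map_mul, map_pow, map_inv₀]
  -- No positivity of G is assumed; if the denominator is zero, both quotients are zero by the
  -- convention for division.
  by_cases hd : Complex.normSq q * (G 1 1).re * (G 2 2).re = 0
  · rw [hd, div_zero]
    rw [show Complex.normSq m * Complex.normSq l ^ 2 * Complex.normSq q * (G 1 1).re *
      ((Complex.normSq l)⁻¹ * (G 2 2).re) = Complex.normSq m * Complex.normSq l ^ 2 *
      (Complex.normSq l)⁻¹ * (Complex.normSq q * (G 1 1).re * (G 2 2).re) by ring, hd]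
    simp
  · obtain ⟨⟨hq, h1⟩, h2⟩ := (by simpa [not_or] using hd :
      (¬q = 0 ∧ ¬(G 1 1).re = 0) ∧ ¬(G 2 2).re = 0)
    have hq' := (Complex.normSq_pos.2 hq).ne'
    field_simp

lemma ratioLower_scale {l m : ℂ} (hl : l ≠ 0) (hm : m ≠ 0) (G : Matrix (Fin 3) (Fin 3) ℂ)
    (p q : ℂ) :
    ratioLower (scaleGram l G) (m * l⁻¹ * p) (m * l ^ 2 * q) = ratioLower G p q := by
  obtain ⟨e0, e1, e2⟩ := scaleGram_diag_re l G
  have hl' := (Complex.normSq_pos.2 hl).ne'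
  have hm' := (Complex.normSq_pos.2 hm).ne'
  simp only [ratioLower, e0, e1, e2, map_mul, map_pow, map_inv₀]
  by_cases hd : Complex.normSq q * (G 2 2).re ^ 2 = 0
  · rw [hd, div_zero]
    rw [show Complex.normSq m * Complex.normSq l ^ 2 * Complex.normSq q *
      ((Complex.normSq l)⁻¹ * (G 2 2).re) ^ 2 = Complex.normSq m * Complex.normSq l ^ 2 *
      (Complex.normSq l)⁻¹ ^ 2 * (Complex.normSq q * (G 2 2).re ^ 2) by ring, hd]
    simp
  · obtain ⟨hq, h2⟩ := (by simpa [not_or] using hd : ¬q = 0 ∧ ¬(G 2 2).re = 0)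
    have hq' := (Complex.normSq_pos.2 hq).ne'
    field_simp

end RatioScaling

/-! ### Local consequences of the Bochner formula for the cyclic gauge transformation. -/

section LocalBochner

open scoped ComplexOrder

variable {G : ℂ → Matrix (Fin 3) (Fin 3) ℂ} {p q : ℂ → ℂ} {z ζ : ℂ}

lemma CyclicHitchinAt.continuousAt_diag (h : CyclicHitchinAt G p q z) (i : Fin 3) :
    ContinuousAt (fun w => (G w i i).re) z := (h.contDiffAt_re_diag i).continuousAt

lemma CyclicHitchinAt.continuousAt_ratioUpper (h : CyclicHitchinAt G p q z) :
    ContinuousAt (fun w => ratioUpper (G w) (p w) (q w)) z :=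
  ((Complex.continuous_normSq.continuousAt.comp h.p_diff.continuousAt).mul
    ((h.continuousAt_diag 0).pow 2)).div
    (((Complex.continuous_normSq.continuousAt.comp h.q_diff.continuousAt).mul
      (h.continuousAt_diag 1)).mul (h.continuousAt_diag 2))
    (mul_ne_zero (mul_ne_zero (Complex.normSq_pos.2 h.q_ne).ne' (h.posDef.re_diag_pos 1).ne')
      (h.posDef.re_diag_pos 2).ne')

lemma CyclicHitchinAt.continuousAt_ratioLower (h : CyclicHitchinAt G p q z) :
    ContinuousAt (fun w => ratioLower (G w) (p w) (q w)) z :=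
  (((Complex.continuous_normSq.continuousAt.comp h.p_diff.continuousAt).mul
    (h.continuousAt_diag 0)).mul (h.continuousAt_diag 1)).div
    ((Complex.continuous_normSq.continuousAt.comp h.q_diff.continuousAt).mul
      ((h.continuousAt_diag 2).pow 2))
    (mul_ne_zero (Complex.normSq_pos.2 h.q_ne).ne' (pow_ne_zero _ (h.posDef.re_diag_pos 2).ne'))

lemma CyclicHitchinAt.contDiffAt_gramNormSq (h : CyclicHitchinAt G p q z)
    (γ : Matrix (Fin 3) (Fin 3) ℂ) : ContDiffAt ℝ 2 (fun w => (gramNormSq (G w) γ).re) z :=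
  Complex.reCLM.contDiff.contDiffAt.comp z
    ((((h.smooth.gramAdjoint h.posDef γ).mul (.const γ)).trace).of_le (by norm_cast))

lemma planeLaplacian_gramNormSq (h : ∀ᶠ w in 𝓝 z, CyclicHitchinAt G p q w)
    (hζ : ζ ^ 2 + ζ + 1 = 0) :
    planeLaplacian (fun w => (gramNormSq (G w) (cyclicGauge ζ)).re) z =
      4 * ((gramNormSq (G z) (chernForm G z * cyclicGauge ζ - cyclicGauge ζ * chernForm G z)).re +
        (gramNormSq (G z) (gramAdjoint (G z) (cyclicMatrix (p z) (q z)) * cyclicGauge ζ -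
          star ζ • (cyclicGauge ζ * gramAdjoint (G z) (cyclicMatrix (p z) (q z))))).re) := by
  have hz := h.self_of_nhds
  have h1 := re_wirtingerZBar_wirtingerZ_ofReal (hz.contDiffAt_gramNormSq (cyclicGauge ζ))
  have hev : (fun w => ((gramNormSq (G w) (cyclicGauge ζ)).re : ℂ)) =ᶠ[𝓝 z]
      fun w => gramNormSq (G w) (cyclicGauge ζ) :=
    h.mono fun w hw => Complex.ext rfl (gramNormSq_im hw.posDef _).symm
  have hev2 : (wirtingerZ fun w => ((gramNormSq (G w) (cyclicGauge ζ)).re : ℂ)) =ᶠ[𝓝 z]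
      wirtingerZ fun w => gramNormSq (G w) (cyclicGauge ζ) :=
    hev.eventuallyEq_nhds.mono fun w hw => wirtingerZ_congr hw
  rw [wirtingerZBar_congr hev2, wirtingerZBar_wirtingerZ_gramNormSq (h.mono fun w hw => hw.smooth)
    (h.mono fun w hw => hw.posDef) hz.hitchin (mul_star_eq_one hζ)
    (cyclicMatrix_mul_cyclicGauge hζ _ _), Complex.add_re] at h1
  linarith

/-- Both terms of the Bochner formula are nonnegative, so |γ|² is subharmonic and the strong maximum
principle applies with C = 0. -/
lemma eventually_gramNormSq_eq (h : ∀ᶠ w in 𝓝 z, CyclicHitchinAt G p q w)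
    (hζ : ζ ^ 2 + ζ + 1 = 0) (hmax : ∀ᶠ w in 𝓝 z, (gramNormSq (G w) (cyclicGauge ζ)).re ≤
      (gramNormSq (G z) (cyclicGauge ζ)).re) :
    ∀ᶠ w in 𝓝 z, (gramNormSq (G w) (cyclicGauge ζ)).re = (gramNormSq (G z) (cyclicGauge ζ)).re := by
  set u := fun w => (gramNormSq (G w) (cyclicGauge ζ)).re with hu
  have hconst : ∀ w, ContDiffAt ℝ 2 (fun _ : ℂ => -u z) w := fun w => contDiffAt_const
  have hlap0 : ∀ w, planeLaplacian (fun _ : ℂ => -u z) w = 0 := fun w => by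
    simp [planeLaplacian, secondDeriv]
  have key := eventually_eq_zero_of_planeLaplacian_ge (z₀ := z)
    (f := fun w => u w + -u z) (C := 0) le_rfl
    (h.mono fun w hw => (hw.contDiffAt_gramNormSq _).add (hconst w))
    (hmax.mono fun w hw => by linarith) (by simp) ?_
  · exact key.mono fun w hw => by linarith
  · filter_upwards [h.eventually_nhds] with w hw
    rw [planeLaplacian_add (hw.self_of_nhds.contDiffAt_gramNormSq _) (hconst w), hlap0, add_zero,
      zero_mul, planeLaplacian_gramNormSq hw hζ]
    have hp := hw.self_of_nhds.posDef
    have a := (gramNormSq_nonneg_and_eq_zero hp (chernForm G w * cyclicGauge ζ -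
      cyclicGauge ζ * chernForm G w)).1
    have b := (gramNormSq_nonneg_and_eq_zero hp (gramAdjoint (G w) (cyclicMatrix (p w) (q w)) *
      cyclicGauge ζ - star ζ • (cyclicGauge ζ * gramAdjoint (G w) (cyclicMatrix (p w) (q w))))).1
    linarith

/-- Where the norm of the cyclic gauge transformation is constant, its adjoint is holomorphic and
intertwines the Higgs field with a multiple of it. -/
lemma holomorphic_gramAdjoint_of_const (h : ∀ᶠ w in 𝓝 z, CyclicHitchinAt G p q w)
    (hζ : ζ ^ 2 + ζ + 1 = 0) {M : ℝ}
    (hM : ∀ᶠ w in 𝓝 z, (gramNormSq (G w) (cyclicGauge ζ)).re = M) :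
    (∀ i j, DifferentiableAt ℂ (fun w => gramAdjoint (G w) (cyclicGauge ζ) i j) z) ∧
      gramAdjoint (G z) (cyclicGauge ζ) * cyclicMatrix (p z) (q z) =
        ζ • (cyclicMatrix (p z) (q z) * gramAdjoint (G z) (cyclicGauge ζ)) := by
  have hz := h.self_of_nhds
  have hlap : planeLaplacian (fun w => (gramNormSq (G w) (cyclicGauge ζ)).re) z = 0 := by
    refine (planeLaplacian_congr (g := fun _ => M) hM).trans ?_
    simp [planeLaplacian, secondDeriv]
  rw [planeLaplacian_gramNormSq h hζ] at hlap
  obtain ⟨a, a'⟩ := gramNormSq_nonneg_and_eq_zero hz.posDef (chernForm G z * cyclicGauge ζ -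
    cyclicGauge ζ * chernForm G z)
  obtain ⟨b, b'⟩ := gramNormSq_nonneg_and_eq_zero hz.posDef
    (gramAdjoint (G z) (cyclicMatrix (p z) (q z)) * cyclicGauge ζ -
      star ζ • (cyclicGauge ζ * gramAdjoint (G z) (cyclicMatrix (p z) (q z))))
  have hY := a' (by linarith)
  have hZ := b' (by linarith)
  constructor
  · intro i j
    refine differentiableAt_of_wirtingerZBar_eq_zero
      ((hz.smooth.gramAdjoint hz.posDef _).diff i j) ?_
    have e := matrixDZBar_gramAdjoint hz.smooth (h.mono fun w hw => hw.posDef) (cyclicGauge ζ)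
    rw [hY] at e
    have e' := congrFun (congrFun e i) j
    simpa [gramAdjoint, matrixDZBar] using e'
  · have hu := hz.posDef.isUnit_det
    have e := congrArg (gramAdjoint (G z)) (sub_eq_zero.1 hZ)
    rwa [gramAdjoint_smul, star_star, gramAdjoint_mul hu, gramAdjoint_mul hu,
      gramAdjoint_gramAdjoint hu hz.posDef.isHermitian] at e

end LocalBochner

/-! ### Global argument on the compact surface. -/

section GlobalArgument

open scoped ComplexOrder

/-- The level set through x₀ is closed by continuity and open by hypothesis. -/
lemma eq_of_locally_eq_max {X : Type*} [TopologicalSpace X] [PreconnectedSpace X] {f : X → ℝ}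
    (hf : Continuous f) {x₀ : X} (h : ∀ y, f y = f x₀ → ∀ᶠ x in 𝓝 y, f x = f x₀) (x : X) :
    f x = f x₀ := by
  have hcl : IsClopen {x | f x = f x₀} :=
    ⟨isClosed_eq hf continuous_const, isOpen_iff_eventually.2 h⟩
  have := hcl.eq_univ ⟨x₀, rfl⟩
  exact (Set.eq_univ_iff_forall.1 this) x

variable {X : Type*} [TopologicalSpace X] [ChartedSpace ℂ X]

lemma eventually_chart_iff {x₀ : X} {P : X → Prop} :
    (∀ᶠ z in 𝓝 (chartAt ℂ x₀ x₀), P ((chartAt ℂ x₀).symm z)) ↔ ∀ᶠ x in 𝓝 x₀, P x := by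
  have hx := mem_chart_source ℂ x₀
  constructor
  · intro h
    have h1 := ((chartAt ℂ x₀).continuousAt hx).eventually h
    filter_upwards [h1, (chartAt ℂ x₀).open_source.mem_nhds hx] with x h2 h3
    rwa [(chartAt ℂ x₀).left_inv h3] at h2
  · intro h
    have h1 := (chartAt ℂ x₀).continuousAt_symm ((chartAt ℂ x₀).map_source hx)
    rw [ContinuousAt, (chartAt ℂ x₀).left_inv hx] at h1
    exact h1.eventually h

lemma continuousAt_of_chart {Y : Type*} [TopologicalSpace Y] {x₀ : X} {f : X → Y} {F : ℂ → Y}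
    (hF : ContinuousAt F (chartAt ℂ x₀ x₀))
    (h : ∀ᶠ z in 𝓝 (chartAt ℂ x₀ x₀), f ((chartAt ℂ x₀).symm z) = F z) : ContinuousAt f x₀ := by
  have hx := mem_chart_source ℂ x₀
  have h1 : ContinuousAt (fun x => F (chartAt ℂ x₀ x)) x₀ :=
    ContinuousAt.comp (f := chartAt ℂ x₀) hF ((chartAt ℂ x₀).continuousAt hx)
  refine h1.congr ?_
  filter_upwards [((chartAt ℂ x₀).continuousAt hx).eventually h,
    (chartAt ℂ x₀).open_source.mem_nhds hx] with x h2 h3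
  rw [← h2, (chartAt ℂ x₀).left_inv h3]

lemma eq_of_holomorphic [IsManifold 𝓘(ℂ) ω X] [CompactSpace X] [PreconnectedSpace X] {f : X → ℂ}
    (h : ∀ x₀, ∃ F : ℂ → ℂ, DifferentiableAt ℂ F (chartAt ℂ x₀ x₀) ∧
      ∀ᶠ z in 𝓝 (chartAt ℂ x₀ x₀), f ((chartAt ℂ x₀).symm z) = F z) (x y : X) : f x = f y := by
  have : IsManifold 𝓘(ℂ) 1 X := .of_le (n := ω) le_top
  have hf : MDifferentiable 𝓘(ℂ) 𝓘(ℂ) f := fun x₀ => by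
    obtain ⟨F, hF, he⟩ := h x₀
    have hx := mem_chart_source ℂ x₀
    have h1 : MDifferentiableAt 𝓘(ℂ) 𝓘(ℂ) (fun x => F (chartAt ℂ x₀ x)) x₀ :=
      MDifferentiableAt.comp x₀ hF.mdifferentiableAt
        (mdifferentiableAt_atlas (I := 𝓘(ℂ)) (chart_mem_atlas ℂ x₀) hx)
    refine h1.congr_of_eventuallyEq ?_
    filter_upwards [((chartAt ℂ x₀).continuousAt hx).eventually he,
      (chartAt ℂ x₀).open_source.mem_nhds hx] with x h2 h3
    rw [← h2, (chartAt ℂ x₀).left_inv h3]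
  obtain ⟨c, hc⟩ := hf.exists_eq_const_of_compactSpace
  rw [hc]; rfl

/-- Pointwise data `Gh`, `ph`, `qh` (Gram matrix and coefficients of the Higgs field in arbitrary
frames of the fibers) and holomorphic one-forms `forms` that have holomorphic readings
near every point, related to them by changes of frame. -/
def HasCyclicReadings (Gh : X → Matrix (Fin 3) (Fin 3) ℂ) (ph qh : X → ℂ) (forms : Set (X → ℂ)) :
    Prop :=
  ∀ x₀ : X, ∃ (G : ℂ → Matrix (Fin 3) (Fin 3) ℂ) (p q l m : ℂ → ℂ),
    ∀ᶠ z in 𝓝 (chartAt ℂ x₀ x₀), CyclicHitchinAt G p q z ∧ l z ≠ 0 ∧ m z ≠ 0 ∧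
      G z = scaleGram (l z) (Gh ((chartAt ℂ x₀).symm z)) ∧
      p z = m z * (l z)⁻¹ * ph ((chartAt ℂ x₀).symm z) ∧
      q z = m z * (l z) ^ 2 * qh ((chartAt ℂ x₀).symm z) ∧
      ∀ w ∈ forms, DifferentiableAt ℂ (fun z => m z * w ((chartAt ℂ x₀).symm z)) z

variable {Gh : X → Matrix (Fin 3) (Fin 3) ℂ} {ph qh : X → ℂ} {forms : Set (X → ℂ)} {ζ : ℂ}

/-- Identity theorem: the points where a one-form has zero germ form a clopen set, which is empty as
soon as the form is nonzero somewhere. -/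
lemma HasCyclicReadings.frequently_ne [PreconnectedSpace X]
    (h : HasCyclicReadings Gh ph qh forms) {w : X → ℂ} (hw : w ∈ forms) {y : X} (hy : w y ≠ 0)
    (x : X) : ∃ᶠ x' in 𝓝 x, w x' ≠ 0 := by
  have hcl : IsClopen {x | ∀ᶠ x' in 𝓝 x, w x' = 0} := by
    refine ⟨?_, isOpen_iff_eventually.2 fun x hx => hx.eventually_nhds⟩
    refine isClosed_iff_frequently.2 fun x hx => ?_
    obtain ⟨G, p, q, l, m, hr⟩ := h x
    set φ := chartAt ℂ x
    have han : AnalyticAt ℂ (fun z => m z * w (φ.symm z)) (φ x) :=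
      Complex.analyticAt_iff_eventually_differentiableAt.2 (hr.mono fun z hz => hz.2.2.2.2.2.2 w hw)
    have hm := hr.mono fun z hz => hz.2.2.1
    rcases han.eventually_eq_zero_or_eventually_ne_zero with h0 | h0
    · refine eventually_chart_iff.1 ?_
      filter_upwards [h0, hm] with z hz hmz
      exact (mul_eq_zero.1 hz).resolve_left hmz
    -- In the other case the zeros are isolated, whereas a limit of points with zero germ has zeros
    -- filling open sets arbitrarily near it.
    · exfalso
      have h1 : ∃ᶠ z in 𝓝 (φ x), ∀ᶠ z' in 𝓝 z, m z' * w (φ.symm z') = 0 := by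
        have hx' : ∃ᶠ z in 𝓝 (φ x), ∀ᶠ x' in 𝓝 (φ.symm z), w x' = 0 := by
          intro hcon
          exact hx (eventually_chart_iff.1 hcon)
        refine (hx'.and_eventually (φ.open_target.mem_nhds
          (φ.map_source (mem_chart_source ℂ x)))).mono fun z hz => ?_
        exact ((φ.continuousAt_symm hz.2).eventually hz.1).mono fun z' hz' => by
          rw [hz', mul_zero]
      rw [eventually_nhdsWithin_iff] at h0
      obtain ⟨z, hz1, hz2⟩ := (h1.and_eventually h0.eventually_nhds).exists
      have h3 : ∀ᶠ z' in 𝓝 z, z' = φ x := by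
        filter_upwards [hz1, hz2] with z' h4 h5
        by_contra hne
        exact h5 hne h4
      have h4 : {φ x}ᶜ ∈ 𝓝[≠] z := by
        rcases eq_or_ne z (φ x) with rfl | hne
        · exact self_mem_nhdsWithin
        · exact mem_nhdsWithin_of_mem_nhds (isOpen_ne.mem_nhds hne)
      obtain ⟨z', h5, h6⟩ := ((h3.filter_mono nhdsWithin_le_nhds).and h4).exists
      exact h6 h5
  by_contra hcon
  have hx : ∀ᶠ x' in 𝓝 x, w x' = 0 :=
    (Filter.not_frequently.1 hcon).mono fun _ => not_not.1
  have := hcl.eq_univ ⟨x, hx⟩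
  exact hy ((Set.eq_univ_iff_forall.1 this y).self_of_nhds)

/-- A continuous function on compact X attains its maximum, and the local strong maximum principle
propagates the maximal value to all of X. -/
lemma HasCyclicReadings.gramNormSq_const [CompactSpace X] [ConnectedSpace X]
    (h : HasCyclicReadings Gh ph qh forms) (hζ : ζ ^ 2 + ζ + 1 = 0) :
    ∃ M, ∀ x, (gramNormSq (Gh x) (cyclicGauge ζ)).re = M := by
  set u : X → ℝ := fun x => (gramNormSq (Gh x) (cyclicGauge ζ)).re with hu
  have hcont : Continuous u := continuous_iff_continuousAt.2 fun x => by
    obtain ⟨G, p, q, l, m, hr⟩ := h x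
    refine continuousAt_of_chart
      (hr.self_of_nhds.1.contDiffAt_gramNormSq (cyclicGauge ζ)).continuousAt ?_
    filter_upwards [hr] with z hz
    rw [hz.2.2.2.1, gramNormSq_scaleGram hz.2.1]
  obtain ⟨x₀, -, hmax⟩ := isCompact_univ.exists_isMaxOn Set.univ_nonempty hcont.continuousOn
  refine ⟨u x₀, eq_of_locally_eq_max hcont fun y hy => ?_⟩
  obtain ⟨G, p, q, l, m, hr⟩ := h y
  have hloc : ∀ᶠ z in 𝓝 (chartAt ℂ y y), (gramNormSq (G z) (cyclicGauge ζ)).re =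
      u ((chartAt ℂ y).symm z) := hr.mono fun z hz => by
    rw [hz.2.2.2.1, gramNormSq_scaleGram hz.2.1]
  have hy' : (gramNormSq (G (chartAt ℂ y y)) (cyclicGauge ζ)).re = u x₀ := by
    rw [hloc.self_of_nhds, (chartAt ℂ y).left_inv (mem_chart_source ℂ y), hy]
  refine eventually_chart_iff.1 ?_
  have key := eventually_gramNormSq_eq (hr.mono fun z hz => hz.1) hζ (hloc.mono fun z hz => by
    rw [hz, hy']; exact hmax (Set.mem_univ _))
  filter_upwards [key, hloc] with z h1 h2
  rw [← h2, h1, hy']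

lemma HasCyclicReadings.qh_ne (h : HasCyclicReadings Gh ph qh forms) (x : X) : qh x ≠ 0 := by
  obtain ⟨G, p, q, l, m, hr⟩ := h x
  obtain ⟨h1, -, -, -, -, h2, -⟩ := hr.self_of_nhds
  have h3 := h1.q_ne
  rw [h2, (chartAt ℂ x).left_inv (mem_chart_source ℂ x)] at h3
  exact right_ne_zero_of_mul h3

/-- A homogeneous holomorphic function `E` of the adjoint of the gauge transformation that
represents a section of the dual of the canonical bundle vanishes. -/
lemma HasCyclicReadings.eq_zero_of_dual_canonical [IsManifold 𝓘(ℂ) ω X] [CompactSpace X]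
    [ConnectedSpace X] (h : HasCyclicReadings Gh ph qh forms)
    (hforms : ∀ x, ∃ w ∈ forms, w x = 0 ∧ ∃ y, w y ≠ 0) (hζ : ζ ^ 2 + ζ + 1 = 0)
    {E : Matrix (Fin 3) (Fin 3) ℂ → ℂ}
    (hE : ∀ l ≠ 0, ∀ G, E (gramAdjoint (scaleGram l G) (cyclicGauge ζ)) =
      l ^ 2 * E (gramAdjoint G (cyclicGauge ζ)))
    (hE' : ∀ (V : ℂ → Matrix (Fin 3) (Fin 3) ℂ) z,
      (∀ i j, DifferentiableAt ℂ (fun w => V w i j) z) → DifferentiableAt ℂ (fun w => E (V w)) z)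
    (x : X) : E (gramAdjoint (Gh x) (cyclicGauge ζ)) = 0 := by
  obtain ⟨M, hM⟩ := h.gramNormSq_const hζ
  have hread : ∀ x, ∃ (N q l m : ℂ → ℂ), ∀ᶠ z in 𝓝 (chartAt ℂ x x), DifferentiableAt ℂ N z ∧
      DifferentiableAt ℂ q z ∧ q z ≠ 0 ∧ l z ≠ 0 ∧ m z ≠ 0 ∧
      N z = l z ^ 2 * E (gramAdjoint (Gh ((chartAt ℂ x).symm z)) (cyclicGauge ζ)) ∧
      q z = m z * (l z) ^ 2 * qh ((chartAt ℂ x).symm z) ∧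
      ∀ w ∈ forms, DifferentiableAt ℂ (fun z => m z * w ((chartAt ℂ x).symm z)) z := fun x => by
    obtain ⟨G, p, q, l, m, hr⟩ := h x
    refine ⟨fun z => E (gramAdjoint (G z) (cyclicGauge ζ)), q, l, m, ?_⟩
    filter_upwards [hr.eventually_nhds] with z hz
    obtain ⟨h1, h2, h3, h4, h5, h6, h7⟩ := hz.self_of_nhds
    have hM' : ∀ᶠ w in 𝓝 z, (gramNormSq (G w) (cyclicGauge ζ)).re = M := by
      filter_upwards [hz] with w hw
      rw [hw.2.2.2.1, gramNormSq_scaleGram hw.2.1, hM]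
    refine ⟨hE' _ _ (holomorphic_gramAdjoint_of_const (hz.mono fun w hw => hw.1) hζ hM').1,
      h1.q_diff, h1.q_ne, h2, h3, ?_, h6, h7⟩
    rw [h4, hE _ h2]
  obtain ⟨w, hw, hw0, y, hy⟩ := hforms x
  -- In a reading w, E and qh become m w, l² E and m l² qh, so w E / qh is independent of the frame.
  -- It is a global holomorphic function, hence constant, and w vanishes at x.
  have hconst : ∀ x', w x' * E (gramAdjoint (Gh x') (cyclicGauge ζ)) / qh x' = 0 := fun x' => by
    rw [eq_of_holomorphic (f := fun x' => w x' * E (gramAdjoint (Gh x') (cyclicGauge ζ)) / qh x')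
      (fun x => ?_) x' x, hw0, zero_mul, zero_div]
    obtain ⟨N, q, l, m, hr⟩ := hread x
    refine ⟨fun z => (m z * w ((chartAt ℂ x).symm z)) * N z / q z, ?_, ?_⟩
    · obtain ⟨h1, h2, h3, -, -, -, -, h8⟩ := hr.self_of_nhds
      exact ((h8 w hw).mul h1).div h2 h3
    · filter_upwards [hr] with z hz
      obtain ⟨h1, h2, h3, h4, h5, h6, h7, h8⟩ := hz
      have := h.qh_ne ((chartAt ℂ x).symm z)
      rw [h6, h7]
      field_simp
  have hfreq := h.frequently_ne hw hy x
  obtain ⟨N, q, l, m, hr⟩ := hread x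
  -- E vanishes wherever w does not, and such points accumulate at x; continuity then gives the
  -- value at x itself.
  have hfr : ∃ᶠ z in 𝓝 (chartAt ℂ x x), N z = 0 := by
    have h1 : ∃ᶠ z in 𝓝 (chartAt ℂ x x), w ((chartAt ℂ x).symm z) ≠ 0 := fun hcon =>
      hfreq (eventually_chart_iff.1 hcon)
    refine (h1.and_eventually hr).mono fun z hz => ?_
    obtain ⟨hz1, -, -, -, h4, h5, h6, h7, -⟩ := hz
    have h9 := hconst ((chartAt ℂ x).symm z)
    have h10 := h.qh_ne ((chartAt ℂ x).symm z)
    rw [h6, (mul_eq_zero.1 ((div_eq_zero_iff.1 h9).resolve_right h10)).resolve_left hz1, mul_zero]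
  obtain ⟨h1, -, -, h4, -, h6, -, -⟩ := hr.self_of_nhds
  have hN : N (chartAt ℂ x x) = 0 := by
    by_contra hne
    exact hfr ((h1.continuousAt.eventually_ne hne).mono fun z hz => hz)
  rw [h6, (chartAt ℂ x).left_inv (mem_chart_source ℂ x)] at hN
  exact (mul_eq_zero.1 hN).resolve_left (pow_ne_zero _ h4)

/-- The harmonic metric is diagonal. -/
theorem HasCyclicReadings.offDiag_eq_zero [IsManifold 𝓘(ℂ) ω X] [CompactSpace X]
    [ConnectedSpace X] (h : HasCyclicReadings Gh ph qh forms)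
    (hforms : ∀ x, ∃ w ∈ forms, w x = 0 ∧ ∃ y, w y ≠ 0) (hpos : ∀ x, (Gh x).PosDef) (x : X) :
    ∀ i j, i ≠ j → Gh x i j = 0 := by
  obtain ⟨ζ, hζ⟩ := exists_cube_root
  have hζ0 : ζ ≠ 0 := fun h => by rw [h] at hζ; norm_num at hζ
  have key := @gramAdjoint_scaleGram_apply ζ
  -- The entry (2, 0) carries the weight l² of K⁻¹. The entries (1, 0) and (2, 1) carry only l, as
  -- sections of L⁻¹, and are therefore squared.
  have h20 := h.eq_zero_of_dual_canonical hforms hζ (E := fun W => W 2 0)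
    (fun l hl G => by rw [key hl]; simp; ring) (fun V z hV => hV 2 0) x
  have h10 := h.eq_zero_of_dual_canonical hforms hζ (E := fun W => W 1 0 ^ 2)
    (fun l hl G => by rw [key hl]; simp; ring) (fun V z hV => (hV 1 0).pow 2) x
  have h21 := h.eq_zero_of_dual_canonical hforms hζ (E := fun W => W 2 1 ^ 2)
    (fun l hl G => by rw [key hl]; simp; ring) (fun V z hV => (hV 2 1).pow 2) x
  have h10 : gramAdjoint (Gh x) (cyclicGauge ζ) 1 0 = 0 := by simpa using h10
  have h21 : gramAdjoint (Gh x) (cyclicGauge ζ) 2 1 = 0 := by simpa using h21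
  obtain ⟨M, hM⟩ := h.gramNormSq_const hζ
  obtain ⟨G, p, q, l, m, hr⟩ := h x
  have hM' : ∀ᶠ w in 𝓝 (chartAt ℂ x x), (gramNormSq (G w) (cyclicGauge ζ)).re = M := by
    filter_upwards [hr] with w hw
    rw [hw.2.2.2.1, gramNormSq_scaleGram hw.2.1, hM]
  have hcomm := (holomorphic_gramAdjoint_of_const (hr.mono fun w hw => hw.1) hζ hM').2
  obtain ⟨h1, h2, -, h4, -⟩ := hr.self_of_nhds
  rw [(chartAt ℂ x).left_inv (mem_chart_source ℂ x)] at h4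
  have hoff := offDiag_eq_zero_of_commute h1.q_ne hζ0 hcomm
    (by rw [h4, key h2, h10]; simp) (by rw [h4, key h2, h20]; simp) (by rw [h4, key h2, h21]; simp)
  refine offDiag_gram_eq_zero (hpos x) hζ fun i j hij => ?_
  have h5 := hoff i j hij
  rw [h4, key h2] at h5
  have h7 : ∀ i, (![l (chartAt ℂ x x), 1, (l (chartAt ℂ x x))⁻¹] : Fin 3 → ℂ) i ≠ 0 := fun i => by
    fin_cases i <;> simp [h2]
  rcases mul_eq_zero.1 h5 with h8 | h8
  · refine (mul_eq_zero.1 h8).resolve_left ?_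
    fin_cases i <;> simp [h2]
  · exact absurd h8 (h7 j)

/-- A ratio that satisfies the strong maximum principle above `1` is less than `1`. -/
lemma HasCyclicReadings.ratio_lt_one [IsManifold 𝓘(ℂ) ω X] [CompactSpace X]
    [ConnectedSpace X] (h : HasCyclicReadings Gh ph qh forms)
    (hforms : ∀ x, ∃ w ∈ forms, w x = 0 ∧ ∃ y, w y ≠ 0) (hpos : ∀ x, (Gh x).PosDef)
    {ρ : Matrix (Fin 3) (Fin 3) ℂ → ℂ → ℂ → ℝ} (hρ0 : ∀ G q, ρ G 0 q = 0)
    (hscale : ∀ l ≠ 0, ∀ m ≠ 0, ∀ G p q,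
      ρ (scaleGram l G) (m * l⁻¹ * p) (m * l ^ 2 * q) = ρ G p q)
    (hcont : ∀ (G : ℂ → Matrix (Fin 3) (Fin 3) ℂ) p q z, CyclicHitchinAt G p q z →
      ContinuousAt (fun w => ρ (G w) (p w) (q w)) z)
    (hmp : ∀ (G : ℂ → Matrix (Fin 3) (Fin 3) ℂ) (p q : ℂ → ℂ) (z : ℂ),
      (∀ᶠ w in 𝓝 z, CyclicHitchinAt G p q w) → (∀ᶠ w in 𝓝 z, ∀ i j, i ≠ j → G w i j = 0) →
      1 ≤ ρ (G z) (p z) (q z) → (∀ᶠ w in 𝓝 z, ρ (G w) (p w) (q w) ≤ ρ (G z) (p z) (q z)) →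
      ∀ᶠ w in 𝓝 z, ρ (G w) (p w) (q w) = ρ (G z) (p z) (q z)) (x : X) :
    ρ (Gh x) (ph x) (qh x) < 1 := by
  set u : X → ℝ := fun x => ρ (Gh x) (ph x) (qh x) with hu
  have hucont : Continuous u := continuous_iff_continuousAt.2 fun x => by
    obtain ⟨G, p, q, l, m, hr⟩ := h x
    refine continuousAt_of_chart (hcont G p q _ hr.self_of_nhds.1) ?_
    filter_upwards [hr] with z hz
    obtain ⟨-, h2, h3, h4, h5, h6, -⟩ := hz
    rw [h4, h5, h6, hscale _ h2 _ h3]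
  obtain ⟨x₀, -, hmax⟩ := isCompact_univ.exists_isMaxOn Set.univ_nonempty hucont.continuousOn
  refine lt_of_le_of_lt (hmax (Set.mem_univ x)) ?_
  by_contra! hge
  -- A maximum at least 1 spreads over X, since every point with the maximal value satisfies the
  -- hypotheses of the local principle.
  have huconst := eq_of_locally_eq_max hucont (x₀ := x₀) fun y hy => by
    obtain ⟨G, p, q, l, m, hr⟩ := h y
    have hloc : ∀ᶠ z in 𝓝 (chartAt ℂ y y), ρ (G z) (p z) (q z) = u ((chartAt ℂ y).symm z) :=
      hr.mono fun z hz => by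
        obtain ⟨-, h2, h3, h4, h5, h6, -⟩ := hz
        rw [h4, h5, h6, hscale _ h2 _ h3]
    have hy' : ρ (G (chartAt ℂ y y)) (p (chartAt ℂ y y)) (q (chartAt ℂ y y)) = u x₀ := by
      rw [hloc.self_of_nhds, (chartAt ℂ y).left_inv (mem_chart_source ℂ y), hy]
    refine eventually_chart_iff.1 ?_
    have key := hmp G p q (chartAt ℂ y y) (hr.mono fun z hz => hz.1)
      (hr.mono fun z hz i j hij => by
        rw [hz.2.2.2.1, scaleGram_apply, h.offDiag_eq_zero hforms hpos _ i j hij]; simp)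
      (by rw [hy']; exact hge)
      (hloc.mono fun z hz => by rw [hz, hy']; exact hmax (Set.mem_univ _))
    filter_upwards [key, hloc] with z h1 h2
    rw [← h2, h1, hy']
  -- At a zero of t the ratio would be 0, whereas it is now everywhere at least 1.
  have hph : ∀ x, ph x ≠ 0 := fun x h0 => by
    have h1 := huconst x
    rw [hu] at h1
    simp only [h0, hρ0] at h1
    have h2 : (1 : ℝ) ≤ 0 := by rw [h1]; exact hge
    norm_num at h2
  obtain ⟨w, hw, hw0, y, hy⟩ := hforms x₀
  -- Both w³ and ph² qh acquire the factor m³, the powers of l cancelling, so the quotient is a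
  -- global holomorphic function.
  have hconst := eq_of_holomorphic (f := fun x => w x ^ 3 / (ph x ^ 2 * qh x)) (fun x => by
    obtain ⟨G, p, q, l, m, hr⟩ := h x
    have hp : ∀ᶠ z in 𝓝 (chartAt ℂ x x), p z ≠ 0 := hr.mono fun z hz => by
      obtain ⟨-, h2, h3, -, h5, -, -⟩ := hz
      rw [h5]
      exact mul_ne_zero (mul_ne_zero h3 (inv_ne_zero h2)) (hph _)
    refine ⟨fun z => (m z * w ((chartAt ℂ x).symm z)) ^ 3 / (p z ^ 2 * q z), ?_, ?_⟩
    · obtain ⟨h1, -, -, -, -, -, h7⟩ := hr.self_of_nhds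
      exact ((h7 w hw).pow 3).div ((h1.p_diff.pow 2).mul h1.q_diff)
        (mul_ne_zero (pow_ne_zero _ hp.self_of_nhds) h1.q_ne)
    · filter_upwards [hr] with z hz
      obtain ⟨-, h2, h3, -, h5, h6, -⟩ := hz
      have := h.qh_ne ((chartAt ℂ x).symm z)
      have := hph ((chartAt ℂ x).symm z)
      rw [h5, h6]
      field_simp) y x₀
  have h1 : w y ^ 3 / (ph y ^ 2 * qh y) = 0 := by
    rw [hconst, hw0]; simp
  rcases div_eq_zero_iff.1 h1 with h2 | h2
  · exact hy (by simpa using h2)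
  · exact mul_ne_zero (pow_ne_zero _ (hph y)) (h.qh_ne y) h2

theorem HasCyclicReadings.ratioUpper_lt_one [IsManifold 𝓘(ℂ) ω X] [CompactSpace X]
    [ConnectedSpace X] (h : HasCyclicReadings Gh ph qh forms)
    (hforms : ∀ x, ∃ w ∈ forms, w x = 0 ∧ ∃ y, w y ≠ 0) (hpos : ∀ x, (Gh x).PosDef) (x : X) :
    ratioUpper (Gh x) (ph x) (qh x) < 1 :=
  h.ratio_lt_one hforms hpos (fun _ _ => by simp [ratioUpper])
    (fun _ hl _ hm G p q => ratioUpper_scale hl hm G p q)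
    (fun _ _ _ _ h => h.continuousAt_ratioUpper) (fun _ _ _ _ => eventually_ratioUpper_eq) x

theorem HasCyclicReadings.ratioLower_lt_one [IsManifold 𝓘(ℂ) ω X] [CompactSpace X]
    [ConnectedSpace X] (h : HasCyclicReadings Gh ph qh forms)
    (hforms : ∀ x, ∃ w ∈ forms, w x = 0 ∧ ∃ y, w y ≠ 0) (hpos : ∀ x, (Gh x).PosDef) (x : X) :
    ratioLower (Gh x) (ph x) (qh x) < 1 :=
  h.ratio_lt_one hforms hpos (fun _ _ => by simp [ratioLower])
    (fun _ hl _ hm G p q => ratioLower_scale hl hm G p q)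
    (fun _ _ _ _ h => h.continuousAt_ratioLower) (fun _ _ _ _ => eventually_ratioLower_eq) x

end GlobalArgument

/-! ### The underlying real smooth structure. -/

section RealStructure

lemma isManifold_real {X : Type*} [TopologicalSpace X] [ChartedSpace ℂ X] [IsManifold 𝓘(ℂ) ω X] :
    IsManifold 𝓘(ℝ, ℂ) ∞ X := by
  refine isManifold_of_contDiffOn _ _ _ fun e e' he he' => ?_
  have h := (contDiffGroupoid ω 𝓘(ℂ)).compatible he he'
  rw [contDiffGroupoid, mem_groupoid_of_pregroupoid] at h
  have h1 := h.1
  simp only [contDiffPregroupoid] at h1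
  exact (h1.restrict_scalars ℝ).of_le (by simp)

lemma contDiffAt_of_contMDiffOn_real {X : Type*} [TopologicalSpace X] [ChartedSpace ℂ X]
    [IsManifold 𝓘(ℂ) ω X] {f : X → ℂ} {U : Set X} (hU : IsOpen U)
    (hf : ContMDiffOn 𝓘(ℝ, ℂ) 𝓘(ℝ, ℂ) ∞ f U) (x₀ : X) {z : ℂ} (hz : z ∈ (chartAt ℂ x₀).target)
    (hzU : (chartAt ℂ x₀).symm z ∈ U) : ContDiffAt ℝ ∞ (fun w => f ((chartAt ℂ x₀).symm w)) z := by
  have := isManifold_real (X := X)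
  have h1 : ContMDiffAt 𝓘(ℝ, ℂ) 𝓘(ℝ, ℂ) ∞ (chartAt ℂ x₀).symm z :=
    (contMDiffOn_chart_symm (I := 𝓘(ℝ, ℂ)) (n := ∞) (x := x₀)).contMDiffAt
      ((chartAt ℂ x₀).open_target.mem_nhds hz)
  exact ((hf.contMDiffAt (hU.mem_nhds hzU)).comp z h1).contDiffAt

end RealStructure

/-! ### The coordinate vector field of a chart. -/

section CoordVector

variable {X : Type*} [TopologicalSpace X] [ChartedSpace ℂ X] [IsManifold 𝓘(ℂ) ω X]

/-- The field is the image of the constant field 1 under the tangent map of the inverse chart. -/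
lemma contMDiffAt_coordVector (x₀ : X) {z : ℂ} (hz : z ∈ (chartAt ℂ x₀).target) :
    ContMDiffAt 𝓘(ℂ) (𝓘(ℂ).prod 𝓘(ℂ)) ω
      (fun w => Bundle.TotalSpace.mk' ℂ ((chartAt ℂ x₀).symm w) (coordVector (chartAt ℂ x₀) w)) z := by
  have : IsManifold 𝓘(ℂ) 1 X := .of_le (n := ω) le_top
  set φ := chartAt ℂ x₀
  have h1 : ContMDiffOn 𝓘(ℂ) 𝓘(ℂ) ω φ.symm φ.target := contMDiffOn_chart_symm
  have h2 := h1.contMDiffOn_tangentMapWithin (m := ω) le_top φ.open_target.uniqueMDiffOn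
  have h3 : ContMDiffOn 𝓘(ℂ) (𝓘(ℂ).prod 𝓘(ℂ)) ω
      (fun w : ℂ => (⟨w, (1 : ℂ)⟩ : TangentBundle 𝓘(ℂ) ℂ)) φ.target :=
    contMDiffOn_vectorSpace_iff_contDiffOn.2 contDiffOn_const
  have h4 := h2.comp h3 (fun w hw => hw)
  refine (h4.congr fun w hw => ?_).contMDiffAt (φ.open_target.mem_nhds hz)
  simp only [Function.comp, tangentMapWithin]
  rw [mfderivWithin_of_isOpen φ.open_target hw]
  rfl

lemma coordVector_ne_zero (x₀ : X) {z : ℂ} (hz : z ∈ (chartAt ℂ x₀).target) :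
    coordVector (chartAt ℂ x₀) z ≠ 0 := by
  have : IsManifold 𝓘(ℂ) 1 X := .of_le (n := ω) le_top
  set φ := chartAt ℂ x₀
  intro h0
  have h1 : MDifferentiableAt 𝓘(ℂ) 𝓘(ℂ) φ.symm z :=
    mdifferentiableAt_atlas_symm (chart_mem_atlas ℂ x₀) hz
  have h2 : MDifferentiableAt 𝓘(ℂ) 𝓘(ℂ) φ (φ.symm z) :=
    mdifferentiableAt_atlas (chart_mem_atlas ℂ x₀) (φ.map_target hz)
  have h3 := mfderiv_comp z h2 h1
  have h4 : (φ ∘ φ.symm) =ᶠ[𝓝 z] id := by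
    filter_upwards [φ.open_target.mem_nhds hz] with w hw
    exact φ.right_inv hw
  rw [h4.mfderiv_eq, mfderiv_id] at h3
  have h5 : (1 : ℂ) = mfderiv 𝓘(ℂ) 𝓘(ℂ) φ (φ.symm z) (coordVector φ z) :=
    congrArg (fun L : ℂ →L[ℂ] ℂ => L 1) h3
  rw [h0, map_zero] at h5
  exact (one_ne_zero : (1 : ℂ) ≠ 0) h5

end CoordVector

/-! ### Adapted frames of L ⊕ 𝒪 ⊕ L⁻¹ and holomorphy of coefficients. -/

section Frames

variable {X : Type*} [TopologicalSpace X] [ChartedSpace ℂ X]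
  {L : X → Type*} [TopologicalSpace (Bundle.TotalSpace ℂ L)] [∀ x, AddCommGroup (L x)]
  [∀ x, Module ℂ (L x)] [∀ x, TopologicalSpace (L x)] [∀ x, IsTopologicalAddGroup (L x)]
  [∀ x, ContinuousSMul ℂ (L x)] [FiberBundle ℂ L] [VectorBundle ℂ ℂ L]

/-- The vector of `L x` of coordinate `1` in the trivialization at `x₀`. -/
def lineFrame (L : X → Type*) [TopologicalSpace (Bundle.TotalSpace ℂ L)] [∀ x, AddCommGroup (L x)]
    [∀ x, Module ℂ (L x)] [∀ x, TopologicalSpace (L x)] [FiberBundle ℂ L] [VectorBundle ℂ ℂ L]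
    (x₀ x : X) : L x :=
  (trivializationAt ℂ L x₀).symmL ℂ x (1 : ℂ)

/-- The coordinate functional on `L x` in the trivialization at `x₀`. -/
def lineCoframe (L : X → Type*) [TopologicalSpace (Bundle.TotalSpace ℂ L)]
    [∀ x, AddCommGroup (L x)] [∀ x, Module ℂ (L x)] [∀ x, TopologicalSpace (L x)]
    [FiberBundle ℂ L] [VectorBundle ℂ ℂ L] (x₀ x : X) : DualLine L x :=
  (trivializationAt ℂ L x₀).continuousLinearMapAt ℂ x

/-- The frame `(a, 1, d)` of `L ⊕ 𝒪 ⊕ L⁻¹`. -/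
def adaptedFrame {x : X} (a : L x) (d : DualLine L x) : Fin 3 → RankThreeBundle L x :=
  ![(a, 0, 0), (0, (1 : ℂ), 0), (0, 0, d)]

/-- The standard basis of the model fiber. -/
def rankThreeBasis : Module.Basis (Fin 3) ℂ RankThreeFiber :=
  .ofEquivFun
    { toFun := fun f => ![f.1, f.2.1, f.2.2 1]
      map_add' := fun f g => by ext i; fin_cases i <;> simp
      map_smul' := fun c f => by ext i; fin_cases i <;> simp
      invFun := fun v => (v 0, v 1, v 2 • ContinuousLinearMap.id ℂ ℂ)
      left_inv := fun f => by
        refine Prod.ext rfl (Prod.ext rfl ?_)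
        ext; simp
      right_inv := fun v => by ext i; fin_cases i <;> simp }

lemma rankThreeBasis_apply (i : Fin 3) :
    rankThreeBasis i = (![(1, 0, 0), (0, 1, 0), (0, 0, ContinuousLinearMap.id ℂ ℂ)] :
      Fin 3 → RankThreeFiber) i := by
  rw [rankThreeBasis, Module.Basis.coe_ofEquivFun]
  have h0 : (0 : ℂ) • ContinuousLinearMap.id ℂ ℂ = 0 := by ext; simp
  fin_cases i <;> simp [h0]

lemma lineCoframe_lineFrame {x₀ x : X} (hx : x ∈ (trivializationAt ℂ L x₀).baseSet) :
    lineCoframe L x₀ x (lineFrame L x₀ x) = (1 : ℂ) := by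
  exact (trivializationAt ℂ L x₀).continuousLinearMapAt_symmL (R := ℂ) hx 1

lemma eq_smul_lineFrame {x₀ x : X} (hx : x ∈ (trivializationAt ℂ L x₀).baseSet) (b : L x) :
    b = (lineCoframe L x₀ x b : ℂ) • lineFrame L x₀ x := by
  have h := (trivializationAt ℂ L x₀).symmL_continuousLinearMapAt (R := ℂ) hx b
  have h2 := map_smul ((trivializationAt ℂ L x₀).symmL ℂ x) (lineCoframe L x₀ x b : ℂ) (1 : ℂ)
  rw [smul_eq_mul, mul_one] at h2
  exact h.symm.trans h2

lemma smul_zero_dualLine {x : X} (c : ℂ) : c • (0 : DualLine L x) = 0 := by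
  ext b
  exact mul_zero c

lemma adaptedFrame_smul {x : X} (l : ℂ) (a : L x) (d : DualLine L x) (i : Fin 3) :
    adaptedFrame (l • a) (l⁻¹ • d) i = (![l, 1, l⁻¹] : Fin 3 → ℂ) i • adaptedFrame a d i := by
  fin_cases i
  · exact Prod.ext rfl (Prod.ext (smul_zero _).symm (smul_zero_dualLine _).symm)
  · exact Prod.ext (smul_zero _).symm (Prod.ext (one_smul ℂ _).symm (smul_zero_dualLine _).symm)
  · exact Prod.ext (smul_zero _).symm (Prod.ext (smul_zero _).symm rfl)

lemma adaptedFrame_sum {x : X} (a : L x) (d : DualLine L x) (v : Fin 3 → ℂ) :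
    ∑ i, v i • adaptedFrame a d i = (v 0 • a, (v 1 : Bundle.Trivial X ℂ x), v 2 • d) := by
  rw [Fin.sum_univ_three]
  refine Prod.ext ?_ (Prod.ext ?_ ?_)
  · change v 0 • a + v 1 • (0 : L x) + v 2 • (0 : L x) = _
    simp
  · change v 0 • (0 : ℂ) + v 1 • (1 : ℂ) + v 2 • (0 : ℂ) = v 1
    simp
  · change v 0 • (0 : DualLine L x) + v 1 • (0 : DualLine L x) + v 2 • d = _
    rw [smul_zero_dualLine, smul_zero_dualLine, zero_add, zero_add]

variable (H : HermitianMetric RankThreeFiber (RankThreeBundle L))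

/-- The Gram matrix of an adapted frame. -/
def gramAt {x : X} (a : L x) (d : DualLine L x) : Matrix (Fin 3) (Fin 3) ℂ :=
  Matrix.of fun i j => H.form x (adaptedFrame a d i) (adaptedFrame a d j)

lemma gramAt_smul {x : X} (l : ℂ) (a : L x) (d : DualLine L x) :
    gramAt H (l • a) (l⁻¹ • d) = scaleGram l (gramAt H a d) := by
  ext i j
  rw [scaleGram_apply]
  simp only [gramAt, Matrix.of_apply, adaptedFrame_smul]
  rw [map_smul, map_smulₛₗ, LinearMap.smul_apply, smul_eq_mul, smul_eq_mul, mul_comm]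
  rfl

open scoped ComplexOrder in
lemma gramAt_posDef {x : X} {a : L x} {d : DualLine L x} (ha : a ≠ 0) (hd : d ≠ 0) :
    (gramAt H a d).PosDef := by
  have hsum : ∀ v : Fin 3 → ℂ, star v ⬝ᵥ (gramAt H a d *ᵥ v) =
      H.form x (∑ i, v i • adaptedFrame a d i) (∑ i, v i • adaptedFrame a d i) := fun v => by
    simp only [map_sum, LinearMap.sum_apply, map_smulₛₗ, LinearMap.smul_apply, dotProduct,
      Matrix.mulVec, gramAt, Matrix.of_apply, Pi.star_apply, Finset.mul_sum, smul_eq_mul,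
      RingHom.id_apply]
    rw [Finset.sum_comm]
    refine Finset.sum_congr rfl fun i _ => Finset.sum_congr rfl fun j _ => ?_
    rw [starRingEnd_apply]; ring
  refine Matrix.PosDef.of_dotProduct_mulVec_pos ?_ fun v hv => ?_
  · ext i j
    exact H.conj_symm x _ _
  · rw [hsum]
    set u := ∑ i, v i • adaptedFrame a d i with hu
    have hne : u ≠ 0 := fun h0 => hv (by
      rw [hu, adaptedFrame_sum] at h0
      have e0 := congrArg (fun f : RankThreeBundle L x => f.1) h0
      have e1 := congrArg (fun f : RankThreeBundle L x => f.2.1) h0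
      have e2 := congrArg (fun f : RankThreeBundle L x => f.2.2) h0
      ext i
      fin_cases i
      · exact (smul_eq_zero.1 e0).resolve_right ha
      · exact e1
      · exact (smul_eq_zero.1 e2).resolve_right hd)
    refine Complex.pos_iff.2 ⟨H.pos x u hne, ?_⟩
    have := congrArg Complex.im (H.conj_symm x u u)
    rw [Complex.conj_im] at this
    linarith

lemma lineFrame_ne_zero {x₀ x : X} (hx : x ∈ (trivializationAt ℂ L x₀).baseSet) :
    lineFrame L x₀ x ≠ 0 := fun h => by
  have := lineCoframe_lineFrame (L := L) hx
  rw [h, map_zero] at this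
  exact (zero_ne_one : (0 : ℂ) ≠ 1) this

lemma lineCoframe_ne_zero {x₀ x : X} (hx : x ∈ (trivializationAt ℂ L x₀).baseSet) :
    lineCoframe L x₀ x ≠ 0 := fun h => by
  have := lineCoframe_lineFrame (L := L) hx
  rw [h] at this
  exact (zero_ne_one : (0 : ℂ) ≠ 1) this

variable [IsManifold 𝓘(ℂ) ω X] (S : CanonicalSquareRoot L)

/-- The fibers of L and of the tangent bundle are lines spanned by a and v. If the product vanished
there, the whole multiplication would vanish at x, against surjectivity onto the nonzero fiber of K.
This is why τ has no zero. -/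
lemma CanonicalSquareRoot.mul_ne_zero {x : X} {a : L x}
    (ha : ∀ b : L x, ∃ c : ℂ, b = c • a) {v : TangentSpace 𝓘(ℂ) x} (hv : v ≠ 0) :
    S.mul x a a v ≠ (0 : ℂ) := by
  intro h0
  -- The tangent space is ℂ by definition, so the coefficient is an honest quotient of complex
  -- numbers.
  have hT : ∀ w : TangentSpace 𝓘(ℂ) x, ∃ c : ℂ, w = c • v := fun w =>
    ⟨@HDiv.hDiv ℂ ℂ ℂ _ w v, (div_mul_cancel₀ (G₀ := ℂ) w (b := v) hv).symm⟩
  have hzero : ∀ b c : L x, S.mul x b c = 0 := fun b c => by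
    obtain ⟨β, rfl⟩ := ha b
    obtain ⟨δ, rfl⟩ := ha c
    refine ContinuousLinearMap.ext fun w => ?_
    obtain ⟨ε, rfl⟩ := hT w
    simp only [map_smul, smul_apply]
    rw [h0]
    simp
  have hlift : TensorProduct.lift (ContinuousLinearMap.coeLM ℂ ∘ₗ S.mul x) = 0 := by
    ext b c : 3
    simpa using hzero b c
  obtain ⟨y, hy⟩ := (S.bijective x).2 (ContinuousLinearMap.id ℂ ℂ : ℂ →L[ℂ] ℂ)
  rw [hlift] at hy
  have := congrArg (fun f : ℂ →L[ℂ] ℂ => f 1) hy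
  exact (zero_ne_one : (0 : ℂ) ≠ 1) this

variable [ContMDiffVectorBundle ω ℂ L 𝓘(ℂ)]

/-- The frame is the one that the trivialization of the direct sum attaches to the standard basis;
this is checked componentwise, the dual component by evaluation on the frame of L. -/
lemma isLocalFrameOn_adaptedFrame (x₀ : X) :
    IsLocalFrameOn 𝓘(ℂ) RankThreeFiber ω
      (fun i x => adaptedFrame (lineFrame L x₀ x) (lineCoframe L x₀ x) i)
      (trivializationAt ℂ L x₀).baseSet := by
  set E := trivializationAt RankThreeFiber (RankThreeBundle L) x₀ with hE
  have hbase : E.baseSet = (trivializationAt ℂ L x₀).baseSet := by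
    simp [hE]
  have h := E.isLocalFrameOn_localFrame_baseSet 𝓘(ℂ) ω rankThreeBasis
  rw [hbase] at h
  refine h.congr fun i x hx => ?_
  rw [E.localFrame_apply_of_mem_baseSet rankThreeBasis (by rwa [hbase])]
  simp only [Bundle.Trivialization.basisAt, Module.Basis.map_apply]
  rw [LinearEquiv.symm_apply_eq, rankThreeBasis_apply]
  have : ∀ f : RankThreeBundle L x, (E.linearEquivAt ℂ x (by rwa [hbase])) f =
      ((trivializationAt ℂ L x₀ ⟨x, f.1⟩).2, f.2.1,
        (trivializationAt (ℂ →L[ℂ] ℂ) (DualLine L) x₀ ⟨x, f.2.2⟩).2) := fun f => rfl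
  have hz : (trivializationAt (ℂ →L[ℂ] ℂ) (DualLine L) x₀ ⟨x, 0⟩).2 = 0 := by
    have := (this 0).symm.trans (map_zero _)
    exact congrArg (fun f : RankThreeFiber => f.2.2) this
  have hz' : (trivializationAt ℂ L x₀ ⟨x, 0⟩).2 = 0 := by
    have := (this 0).symm.trans (map_zero _)
    exact congrArg (fun f : RankThreeFiber => f.1) this
  have h1 : (trivializationAt ℂ L x₀ ⟨x, lineFrame L x₀ x⟩).2 = 1 := by
    exact (congrFun ((trivializationAt ℂ L x₀).coe_linearMapAt_of_mem (R := ℂ) hx) _).symm.trans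
      (lineCoframe_lineFrame hx)
  have h2 : (trivializationAt (ℂ →L[ℂ] ℂ) (DualLine L) x₀ ⟨x, lineCoframe L x₀ x⟩).2 =
      ContinuousLinearMap.id ℂ ℂ := by
    rw [hom_trivializationAt_apply]
    ext
    change (Bundle.Trivial.trivialization X ℂ).continuousLinearMapAt ℂ x
      (lineCoframe L x₀ x (lineFrame L x₀ x)) = 1
    rw [Bundle.Trivial.continuousLinearMapAt_trivialization]
    exact lineCoframe_lineFrame hx
  rw [this]
  fin_cases i
  · exact Prod.ext h1.symm (Prod.ext rfl hz.symm)
  · exact Prod.ext hz'.symm (Prod.ext rfl hz.symm)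
  · exact Prod.ext hz'.symm (Prod.ext rfl h2.symm)

lemma contMDiffOn_lineFrame (x₀ : X) :
    ContMDiffOn 𝓘(ℂ) (𝓘(ℂ).prod 𝓘(ℂ, ℂ)) ω
      (fun x => Bundle.TotalSpace.mk' ℂ x (lineFrame L x₀ x)) (trivializationAt ℂ L x₀).baseSet := by
  rw [(trivializationAt ℂ L x₀).contMDiffOn_section_baseSet_iff]
  refine (contMDiffOn_const (c := (1 : ℂ))).congr fun x hx => ?_
  exact (congrFun ((trivializationAt ℂ L x₀).coe_linearMapAt_of_mem (R := ℂ) hx) _).symm.trans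
      (lineCoframe_lineFrame hx)

lemma differentiableAt_canonicalSection {s : ∀ x, CanonicalBundle X x} {U : Set X} (hU : IsOpen U)
    (hs : ContMDiffOn 𝓘(ℂ) (𝓘(ℂ).prod 𝓘(ℂ, ℂ →L[ℂ] ℂ)) ω
      (fun x => Bundle.TotalSpace.mk' (ℂ →L[ℂ] ℂ) x (s x)) U) (x₀ : X) {z : ℂ}
    (hz : z ∈ (chartAt ℂ x₀).target) (hzU : (chartAt ℂ x₀).symm z ∈ U) :
    DifferentiableAt ℂ (fun w => (s ((chartAt ℂ x₀).symm w) (coordVector (chartAt ℂ x₀) w) : ℂ)) z := by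
  have h1 : ContMDiffAt 𝓘(ℂ) 𝓘(ℂ) ω (chartAt ℂ x₀).symm z :=
    (contMDiffOn_chart_symm (I := 𝓘(ℂ)) (n := ω) (x := x₀)).contMDiffAt
      ((chartAt ℂ x₀).open_target.mem_nhds hz)
  have h2 := (hs.contMDiffAt (hU.mem_nhds hzU)).comp z h1
  have h3 := ContMDiffAt.clm_bundle_apply (E₁ := (TangentSpace 𝓘(ℂ) : X → Type))
    (E₂ := Bundle.Trivial X ℂ) (b := fun w => (chartAt ℂ x₀).symm w) h2
    (contMDiffAt_coordVector x₀ hz)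
  have h4 := (Bundle.contMDiffAt_totalSpace.1 h3).2
  exact h4.contDiffAt.differentiableAt (by simp)

lemma differentiableAt_lineSection {s : ∀ x, TangentSpace 𝓘(ℂ) x →L[ℂ] L x}
    (hs : ContMDiff 𝓘(ℂ) (𝓘(ℂ).prod 𝓘(ℂ, ℂ →L[ℂ] ℂ)) ω
      (fun x => Bundle.TotalSpace.mk' (ℂ →L[ℂ] ℂ) x (s x))) (x₀ : X) {z : ℂ}
    (hz : z ∈ (chartAt ℂ x₀).target)
    (hzU : (chartAt ℂ x₀).symm z ∈ (trivializationAt ℂ L x₀).baseSet) :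
    DifferentiableAt ℂ (fun w => (lineCoframe L x₀ ((chartAt ℂ x₀).symm w)
      (s ((chartAt ℂ x₀).symm w) (coordVector (chartAt ℂ x₀) w)) : ℂ)) z := by
  have h1 : ContMDiffAt 𝓘(ℂ) 𝓘(ℂ) ω (chartAt ℂ x₀).symm z :=
    (contMDiffOn_chart_symm (I := 𝓘(ℂ)) (n := ω) (x := x₀)).contMDiffAt
      ((chartAt ℂ x₀).open_target.mem_nhds hz)
  have h2 := (hs.contMDiffAt (x := (chartAt ℂ x₀).symm z)).comp z h1
  have h3 := ContMDiffAt.clm_bundle_apply (E₁ := (TangentSpace 𝓘(ℂ) : X → Type))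
    (E₂ := L) (b := fun w => (chartAt ℂ x₀).symm w) h2
    (contMDiffAt_coordVector x₀ hz)
  have h4 := ((trivializationAt ℂ L x₀).contMDiffAt_iff (n := ω) (IB := 𝓘(ℂ))
    ((trivializationAt ℂ L x₀).mem_source.2 hzU)).1 h3
  refine (h4.2.contDiffAt.differentiableAt (by simp)).congr_of_eventuallyEq ?_
  have h5 := h1.continuousAt.preimage_mem_nhds
    ((trivializationAt ℂ L x₀).open_baseSet.mem_nhds hzU)
  filter_upwards [h5] with w hw
  exact congrFun ((trivializationAt ℂ L x₀).coe_linearMapAt_of_mem (R := ℂ) hw) _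

end Frames

/-! ### From the bundle and Hitchin's equation to matrices of functions. -/

section Readings

variable {X : Type*} [TopologicalSpace X] [ChartedSpace ℂ X] [IsManifold 𝓘(ℂ) ω X]
  {L : X → Type*} [TopologicalSpace (Bundle.TotalSpace ℂ L)] [∀ x, AddCommGroup (L x)]
  [∀ x, Module ℂ (L x)] [∀ x, TopologicalSpace (L x)] [∀ x, IsTopologicalAddGroup (L x)]
  [∀ x, ContinuousSMul ℂ (L x)] [FiberBundle ℂ L] [VectorBundle ℂ ℂ L]
  (S : CanonicalSquareRoot L)
  (t : Cₛ^ω⟮𝓘(ℂ); ℂ →L[ℂ] ℂ, fun x : X => TangentSpace 𝓘(ℂ) x →L[ℂ] L x⟯)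

/-- The coefficient of `t` in the trivialization at `x₀`, at the tangent vector `v`. -/
def tCoeff (x₀ x : X) (v : TangentSpace 𝓘(ℂ) x) : ℂ := lineCoframe L x₀ x (t x v)

/-- The coefficient of `τ` in the trivialization at `x₀`, at the tangent vector `v`. -/
def tauCoeff (x₀ x : X) (v : TangentSpace 𝓘(ℂ) x) : ℂ :=
  S.mul x (lineFrame L x₀ x) (lineFrame L x₀ x) v

variable {S t} {x₀ x : X}

/-- On a line the functional b ↦ (e b)(v), with e the frame vector, is determined by its value at e.
-/
lemma tau_lineFrame (hx : x ∈ (trivializationAt ℂ L x₀).baseSet) (v : TangentSpace 𝓘(ℂ) x) :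
    S.tau x v (lineFrame L x₀ x) = tauCoeff S x₀ x v • lineCoframe L x₀ x := by
  refine ContinuousLinearMap.ext fun b => ?_
  change (S.mul x (lineFrame L x₀ x) b v : ℂ) = tauCoeff S x₀ x v * (lineCoframe L x₀ x b : ℂ)
  conv_lhs => rw [eq_smul_lineFrame hx b, map_smul]
  exact mul_comm _ _

lemma t_eq_smul_lineFrame (hx : x ∈ (trivializationAt ℂ L x₀).baseSet)
    (v : TangentSpace 𝓘(ℂ) x) : t x v = tCoeff t x₀ x v • lineFrame L x₀ x :=
  eq_smul_lineFrame hx _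

lemma cyclicHiggsField_adaptedFrame (hx : x ∈ (trivializationAt ℂ L x₀).baseSet)
    (v : TangentSpace 𝓘(ℂ) x) (j : Fin 3) :
    cyclicHiggsField S t x v (adaptedFrame (lineFrame L x₀ x) (lineCoframe L x₀ x) j) =
      ∑ i, cyclicMatrix (tCoeff t x₀ x v) (tauCoeff S x₀ x v) i j •
        adaptedFrame (lineFrame L x₀ x) (lineCoframe L x₀ x) i := by
  rw [adaptedFrame_sum (lineFrame L x₀ x) (lineCoframe L x₀ x)
    (fun i => cyclicMatrix (tCoeff t x₀ x v) (tauCoeff S x₀ x v) i j)]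
  fin_cases j
  · refine Prod.ext ?_ (Prod.ext ?_ ?_)
    · change (0 : ℂ) • t x v = (0 : ℂ) • lineFrame L x₀ x
      simp
    · rfl
    · exact tau_lineFrame hx v
  · refine Prod.ext ?_ (Prod.ext ?_ ?_)
    · change (1 : ℂ) • t x v = tCoeff t x₀ x v • lineFrame L x₀ x
      rw [one_smul]; exact t_eq_smul_lineFrame hx v
    · rfl
    · change S.tau x v 0 = (0 : ℂ) • lineCoframe L x₀ x
      rw [map_zero]
      exact ContinuousLinearMap.ext fun b => (zero_mul (M₀ := ℂ) _).symm
  · refine Prod.ext ?_ (Prod.ext ?_ ?_)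
    · change (0 : ℂ) • t x v = (0 : ℂ) • lineFrame L x₀ x
      simp
    · rfl
    · change S.tau x v 0 = (0 : ℂ) • lineCoframe L x₀ x
      rw [map_zero]
      exact ContinuousLinearMap.ext fun b => (zero_mul (M₀ := ℂ) _).symm

lemma IsLocalFrameOn.coeff_eq_of_eq_sum {F : Type*} [NormedAddCommGroup F] [NormedSpace ℂ F]
    {E : X → Type*} [TopologicalSpace (Bundle.TotalSpace F E)] [∀ x, AddCommGroup (E x)]
    [∀ x, Module ℂ (E x)] [∀ x, TopologicalSpace (E x)] [FiberBundle F E] {n : ℕ}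
    {e : Fin n → (x : X) → E x} {U : Set X} (he : IsLocalFrameOn 𝓘(ℂ) F ω e U) (hx : x ∈ U)
    {u : E x} {c : Fin n → ℂ} (hu : u = ∑ i, c i • e i x) (i : Fin n) : he.coeff i x u = c i := by
  have h1 : u = ∑ i, c i • he.toBasisAt hx i := by simpa using hu
  simp only [IsLocalFrameOn.coeff, hx, dite_true, Module.Basis.coord_apply]
  rw [h1, Module.Basis.repr_sum_self]

lemma tCoeff_eq_mul (v : TangentSpace 𝓘(ℂ) x) :
    tCoeff t x₀ x v = (show ℂ from v) * tCoeff t x₀ x (1 : ℂ) := by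
  have hv : v = (show ℂ from v) • (show TangentSpace 𝓘(ℂ) x from (1 : ℂ)) :=
    (mul_one (M := ℂ) _).symm
  simp only [tCoeff]
  conv_lhs => rw [hv, map_smul, map_smul]
  rfl

lemma tauCoeff_eq_mul (v : TangentSpace 𝓘(ℂ) x) :
    tauCoeff S x₀ x v = (show ℂ from v) * tauCoeff S x₀ x (1 : ℂ) := by
  have hv : v = (show ℂ from v) • (show TangentSpace 𝓘(ℂ) x from (1 : ℂ)) :=
    (mul_one (M := ℂ) _).symm
  simp only [tauCoeff]
  conv_lhs => rw [hv, map_smul]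
  rfl

variable [ContMDiffVectorBundle ω ℂ L 𝓘(ℂ)]
  (H : HermitianMetric RankThreeFiber (RankThreeBundle L))

lemma higgsMatrix_cyclicHiggsField (φ : OpenPartialHomeomorph X ℂ) {U : Set X}
    (hU : U ⊆ (trivializationAt ℂ L x₀).baseSet)
    (he : IsLocalFrameOn 𝓘(ℂ) RankThreeFiber ω
      (fun i x => adaptedFrame (lineFrame L x₀ x) (lineCoframe L x₀ x) i) U) {z : ℂ}
    (hz : φ.symm z ∈ U) :
    higgsMatrix (cyclicHiggsField S t) φ he z =
      cyclicMatrix (tCoeff t x₀ (φ.symm z) (coordVector φ z))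
        (tauCoeff S x₀ (φ.symm z) (coordVector φ z)) := by
  ext i j
  exact he.coeff_eq_of_eq_sum hz (cyclicHiggsField_adaptedFrame (hU hz) _ j) i

lemma cyclicHitchinAt_reading (hH : SolvesHitchin H (cyclicHiggsField S t)) (x₀ : X) {z : ℂ}
    (hz : z ∈ (chartAt ℂ x₀).target)
    (hzU : (chartAt ℂ x₀).symm z ∈ (trivializationAt ℂ L x₀).baseSet) :
    CyclicHitchinAt
      (fun z => gramAt H (lineFrame L x₀ ((chartAt ℂ x₀).symm z))
        (lineCoframe L x₀ ((chartAt ℂ x₀).symm z)))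
      (fun z => tCoeff t x₀ ((chartAt ℂ x₀).symm z) (coordVector (chartAt ℂ x₀) z))
      (fun z => tauCoeff S x₀ ((chartAt ℂ x₀).symm z) (coordVector (chartAt ℂ x₀) z)) z := by
  have hB := (trivializationAt ℂ L x₀).open_baseSet
  have hf := isLocalFrameOn_adaptedFrame (L := L) x₀
  refine ⟨fun i j => ?_, gramAt_posDef H (lineFrame_ne_zero hzU) (lineCoframe_ne_zero hzU),
    differentiableAt_lineSection t.contMDiff x₀ hz hzU,
    differentiableAt_canonicalSection hB
      (S.holomorphic _ hB _ _ (contMDiffOn_lineFrame x₀) (contMDiffOn_lineFrame x₀)) x₀ hz hzU,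
    S.mul_ne_zero (fun b => ⟨_, eq_smul_lineFrame hzU b⟩) (coordVector_ne_zero x₀ hz), ?_⟩
  · exact contDiffAt_of_contMDiffOn_real hB (H.smooth _ hB _ _ (hf.contMDiffOn i)
      (hf.contMDiffOn j)) x₀ hz hzU
  · set U := (chartAt ℂ x₀).source ∩ (trivializationAt ℂ L x₀).baseSet
    have hzU' : (chartAt ℂ x₀).symm z ∈ U := ⟨(chartAt ℂ x₀).map_target hz, hzU⟩
    have he := hf.mono (Set.inter_subset_right : U ⊆ _)
    have := hH _ (IsManifold.chart_mem_maximalAtlas x₀) U ((chartAt ℂ x₀).open_source.inter hB)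
      Set.inter_subset_left 3 _ he z hz hzU'
    rw [higgsMatrix_cyclicHiggsField _ Set.inter_subset_right he hzU'] at this
    exact this

variable (X) in
/-- The coefficients of the holomorphic one-forms at the tangent vectors `1`. -/
def oneFormCoeffs : Set (X → ℂ) :=
  Set.range fun (s : Cₛ^ω⟮𝓘(ℂ); ℂ →L[ℂ] ℂ, CanonicalBundle X⟯) (x : X) => (s x (1 : ℂ) : ℂ)

theorem hasCyclicReadings (hH : SolvesHitchin H (cyclicHiggsField S t)) :
    HasCyclicReadings (fun x => gramAt H (lineFrame L x x) (lineCoframe L x x))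
      (fun x => tCoeff t x x (1 : ℂ)) (fun x => tauCoeff S x x (1 : ℂ)) (oneFormCoeffs X) := by
  intro x₀
  set φ := chartAt ℂ x₀
  refine ⟨fun z => gramAt H (lineFrame L x₀ (φ.symm z)) (lineCoframe L x₀ (φ.symm z)),
    fun z => tCoeff t x₀ (φ.symm z) (coordVector φ z),
    fun z => tauCoeff S x₀ (φ.symm z) (coordVector φ z),
    -- The pointwise data use the trivialization at the point itself, which may jump from point to
    -- point. So l and m compare it with the fixed trivialization and chart at x₀ one point at a
    -- time, with no continuity claimed.
    fun z => lineCoframe L (φ.symm z) (φ.symm z) (lineFrame L x₀ (φ.symm z)),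
    fun z => coordVector φ z, ?_⟩
  have hx₀ : φ x₀ ∈ φ.target := φ.map_source (mem_chart_source ℂ x₀)
  have hpre : ∀ᶠ z in 𝓝 (φ x₀), φ.symm z ∈ (trivializationAt ℂ L x₀).baseSet := by
    refine (φ.continuousAt_symm hx₀).preimage_mem_nhds
      ((trivializationAt ℂ L x₀).open_baseSet.mem_nhds ?_)
    rw [φ.left_inv (mem_chart_source ℂ x₀)]
    exact FiberBundle.mem_baseSet_trivializationAt ℂ L x₀
  filter_upwards [φ.open_target.mem_nhds hx₀, hpre] with z hz hzU
  set x := φ.symm z with hx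
  have hxx : x ∈ (trivializationAt ℂ L x).baseSet := FiberBundle.mem_baseSet_trivializationAt ℂ L x
  set l : ℂ := lineCoframe L x x (lineFrame L x₀ x) with hl
  have hframe : lineFrame L x₀ x = l • lineFrame L x x := eq_smul_lineFrame hxx _
  have hl0 : l ≠ 0 := fun h0 => lineFrame_ne_zero hzU (by rw [hframe, h0, zero_smul])
  have hcoframe : lineCoframe L x₀ x = l⁻¹ • lineCoframe L x x := by
    refine ContinuousLinearMap.ext fun b => ?_
    have h1 := congrArg (lineCoframe L x x) (eq_smul_lineFrame hzU b)
    rw [map_smul] at h1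
    have h2 : (lineCoframe L x x b : ℂ) = (lineCoframe L x₀ x b : ℂ) * l := h1
    change (lineCoframe L x₀ x b : ℂ) = l⁻¹ * (lineCoframe L x x b : ℂ)
    rw [h2]; field_simp
  refine ⟨cyclicHitchinAt_reading H hH x₀ hz hzU, hl0, coordVector_ne_zero x₀ hz, ?_, ?_, ?_, ?_⟩
  · rw [hframe, hcoframe, gramAt_smul]
  · have h1 : tCoeff t x₀ x (1 : ℂ) = l⁻¹ * tCoeff t x x (1 : ℂ) := by
      simp only [tCoeff]
      rw [hcoframe]
      rfl
    exact (tCoeff_eq_mul (coordVector φ z)).trans ((congrArg _ h1).trans (mul_assoc _ _ _).symm)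
  · have h1 : tauCoeff S x₀ x (1 : ℂ) = l ^ 2 * tauCoeff S x x (1 : ℂ) := by
      simp only [tauCoeff]
      rw [hframe, map_smul, map_smul, sq, mul_assoc]
      rfl
    exact (tauCoeff_eq_mul (coordVector φ z)).trans ((congrArg _ h1).trans (mul_assoc _ _ _).symm)
  · rintro w ⟨s, rfl⟩
    have := differentiableAt_canonicalSection isOpen_univ s.contMDiff.contMDiffOn x₀ hz
      (Set.mem_univ _)
    refine this.congr_of_eventuallyEq (Eventually.of_forall fun y => ?_)
    have hm : coordVector φ y = (show ℂ from coordVector φ y) •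
      (show TangentSpace 𝓘(ℂ) (φ.symm y) from (1 : ℂ)) := (mul_one (M := ℂ) _).symm
    change _ = (s (φ.symm y) (coordVector φ y) : ℂ)
    conv_rhs => rw [hm, map_smul]
    rfl

/-- Evaluation at x maps a space of dimension at least 2 to a line, so it has a kernel. This is the
only place where the genus enters. -/
lemma exists_oneFormCoeffs_eq_zero (hgenus : 2 ≤ riemannSurfaceGenus X) (x : X) :
    ∃ w ∈ oneFormCoeffs X, w x = 0 ∧ ∃ y, w y ≠ 0 := by
  let ev : Cₛ^ω⟮𝓘(ℂ); ℂ →L[ℂ] ℂ, CanonicalBundle X⟯ →ₗ[ℂ] ℂ :=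
    { toFun := fun s => s x (1 : ℂ)
      map_add' := fun s s' => rfl
      map_smul' := fun c s => rfl }
  have hev : ¬ Function.Injective ev := fun h => by
    have := LinearMap.finrank_le_finrank_of_injective h
    rw [Module.finrank_self] at this
    exact absurd (hgenus.trans this) (by norm_num)
  rw [← LinearMap.ker_eq_bot, Submodule.eq_bot_iff] at hev
  push Not at hev
  obtain ⟨s, hs, hs0⟩ := hev
  refine ⟨_, ⟨s, rfl⟩, hs, ?_⟩
  by_contra! h
  refine hs0 (ContMDiffSection.ext fun y => ContinuousLinearMap.ext fun v => ?_)
  have hv : v = (show ℂ from v) • (show TangentSpace 𝓘(ℂ) y from (1 : ℂ)) :=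
    (mul_one (M := ℂ) _).symm
  have h' : s y (show TangentSpace 𝓘(ℂ) y from (1 : ℂ)) = (0 : ℂ) := h y
  rw [hv, map_smul, h']
  exact mul_zero _

end Readings

/-! ### Operator norms on lines and elementary inequalities. -/

section Norms

/-- On lines, by homogeneity, a constant is admissible as soon as it is admissible at one pair of
generators; the admissible constants form a closed half-line. -/
lemma twistedHomNorm_eq {T V W : Type*} [AddCommGroup T] [Module ℂ T] [AddCommGroup V]
    [Module ℂ V] [AddCommGroup W] [Module ℂ W] {nT : T → ℝ} {nV : V → ℝ} {nW : W → ℝ}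
    (A : T →ₗ[ℂ] V →ₗ[ℂ] W) {v₀ : T} {u₀ : V}
    (hv : ∀ v, ∃ c : ℂ, v = c • v₀) (hu : ∀ u, ∃ c : ℂ, u = c • u₀)
    (hnT : ∀ (c : ℂ) v, nT (c • v) = ‖c‖ * nT v) (hnV : ∀ (c : ℂ) u, nV (c • u) = ‖c‖ * nV u)
    (hnW : ∀ (c : ℂ) w, nW (c • w) = ‖c‖ * nW w)
    (hv₀ : 0 < nT v₀) (hu₀ : 0 < nV u₀) (hW : 0 ≤ nW (A v₀ u₀)) :
    twistedHomNorm nT nV nW (fun v u => A v u) = nW (A v₀ u₀) / (nT v₀ * nV u₀) := by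
  have hset : {C : ℝ | 0 ≤ C ∧ ∀ v u, nW (A v u) ≤ C * nT v * nV u} =
      Set.Ici (nW (A v₀ u₀) / (nT v₀ * nV u₀)) := by
    ext C
    simp only [Set.mem_ofPred_eq, Set.mem_Ici]
    constructor
    · rintro ⟨-, h⟩
      rw [div_le_iff₀ (by positivity), ← mul_assoc]
      exact h v₀ u₀
    · intro h
      refine ⟨le_trans (by positivity) h, fun v u => ?_⟩
      obtain ⟨c, rfl⟩ := hv v
      obtain ⟨d, rfl⟩ := hu u
      rw [map_smul, map_smul, LinearMap.smul_apply, hnW, hnW, hnT, hnV]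
      rw [div_le_iff₀ (by positivity)] at h
      calc ‖d‖ * (‖c‖ * nW (A v₀ u₀)) ≤ ‖d‖ * (‖c‖ * (C * (nT v₀ * nV u₀))) := by gcongr
        _ = _ := by ring
  rw [twistedHomNorm, hset, csInf_Ici]

lemma HermitianMetric.fiberNorm_smul {X : Type*} [TopologicalSpace X] [ChartedSpace ℂ X]
    {F : Type*} [NormedAddCommGroup F] [NormedSpace ℂ F]
    {E : X → Type*} [TopologicalSpace (Bundle.TotalSpace F E)] [∀ x, AddCommGroup (E x)]
    [∀ x, Module ℂ (E x)] [∀ x, TopologicalSpace (E x)] [FiberBundle F E]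
    (h : HermitianMetric F E) (x : X) (c : ℂ) (v : E x) :
    h.fiberNorm x (c • v) = ‖c‖ * h.fiberNorm x v := by
  have : (h.form x (c • v) (c • v)).re = ‖c‖ ^ 2 * (h.form x v v).re := by
    rw [map_smul, map_smulₛₗ, LinearMap.smul_apply, smul_eq_mul, smul_eq_mul, ← mul_assoc,
      Complex.mul_conj, Complex.re_ofReal_mul, Complex.normSq_eq_norm_sq]
  rw [fiberNorm, this, Real.sqrt_mul (by positivity), Real.sqrt_sq (norm_nonneg c), fiberNorm]

lemma HermitianMetric.fiberNorm_pos {X : Type*} [TopologicalSpace X] [ChartedSpace ℂ X]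
    {F : Type*} [NormedAddCommGroup F] [NormedSpace ℂ F]
    {E : X → Type*} [TopologicalSpace (Bundle.TotalSpace F E)] [∀ x, AddCommGroup (E x)]
    [∀ x, Module ℂ (E x)] [∀ x, TopologicalSpace (E x)] [FiberBundle F E]
    (h : HermitianMetric F E) (x : X) {v : E x} (hv : v ≠ 0) : 0 < h.fiberNorm x v :=
  Real.sqrt_pos.2 (h.pos x v hv)

/-- The length g of the tangent vector cancels, and the rest is the square root of the ratio
inequality. -/
lemma div_sqrt_lt_of_ratioUpper_lt_one {P Q g h₀ h₁ h₂ : ℝ} (hQ : 0 < Q) (hg : 0 < g)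
    (h0 : 0 < h₀) (h1 : 0 < h₁) (h2 : 0 < h₂) (h : P ^ 2 * h₀ ^ 2 / (Q ^ 2 * h₁ * h₂) < 1) :
    P * √h₀ / (g * √h₁) < Q * √h₂ / (g * √h₀) := by
  have s0 := Real.sqrt_pos.2 h0
  have s1 := Real.sqrt_pos.2 h1
  have s2 := Real.sqrt_pos.2 h2
  rw [div_lt_one (by positivity)] at h
  have h3 : P * (√h₀ * √h₀) < Q * (√h₁ * √h₂) := by
    refine lt_of_pow_lt_pow_left₀ 2 (by positivity) ?_
    simp only [mul_pow, Real.sq_sqrt h0.le, Real.sq_sqrt h1.le, Real.sq_sqrt h2.le]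
    linarith
  rw [div_lt_div_iff₀ (by positivity) (by positivity)]
  nlinarith

lemma div_sqrt_lt_of_ratioLower_lt_one {P Q g h₀ h₁ h₂ : ℝ} (hQ : 0 < Q) (hg : 0 < g)
    (h0 : 0 < h₀) (h1 : 0 < h₁) (h2 : 0 < h₂) (h : P ^ 2 * h₀ * h₁ / (Q ^ 2 * h₂ ^ 2) < 1) :
    P * √h₁ / (g * √h₂) < Q * √h₂ / (g * √h₀) := by
  have s0 := Real.sqrt_pos.2 h0
  have s1 := Real.sqrt_pos.2 h1
  have s2 := Real.sqrt_pos.2 h2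
  rw [div_lt_one (by positivity)] at h
  have h3 : P * (√h₀ * √h₁) < Q * (√h₂ * √h₂) := by
    refine lt_of_pow_lt_pow_left₀ 2 (by positivity) ?_
    simp only [mul_pow, Real.sq_sqrt h0.le, Real.sq_sqrt h1.le, Real.sq_sqrt h2.le]
    linarith
  rw [div_lt_div_iff₀ (by positivity) (by positivity)]
  nlinarith

end Norms

/-! ### The three norms in terms of the Gram matrix and the coefficients. -/

section NormReadings

variable {X : Type*} [TopologicalSpace X] [ChartedSpace ℂ X] [IsManifold 𝓘(ℂ) ω X]
  {L : X → Type*} [TopologicalSpace (Bundle.TotalSpace ℂ L)] [∀ x, AddCommGroup (L x)]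
  [∀ x, Module ℂ (L x)] [∀ x, TopologicalSpace (L x)] [∀ x, IsTopologicalAddGroup (L x)]
  [∀ x, ContinuousSMul ℂ (L x)] [FiberBundle ℂ L] [VectorBundle ℂ ℂ L]
  (S : CanonicalSquareRoot L)
  (t : Cₛ^ω⟮𝓘(ℂ); ℂ →L[ℂ] ℂ, fun x : X => TangentSpace 𝓘(ℂ) x →L[ℂ] L x⟯)
  (H : HermitianMetric RankThreeFiber (RankThreeBundle L))
  (g : HermitianMetric ℂ (TangentSpace 𝓘(ℂ) : X → Type)) (x : X)

lemma exists_eq_smul_tangent (v : TangentSpace 𝓘(ℂ) x) :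
    ∃ c : ℂ, v = c • (show TangentSpace 𝓘(ℂ) x from (1 : ℂ)) :=
  ⟨v, (mul_one (M := ℂ) _).symm⟩

lemma exists_eq_smul_trivial (b : Bundle.Trivial X ℂ x) :
    ∃ c : ℂ, b = c • (show Bundle.Trivial X ℂ x from (1 : ℂ)) :=
  ⟨b, (mul_one (M := ℂ) _).symm⟩

lemma exists_eq_smul_lineFrame (b : L x) : ∃ c : ℂ, b = c • lineFrame L x x :=
  ⟨_, eq_smul_lineFrame (FiberBundle.mem_baseSet_trivializationAt ℂ L x) b⟩

lemma exists_eq_smul_lineCoframe (f : DualLine L x) : ∃ c : ℂ, f = c • lineCoframe L x x := by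
  refine ⟨f (lineFrame L x x), ContinuousLinearMap.ext fun b => ?_⟩
  have hx := FiberBundle.mem_baseSet_trivializationAt ℂ L x
  conv_lhs => rw [eq_smul_lineFrame hx b, map_smul]
  exact mul_comm (G := ℂ) _ _

lemma fiberNorm_first_smul (c : ℂ) (a : L x) :
    H.fiberNorm x (c • a, 0, 0) = ‖c‖ * H.fiberNorm x (a, 0, 0) := by
  rw [← H.fiberNorm_smul]
  congr 1
  exact Prod.ext rfl (Prod.ext (mul_zero (M₀ := ℂ) c).symm (smul_zero_dualLine c).symm)

lemma fiberNorm_second_smul (c : ℂ) (b : Bundle.Trivial X ℂ x) :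
    H.fiberNorm x (0, c • b, 0) = ‖c‖ * H.fiberNorm x (0, b, 0) := by
  rw [← H.fiberNorm_smul]
  congr 1
  exact Prod.ext (smul_zero c).symm (Prod.ext rfl (smul_zero_dualLine c).symm)

lemma fiberNorm_third_smul (c : ℂ) (d : DualLine L x) :
    H.fiberNorm x (0, 0, c • d) = ‖c‖ * H.fiberNorm x (0, 0, d) := by
  rw [← H.fiberNorm_smul]
  congr 1
  exact Prod.ext (smul_zero c).symm (Prod.ext (mul_zero (M₀ := ℂ) c).symm rfl)

lemma fiberNorm_tangent_one_pos :
    0 < g.fiberNorm x (show TangentSpace 𝓘(ℂ) x from (1 : ℂ)) :=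
  g.fiberNorm_pos x (one_ne_zero (α := ℂ))

/-- The Gram matrix of `H` in the frame of the fiber over `x` given by the preferred trivialization
at `x`. -/
def fiberGram : Matrix (Fin 3) (Fin 3) ℂ := gramAt H (lineFrame L x x) (lineCoframe L x x)

open scoped ComplexOrder in
lemma fiberGram_posDef : (fiberGram H x).PosDef :=
  have hx := FiberBundle.mem_baseSet_trivializationAt ℂ L x
  gramAt_posDef H (lineFrame_ne_zero hx) (lineCoframe_ne_zero hx)

lemma normTau_eq : normTau H g S x = ‖tauCoeff S x x (1 : ℂ)‖ * √(fiberGram H x 2 2).re /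
    (g.fiberNorm x (1 : ℂ) * √(fiberGram H x 0 0).re) := by
  have hx := FiberBundle.mem_baseSet_trivializationAt ℂ L x
  have h := twistedHomNorm_eq (nT := g.fiberNorm x) (nV := fun a : L x => H.fiberNorm x (a, 0, 0))
    (nW := fun c : DualLine L x => H.fiberNorm x (0, 0, c)) (S.tau x)
    (exists_eq_smul_tangent x) (exists_eq_smul_lineFrame x) (g.fiberNorm_smul x)
    (fiberNorm_first_smul H x) (fiberNorm_third_smul H x) (fiberNorm_tangent_one_pos g x)
    (Real.sqrt_pos.2 ((fiberGram_posDef H x).re_diag_pos 0)) (Real.sqrt_nonneg _)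
  have h1 := (congrArg (fun c => H.fiberNorm x (0, 0, c)) (tau_lineFrame (S := S) hx (1 : ℂ))).trans
    (fiberNorm_third_smul H x _ _)
  exact h.trans (congrArg (· / _) h1)

lemma normTUpper_eq : normTUpper H g t x = ‖tCoeff t x x (1 : ℂ)‖ * √(fiberGram H x 0 0).re /
    (g.fiberNorm x (1 : ℂ) * √(fiberGram H x 1 1).re) := by
  have hx := FiberBundle.mem_baseSet_trivializationAt ℂ L x
  have h := twistedHomNorm_eq (nT := g.fiberNorm x)
    (nV := fun b : Bundle.Trivial X ℂ x => H.fiberNorm x (0, b, 0))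
    (nW := fun a : L x => H.fiberNorm x (a, 0, 0)) (tUpper t x)
    (exists_eq_smul_tangent x) (exists_eq_smul_trivial x) (g.fiberNorm_smul x)
    (fiberNorm_second_smul H x) (fiberNorm_first_smul H x) (fiberNorm_tangent_one_pos g x)
    (Real.sqrt_pos.2 ((fiberGram_posDef H x).re_diag_pos 1)) (Real.sqrt_nonneg _)
  have h1 : tUpper t x (show TangentSpace 𝓘(ℂ) x from (1 : ℂ))
      (show Bundle.Trivial X ℂ x from (1 : ℂ)) = tCoeff t x x (1 : ℂ) • lineFrame L x x :=
    (one_smul ℂ _).trans (t_eq_smul_lineFrame hx _)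
  simp only at h
  rw [h1, fiberNorm_first_smul] at h
  exact h

lemma normTLower_eq : normTLower H g t x = ‖tCoeff t x x (1 : ℂ)‖ * √(fiberGram H x 1 1).re /
    (g.fiberNorm x (1 : ℂ) * √(fiberGram H x 2 2).re) := by
  have h := twistedHomNorm_eq (nT := g.fiberNorm x)
    (nV := fun c : DualLine L x => H.fiberNorm x (0, 0, c))
    (nW := fun b : Bundle.Trivial X ℂ x => H.fiberNorm x (0, b, 0)) (tLower t x)
    (exists_eq_smul_tangent x) (exists_eq_smul_lineCoframe x) (g.fiberNorm_smul x)
    (fiberNorm_third_smul H x) (fiberNorm_second_smul H x) (fiberNorm_tangent_one_pos g x)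
    (Real.sqrt_pos.2 ((fiberGram_posDef H x).re_diag_pos 2)) (Real.sqrt_nonneg _)
  have h1 : tLower t x (show TangentSpace 𝓘(ℂ) x from (1 : ℂ)) (lineCoframe L x x) =
      tCoeff t x x (1 : ℂ) • (show Bundle.Trivial X ℂ x from (1 : ℂ)) :=
    (mul_one (M := ℂ) _).symm
  simp only at h
  rw [h1, fiberNorm_second_smul] at h
  exact h

end NormReadings

end

theorem proposition4p3 {X : Type*} [TopologicalSpace X] [ChartedSpace ℂ X] [IsManifold 𝓘(ℂ) ω X]
    [T2Space X] [CompactSpace X] [ConnectedSpace X] (hgenus : 2 ≤ riemannSurfaceGenus X)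
    {L : X → Type*} [TopologicalSpace (Bundle.TotalSpace ℂ L)] [∀ x, AddCommGroup (L x)]
    [∀ x, Module ℂ (L x)] [∀ x, TopologicalSpace (L x)] [∀ x, IsTopologicalAddGroup (L x)]
    [∀ x, ContinuousSMul ℂ (L x)] [FiberBundle ℂ L] [VectorBundle ℂ ℂ L]
    [ContMDiffVectorBundle ω ℂ L 𝓘(ℂ)] (S : CanonicalSquareRoot L)
    (t : Cₛ^ω⟮𝓘(ℂ); ℂ →L[ℂ] ℂ, fun x : X => TangentSpace 𝓘(ℂ) x →L[ℂ] L x⟯)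
    (H : HermitianMetric RankThreeFiber (RankThreeBundle L))
    (hH : SolvesHitchin H (cyclicHiggsField S t))
    (g : HermitianMetric ℂ (TangentSpace 𝓘(ℂ) : X → Type)) (x : X) :
    normTUpper H g t x < normTau H g S x ∧ normTLower H g t x < normTau H g S x := by
  have h := hasCyclicReadings H hH
  have hpos := fun i => (fiberGram_posDef H x).re_diag_pos i
  have hq : 0 < ‖tauCoeff S x x (1 : ℂ)‖ := norm_pos_iff.2 (h.qh_ne x)
  have hup := h.ratioUpper_lt_one (exists_oneFormCoeffs_eq_zero hgenus) (fiberGram_posDef H) x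
  have hlow := h.ratioLower_lt_one (exists_oneFormCoeffs_eq_zero hgenus) (fiberGram_posDef H) x
  rw [ratioUpper, Complex.normSq_eq_norm_sq, Complex.normSq_eq_norm_sq] at hup
  rw [ratioLower, Complex.normSq_eq_norm_sq, Complex.normSq_eq_norm_sq] at hlow
  rw [normTau_eq, normTUpper_eq, normTLower_eq]
  have hg := fiberNorm_tangent_one_pos g x
  exact ⟨div_sqrt_lt_of_ratioUpper_lt_one hq hg (hpos 0) (hpos 1) (hpos 2) hup,
    div_sqrt_lt_of_ratioLower_lt_one hq hg (hpos 0) (hpos 1) (hpos 2) hlow⟩
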